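/- Let $N\ge 1$ be an odd squarefree integer, $k\ge 1$ an odd integer and $p\nmid 2N$ a prime. Write $S_w(M)$ for the cusp forms of weight $w$ on $\Gamma_0(M)$ with trivial character and $a_n(x)$ for the Fourier coefficients of $x$. Put $(Vx)(\tau)=x(p\tau)$, $(Ux)(\tau)=p^{-1}\sum_{b \bmod p}x((\tau+b)/p)$ and $$\langle x,y\rangle=\frac1{[\mathrm{SL}_2(\mathbf Z):\Gamma_0(M)]}\int_{\Gamma_0(M)\backslash\mathcal H}x(\tau)\overline{y(\tau)}\,v^{w-2}\,du\,dv\qquad(\tau=u+iv)$$ for $x,y\in S_w(M)$. View $S_w(M)\otimes S_w(M)$ as a space of functions on $\mathcal H\times\mathcal H$, with $(x\times y)(\tau_1,\tau_2)=x(\tau_1)y(\tau_2)$ and $\langle x'\times y',x\times y\rangle=\langle x',x\rangle\langle y',y\rangle$. A normalised eigenform is an eigenform for all Hecke operators with $a_1=1$. Let $f\in S_{2k}(N)$ be a normalised eigenform (for instance a newform), and let $\alpha_f,\beta_f$, in any order, be the complex numbers with $\alpha_f+\beta_f=a_p(f)$ and $\alpha_f\beta_f=p^{2k-1}$. Let $h=\sum_n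 c(n)q^n\in S_{k+1/2}(N)$ be a form in Kohnen's plus space (cusp forms of weight $k+\frac12$, level $\Gamma_0(4N)$ and trivial character in the sense of Shimura, with $c(n)=0$ unless $(-1)^kn\equiv 0,1 \bmod 4$) which corresponds to $f$ under the Shimura--Shintani correspondence: $T_{\ell^2}h=a_\ell(f)h$ for all odd primes $\ell\nmid N$, where $T_{\ell^2}h$ has $n$-th coefficient $c(\ell^2n)+\left(\frac{(-1)^kn}{\ell}\right)\ell^{k-1}c(n)+\ell^{2k-1}c(n/\ell^2)$. Let $h_\alpha=\sum_n c_\alpha(n)q^n$ with $c_\alpha(n)=\alpha_f^{-1}(c(p^2n)-\beta_fc(n))$. For an integer $M\geq 1$ and $h'=\sum_n c'(n)q^n$ let $$\mathrm{SK}_M(h')(Z)=\sum_{B>0}\Bigl(\sum_{0<d\mid\gcd(B),\,(d,M)=1}d^kc'(\det(2B)/d^2)\Bigr)e^{2\pi i\,\mathrm{Tr}(BZ)}\qquad(Z\in\mathcal H_2),$$ where $B$ runs over the positive definite half-integral symmetric matrices $\begin{pmatrix}n&r/2\\r/2&m\end{pmatrix}$ and $\gcd(B)=\gcd(n,r,m)$.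 Put $F=\mathrm{SK}_N(h)$ and $F_\alpha=\mathrm{SK}_{Np}(h_\alpha)$. Let $\varpi$ denote restriction to the diagonally embedded $\mathcal H\times\mathcal H\subset\mathcal H_2$. Fix a field isomorphism $\iota:\mathbf C\simeq\mathbf C_p$. Let $\phi\in S_{k+1}(N)$ be a normalised eigenform that is ordinary at $p$: there are $\alpha_\phi,\beta_\phi$ with $\alpha_\phi+\beta_\phi=a_p(\phi)$, $\alpha_\phi\beta_\phi=p^k$ and $|\iota(\alpha_\phi)|_p=1$. Let $\phi_\alpha=\phi-\beta_\phi V\phi\in S_{k+1}(Np)$. Let $e_\phi$ be the projector of $S_{k+1}(Np)$ onto the subspace on which $T_\ell$ acts as $a_\ell(\phi)$ for all primes $\ell\nmid Np$, along the sum of the other simultaneous eigenspaces of these operators, and put $\varpi_\phi=(e_\phi\otimes e_\phi)\circ\varpi$. Let $e_{\mathrm{ord}}$ stand for $e_{\mathrm{ord}}\otimes e_{\mathrm{ord}}$, where $e_{\mathrm{ord}}=\lim_{j\to\infty}U^{j!}$ on $S_{k+1}(Np)$, the limit being taken $p$-adically via $\iota$. Put $$\mathcal E^{\circ}(f,\mathrm{Ad}(\phi))=\left(1-\frac{\beta_f}{p^k}\right)\left(1-\frac{\beta_f\beta_\phi/\alpha_\phi}{p^k}\right),\qquad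 \mathcal E(\mathrm{Ad}(\phi))=\left(1-\frac{\beta_\phi}{\alpha_\phi}\right)\left(1-\frac{\beta_\phi}{p\alpha_\phi}\right).$$ Then $\varpi(F)\in S_{k+1}(N)\otimes S_{k+1}(N)$ and $\varpi(F_\alpha)\in S_{k+1}(Np)\otimes S_{k+1}(Np)$, the numbers $\langle\phi,\phi\rangle$, $\langle\phi_\alpha,\phi_\alpha\rangle$ and $\mathcal E(\mathrm{Ad}(\phi))$ are non-zero, and $$\frac{\langle e_{\mathrm{ord}}(\varpi_\phi(F_\alpha)),\phi_\alpha\times\phi_\alpha\rangle}{\langle\phi_\alpha,\phi_\alpha\rangle^2}=\frac{\mathcal E^{\circ}(f,\mathrm{Ad}(\phi))}{\mathcal E(\mathrm{Ad}(\phi))}\cdot\frac{\langle\varpi(F),\phi\times\phi\rangle}{\langle\phi,\phi\rangle^2}.$$ -/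

import Mathlib

open UpperHalfPlane Filter Topology MeasureTheory
open scoped MatrixGroups Modular Manifold

noncomputable section

namespace SKPullback

/-! ### Cusp forms of integral weight -/

/-- The space `S_w(M)` of cusp forms of weight `w` for `Γ₀(M)` (trivial character), seen inside the
space of all functions on the upper half-plane. -/
def cuspSpace (M : ℕ) (w : ℤ) : Submodule ℂ (ℍ → ℂ) where
  carrier := {x | ∃ X : CuspForm ((CongruenceSubgroup.Gamma0 M : Subgroup SL(2, ℤ)) :
    Subgroup (GL (Fin 2) ℝ)) w, ⇑X = x}
  zero_mem' := ⟨0, rfl⟩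
  add_mem' := by
    rintro _ _ ⟨X, rfl⟩ ⟨Y, rfl⟩
    exact ⟨X + Y, rfl⟩
  smul_mem' := by
    rintro c _ ⟨X, rfl⟩
    exact ⟨c • X, rfl⟩

/-- `a_n(x)`, the `n`-th coefficient of the `q`-expansion of `x`, with `q = exp(2πiτ)`. -/
def fourierCoeff (x : ℍ → ℂ) (n : ℕ) : ℂ := (qExpansion 1 x).coeff n

/-- `(U_p x)(τ) = p⁻¹ ∑_{b mod p} x((τ + b) / p)`; on `q`-expansions `∑ a_{pn} q^n`. -/
def opU (p : ℕ) : (ℍ → ℂ) →ₗ[ℂ] (ℍ → ℂ) where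
  toFun x := fun τ => (p : ℂ)⁻¹ * ∑ b ∈ Finset.range p, x (ofComplex (((τ : ℂ) + b) / p))
  map_add' x y := by
    funext τ
    simp [Finset.sum_add_distrib, mul_add]
  map_smul' c x := by
    funext τ
    simp only [Pi.smul_apply, smul_eq_mul, RingHom.id_apply, ← Finset.mul_sum]
    ring

/-- `(V_p x)(τ) = x(pτ)`; on `q`-expansions `∑ a_n q^{pn}`. -/
def opV (p : ℕ) : (ℍ → ℂ) →ₗ[ℂ] (ℍ → ℂ) where
  toFun x := fun τ => x (ofComplex ((p : ℂ) * τ))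
  map_add' _ _ := rfl
  map_smul' _ _ := rfl

/-- The Hecke operator `T_ℓ = U_ℓ + ℓ^{w-1} V_ℓ` in weight `w` (for `ℓ` prime to the level). -/
def heckeT (w : ℤ) (l : ℕ) : (ℍ → ℂ) →ₗ[ℂ] (ℍ → ℂ) := opU l + ((l : ℂ) ^ (w - 1)) • opV l

/-- Normalised eigenforms `φ ∈ S_w(M)` for all Hecke operators: `a_1(φ) = 1`, and `φ` is an
eigenvector of `T_ℓ` (`ℓ ∤ M`) and `U_ℓ` (`ℓ ∣ M`) for all primes `ℓ`, with eigenvalue `a_ℓ(φ)`. -/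
structure IsNormalisedEigenform (M : ℕ) (w : ℤ) (φ : ℍ → ℂ) : Prop where
  mem : φ ∈ cuspSpace M w
  coeff_one : fourierCoeff φ 1 = 1
  hecke : ∀ l : ℕ, l.Prime → ¬ l ∣ M → heckeT w l φ = fourierCoeff φ l • φ
  hecke_bad : ∀ l : ℕ, l.Prime → l ∣ M → opU l φ = fourierCoeff φ l • φ

/-- The `p`-stabilisation `φ_α = (1 - β V_p) φ`. -/
def stabilisation (p : ℕ) (β : ℂ) (φ : ℍ → ℂ) : ℍ → ℂ := φ - β • opV p φ

/-- The Petersson product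
`⟨x, y⟩ = [SL₂(ℤ) : Γ₀(M)]⁻¹ ∫_{Γ₀(M)\ℍ} x(τ) conj(y(τ)) Im(τ)^w du dv / v²` in weight `w`.
The integral over `Γ₀(M)\ℍ` is taken over the union of the translates `γ⁻¹ 𝒟` of the standard
fundamental domain `𝒟` of `SL₂(ℤ)`, where `γ` runs over representatives of `SL₂(ℤ)/Γ₀(M)`; Mathlib's
measure on `ℍ` is `du dv / v²`, and its `petersson w y x` is `conj y * x * Im^w`. -/
def peterssonProduct (M : ℕ) (w : ℤ) (x y : ℍ → ℂ) : ℂ :=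
  ((CongruenceSubgroup.Gamma0 M).index : ℂ)⁻¹ *
    ∑ᶠ γ : SL(2, ℤ) ⧸ CongruenceSubgroup.Gamma0 M,
      ∫ τ in 𝒟, petersson w y x ((Quotient.out γ)⁻¹ • τ)

/-! ### Isotypic components -/

/-- The simultaneous eigenspace in `S_w(M)` of all `T_ℓ`, `ℓ ∤ M` prime, for the system of
eigenvalues `e`. -/
def heckeEigenspace (M : ℕ) (w : ℤ) (e : ℕ → ℂ) : Submodule ℂ (ℍ → ℂ) where
  carrier := {x | x ∈ cuspSpace M w ∧ ∀ l : ℕ, l.Prime → ¬ l ∣ M → heckeT w l x = e l • x}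
  zero_mem' := ⟨zero_mem _, fun l _ _ => by simp⟩
  add_mem' := by
    rintro x y ⟨hx, hx'⟩ ⟨hy, hy'⟩
    exact ⟨add_mem hx hy, fun l h₁ h₂ => by rw [map_add, hx' l h₁ h₂, hy' l h₁ h₂, smul_add]⟩
  smul_mem' := by
    rintro c x ⟨hx, hx'⟩
    exact ⟨Submodule.smul_mem _ c hx, fun l h₁ h₂ => by
      rw [map_smul, hx' l h₁ h₂, smul_comm]⟩

/-- The component `S_w(M)[φ]` attached to the eigensystem `(a_ℓ(φ))_{ℓ ∤ M}`. -/
def isotypic (M : ℕ) (w : ℤ) (φ : ℍ → ℂ) : Submodule ℂ (ℍ → ℂ) :=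
  heckeEigenspace M w (fourierCoeff φ)

/-- The sum of the components of `S_w(M)` for all the other eigensystems. -/
def isotypicCompl (M : ℕ) (w : ℤ) (φ : ℍ → ℂ) : Submodule ℂ (ℍ → ℂ) :=
  ⨆ (e : ℕ → ℂ) (_ : ∃ l : ℕ, l.Prime ∧ ¬ l ∣ M ∧ e l ≠ fourierCoeff φ l),
    heckeEigenspace M w e

open Classical in
/-- The projector `e_φ` of `S_w(M)` onto the component `S_w(M)[φ]`, for the decomposition of `S_w(M)`
into the simultaneous eigenspaces of the `T_ℓ`, `ℓ ∤ M` (and `0` outside `S_w(M)`). -/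
def isotypicProj (M : ℕ) (w : ℤ) (φ : ℍ → ℂ) (x : ℍ → ℂ) : ℍ → ℂ :=
  if h : ∃ x' ∈ isotypic M w φ, x - x' ∈ isotypicCompl M w φ then h.choose else 0

/-! ### The ordinary projector -/

open Classical in
/-- Hida's ordinary projector `e_ord = lim U_p^{j!}` on `S_w(M)`, `p ∣ M`, the limit being `p`-adic
with respect to a field isomorphism `ι : ℂ ≃ ℂ_p`. As `S_w(M)` is finite-dimensional and its elements
are determined by their `q`-expansions, this is a limit coefficient by coefficient. -/
def ordProj (p : ℕ) [Fact p.Prime] (ι : ℂ ≃+* ℂ_[p]) (M : ℕ) (w : ℤ) (x : ℍ → ℂ) : ℍ → ℂ :=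
  if h : ∃ x' ∈ cuspSpace M w, ∀ n : ℕ,
      Tendsto (fun j : ℕ => ι (fourierCoeff ((opU p)^[j.factorial] x) n)) atTop
        (𝓝 (ι (fourierCoeff x' n)))
  then h.choose else 0

/-! ### Functions on `ℍ × ℍ` -/

/-- `A ⊗ B`, realised as the span of the functions `(x × y)(τ₁, τ₂) = x(τ₁) y(τ₂)`, for `x ∈ A` and
`y ∈ B`. -/
def boxTensor (A B : Submodule ℂ (ℍ → ℂ)) : Submodule ℂ (ℍ → ℍ → ℂ) :=
  Submodule.span ℂ {Ψ | ∃ x ∈ A, ∃ y ∈ B, Ψ = fun τ₁ τ₂ => x τ₁ * y τ₂}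

/-- `T ⊗ T` for an operator `T`: apply `T` in the first variable and then in the second one. -/
def onBoth (T : (ℍ → ℂ) → (ℍ → ℂ)) (Ψ : ℍ → ℍ → ℂ) : ℍ → ℍ → ℂ :=
  fun τ₁ τ₂ => T (fun t₂ => T (fun t₁ => Ψ t₁ t₂) τ₁) τ₂

/-- The Petersson product `⟨Ψ, x × y⟩` on `S_w(M) ⊗ S_w(M)`, characterised by
`⟨x' × y', x × y⟩ = ⟨x', x⟩ ⟨y', y⟩`. -/
def peterssonProduct₂ (M : ℕ) (w : ℤ) (Ψ : ℍ → ℍ → ℂ) (x y : ℍ → ℂ) : ℂ :=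
  peterssonProduct M w (fun τ₂ => peterssonProduct M w (fun τ₁ => Ψ τ₁ τ₂) x) y

/-! ### Half-integral weight -/

/-- `θ(τ) = ∑_{n ∈ ℤ} exp(2πi n² τ)`. -/
def theta (τ : ℍ) : ℂ := jacobiTheta (2 * (τ : ℂ))

/-- Kohnen's plus space `S_{k+1/2}(N)`: cusp forms, in the sense of Shimura, of weight `k + 1/2`,
level `Γ₀(4N)` and trivial character, whose coefficients `c(n)` vanish unless
`(-1)^k n ≡ 0, 1 (mod 4)`. -/
structure IsKohnenPlusForm (N k : ℕ) (h : ℍ → ℂ) : Prop where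
  holo : MDifferentiable 𝓘(ℂ) 𝓘(ℂ) h
  automorphy : ∀ γ ∈ CongruenceSubgroup.Gamma0 (4 * N), ∀ τ : ℍ,
    h (γ • τ) = (theta (γ • τ) / theta τ) ^ (2 * k + 1) * h τ
  cuspidal : ∀ γ : SL(2, ℤ), IsZeroAtImInfty fun τ : ℍ =>
    ((‖(γ 1 0 : ℂ) * τ + (γ 1 1 : ℂ)‖ ^ (-((k : ℝ) + 1 / 2)) : ℝ) : ℂ) * h (γ • τ)
  plus : ∀ n : ℕ, fourierCoeff h n ≠ 0 →
    ((-1) ^ k * (n : ℤ)) % 4 = 0 ∨ ((-1) ^ k * (n : ℤ)) % 4 = 1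

/-- The `n`-th coefficient of `T_{ℓ²} h`, for an odd prime `ℓ` prime to the level and
`h = ∑ c(n) q^n` of weight `k + 1/2`:
`c(ℓ² n) + ((-1)^k n / ℓ) ℓ^{k-1} c(n) + ℓ^{2k-1} c(n / ℓ²)`. -/
def heckeTsqCoeff (k l : ℕ) (c : ℕ → ℂ) (n : ℕ) : ℂ :=
  c (l ^ 2 * n) + (jacobiSym ((-1) ^ k * (n : ℤ)) l : ℂ) * (l : ℂ) ^ (k - 1) * c n +
    (l : ℂ) ^ (2 * k - 1) * (if l ^ 2 ∣ n then c (n / l ^ 2) else 0)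

/-- `h` and the eigenform `f` of weight `2k` are in Shimura--Shintani correspondence:
`T_{ℓ²} h = a_ℓ(f) h` for all odd primes `ℓ ∤ N`. -/
def InShimuraShintani (N k : ℕ) (f h : ℍ → ℂ) : Prop :=
  ∀ l : ℕ, l.Prime → l ≠ 2 → ¬ l ∣ N → ∀ n : ℕ,
    heckeTsqCoeff k l (fourierCoeff h) n = fourierCoeff f l * fourierCoeff h n

/-- The coefficients `c_α(n)` of the `p`-stabilisation `h_α = α⁻¹ (U_{p²} - β) h`, in terms of those
of `h`. -/
def stabCoeff (p : ℕ) (α β : ℂ) (c : ℕ → ℂ) (n : ℕ) : ℂ := α⁻¹ * (c (p ^ 2 * n) - β * c n)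

/-! ### Genus two -/

/-- Siegel's upper half-space `ℋ₂` of genus two. -/
def SiegelUpperHalfSpace : Type :=
  {Z : Matrix (Fin 2) (Fin 2) ℂ // Z.IsSymm ∧ (Z.map Complex.im).PosDef}

/-- The diagonal embedding `ℍ × ℍ → ℋ₂`. -/
def diagEmbedding (τ₁ τ₂ : ℍ) : SiegelUpperHalfSpace :=
  ⟨Matrix.diagonal ![(τ₁ : ℂ), (τ₂ : ℂ)], Matrix.isSymm_diagonal _, by
    have : (Matrix.diagonal ![(τ₁ : ℂ), (τ₂ : ℂ)]).map Complex.im =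
        Matrix.diagonal ![τ₁.im, τ₂.im] := by
      ext i j
      fin_cases i <;> fin_cases j <;> simp
    rw [this]
    refine Matrix.PosDef.diagonal fun i => ?_
    fin_cases i
    · exact τ₁.im_pos
    · exact τ₂.im_pos⟩

/-- The pullback `ϖ(Φ)` of a function on `ℋ₂` to the diagonal. -/
def pullback (Φ : SiegelUpperHalfSpace → ℂ) : ℍ → ℍ → ℂ := fun τ₁ τ₂ => Φ (diagEmbedding τ₁ τ₂)

/-- Triples `(n, r, m)`, standing for the half-integral symmetric positive definite matrices
`B = (n, r/2; r/2, m)`; note that `det (2B) = 4nm - r²`. -/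
def HalfIntegralForm : Type :=
  {B : ℤ × ℤ × ℤ // 0 < B.1 ∧ 0 < 4 * B.1 * B.2.2 - B.2.1 ^ 2}

namespace HalfIntegralForm

def toMatrix (B : HalfIntegralForm) : Matrix (Fin 2) (Fin 2) ℂ :=
  !![(B.1.1 : ℂ), (B.1.2.1 : ℂ) / 2; (B.1.2.1 : ℂ) / 2, (B.1.2.2 : ℂ)]

/-- `det (2B)`, a positive integer. -/
def disc (B : HalfIntegralForm) : ℕ := (4 * B.1.1 * B.1.2.2 - B.1.2.1 ^ 2).toNat

/-- `gcd(B) = gcd(n, r, m)`. -/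
def content (B : HalfIntegralForm) : ℕ := Int.gcd B.1.1 (Int.gcd B.1.2.1 B.1.2.2 : ℤ)

end HalfIntegralForm

/-- The coefficient `A(B) = ∑_{0 < d ∣ gcd(B), (d, M) = 1} d^k c(det(2B)/d²)`. -/
def saitoKurokawaCoeff (M k : ℕ) (c : ℕ → ℂ) (B : HalfIntegralForm) : ℂ :=
  ∑ d ∈ B.content.divisors with d.Coprime M, (d : ℂ) ^ k * c (B.disc / d ^ 2)

/-- The Saito--Kurokawa lift `SK_M(h) = ∑_{B > 0} A(B) exp(2πi Tr(BZ))` of `h = ∑ c(n) q^n` in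
level `M`. -/
def saitoKurokawa (M k : ℕ) (c : ℕ → ℂ) (Z : SiegelUpperHalfSpace) : ℂ :=
  ∑' B : HalfIntegralForm, saitoKurokawaCoeff M k c B *
    Complex.exp (2 * Real.pi * Complex.I * (B.toMatrix * Z.1).trace)

/-! ### Euler factors -/

/-- `ℰ°(f, Ad φ) = (1 - β_f / p^k) (1 - (β_f β_φ / α_φ) / p^k)`. -/
def eulerCirc (p k : ℕ) (βf α β : ℂ) : ℂ :=
  (1 - βf / (p : ℂ) ^ k) * (1 - (βf * β / α) / (p : ℂ) ^ k)

/-- `ℰ(Ad φ) = (1 - β_φ / α_φ) (1 - β_φ / (p α_φ))`. -/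
def eulerAd (p : ℕ) (α β : ℂ) : ℂ := (1 - β / α) * (1 - β / ((p : ℂ) * α))

end SKPullback

end

/-! Everything reduces to one variable. Let G = ∑ₙ (∑ᵣ c(4n − r²)) qⁿ (`plusProd 1 h`), the form hθ
followed by U₄. It lies in S_{k+1}(N): the plus condition lets the level drop from 4N to N, and k
odd makes the automorphy factor of hθ exactly (cτ+d)^{k+1}. Summing the coefficients of the lift
over the off-diagonal entry r turns the divisor sum into Hecke operators, so ϖ(F) = ∑ₘ (T_m G)(τ₁)
q₂^m (`pullback_saitoKurokawa`). In the same way ϖ(F_α) is the kernel of level Np attached to G_α =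
∑ₙ (∑ᵣ c_α(4n − r²)) qⁿ (`stabProd`). As a_j(T_m g) = a_m(T_j g), and finitely many coefficients
determine a cusp form, such a kernel is a finite sum of products of cusp forms.

Let Φ(x) = ⟨e_ord e_φ x, φ_α⟩ and let Λ(g) be Φ ⊗ Φ applied to the kernel of g in level Np. Four
facts give the identity. (1) Φ(Ux) = αΦ(x), because U_p satisfies the Hecke polynomial of φ on the
whole φ-component of level Np (`opU_opU_of_isotypic`, a form of strong multiplicity one) and e_ord
is there the projector (α − β)⁻¹(U − β) (`ordProj_of_isotypic`). Since U commutes with every T_m of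
level Np, also Λ(Ug) = αΛ(g). As UV = 1, Φ(Vx) = α⁻¹Φ(x) for x of level N. (2) The action of T_{p²}
on h gives (U² − p^{k−1}) G_α = (1 − α_f⁻¹p^{k−1})(U² − β_f) G (`opU_opU_stabProd`), so (α² −
p^{k−1}) Λ(G_α) = (1 − β_f/p^k)(α² − β_f) Λ(G). (3) Passing from level N to Np subtracts p^k (V × V)
from the kernel, and Φ is a multiple κ⟨·, φ⟩ on level N. Hence Λ(G) = (1 − β/α) κ² ⟨ϖ(F), φ × φ⟩
(`boxEval_heckeKernel_level`). (4) Applying Φ to φ_α = φ − βVφ gives ⟨φ_α, φ_α⟩ = (1 − β/α) κ ⟨φ,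
φ⟩. In the quotient κ cancels, and αβ = p^k rewrites the remaining factors as the two Euler factors.
-/

noncomputable section

namespace SKPullback

open CongruenceSubgroup Matrix.SpecialLinearGroup OnePoint
open scoped ModularForm

local notation "𝕢" => Function.Periodic.qParam

section

/-! ### Cusp forms of arbitrary congruence level -/

/-- The diagonal matrix `diag(a, d)`, as a rational matrix. -/
def diagQ (a d : ℕ) [NeZero a] [NeZero d] : GL (Fin 2) ℚ :=
  Matrix.GeneralLinearGroup.mkOfDetNeZero !![(a : ℚ), 0; 0, (d : ℚ)]
    (by simp [NeZero.ne])

/-- The diagonal matrix `diag(a, d)`, as a real matrix. -/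
def diagR (a d : ℕ) [NeZero a] [NeZero d] : GL (Fin 2) ℝ :=
  (diagQ a d).map (Rat.castHom ℝ)

section diag

variable (a d : ℕ) [NeZero a] [NeZero d]

lemma diagR_val : (diagR a d).val = !![(a : ℝ), 0; 0, (d : ℝ)] := by
  ext i j
  fin_cases i <;> fin_cases j <;> simp [diagR, diagQ, Matrix.GeneralLinearGroup.mkOfDetNeZero]

lemma diagR_det : (diagR a d).det.val = a * d := by
  rw [Matrix.GeneralLinearGroup.val_det_apply, diagR_val]; simp

lemma diagR_det_pos : 0 < (diagR a d).det.val := by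
  rw [diagR_det]
  have := NeZero.pos a
  have := NeZero.pos d
  positivity

lemma denom_diagR (τ : ℂ) : denom (diagR a d) τ = d := by
  simp [denom, diagR_val]

lemma coe_diagR_smul (τ : ℍ) : ((diagR a d • τ : ℍ) : ℂ) = a * τ / d := by
  rw [coe_smul_of_det_pos (diagR_det_pos a d)]
  simp [num, denom, diagR_val]

lemma slash_diagR (w : ℤ) (x : ℍ → ℂ) (τ : ℍ) :
    (x ∣[w] diagR a d) τ = ((a : ℂ) * d) ^ (w - 1) * (d : ℂ) ^ (-w) * x (diagR a d • τ) := by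
  rw [ModularForm.slash_apply, denom_diagR, diagR_det, σ, if_pos (diagR_det_pos a d)]
  have : |((a : ℝ) * d)| = a * d := abs_of_nonneg (by positivity)
  simp only [this, ContinuousAlgEquiv.refl_apply]
  push_cast
  ring

end diag

lemma Gamma_le_of_dvd {n m : ℕ} (h : n ∣ m) : Gamma m ≤ Gamma n := fun γ hγ => by
  rw [Gamma_mem] at hγ ⊢
  have h1 := congrArg (ZMod.castHom h (ZMod n)) hγ.1
  have h2 := congrArg (ZMod.castHom h (ZMod n)) hγ.2.1
  have h3 := congrArg (ZMod.castHom h (ZMod n)) hγ.2.2.1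
  have h4 := congrArg (ZMod.castHom h (ZMod n)) hγ.2.2.2
  simp only [map_intCast, map_one, map_zero] at h1 h2 h3 h4
  exact ⟨h1, h2, h3, h4⟩

/-- Cusp forms of weight `w` for some principal congruence subgroup, as functions on `ℍ`. -/
def cuspFn (w : ℤ) : Submodule ℂ (ℍ → ℂ) where
  carrier := {x | MDifferentiable 𝓘(ℂ) 𝓘(ℂ) x ∧ (∃ n : ℕ, n ≠ 0 ∧ ∀ γ ∈ Gamma n, x ∣[w] γ = x) ∧
    ∀ γ : SL(2, ℤ), IsZeroAtImInfty (x ∣[w] γ)}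
  zero_mem' := by
    refine ⟨mdifferentiable_const, ⟨1, one_ne_zero, by simp⟩, fun γ => ?_⟩
    rw [SlashAction.zero_slash]
    exact zero_zeroAtFilter _
  add_mem' := by
    rintro x y ⟨hx, ⟨n, hn, hxn⟩, hx'⟩ ⟨hy, ⟨m, hm, hym⟩, hy'⟩
    refine ⟨hx.add hy, ⟨n * m, mul_ne_zero hn hm, fun γ hγ => ?_⟩, fun γ => ?_⟩
    · have h1 : γ ∈ Gamma n := Gamma_le_of_dvd (Dvd.intro m rfl) hγ
      have h1' : γ ∈ Gamma m := Gamma_le_of_dvd (Dvd.intro_left n rfl) hγ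
      rw [SlashAction.add_slash, hxn _ h1, hym _ h1']
    · rw [SlashAction.add_slash]
      exact (hx' γ).add (hy' γ)
  smul_mem' := by
    rintro c x ⟨hx, ⟨n, hn, hxn⟩, hx'⟩
    refine ⟨hx.const_smul c, ⟨n, hn, fun γ hγ => ?_⟩, fun γ => ?_⟩
    · rw [ModularForm.SL_smul_slash, hxn _ hγ]
    · rw [ModularForm.SL_smul_slash]
      exact (hx' γ).smul c

variable {w : ℤ} {x y : ℍ → ℂ}

lemma SL_slash_eq (γ : SL(2, ℤ)) : x ∣[w] γ = x ∣[w] (mapGL ℝ γ) := rfl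

lemma map_mapGL_rat (γ : SL(2, ℤ)) : (mapGL ℚ γ).map (Rat.castHom ℝ) = mapGL ℝ γ := by
  ext i j
  simp

lemma isZeroAt_of_forall_SL (h : ∀ γ : SL(2, ℤ), IsZeroAtImInfty (x ∣[w] γ)) {c : OnePoint ℝ}
    (hc : IsCusp c 𝒮ℒ) : c.IsZeroAt x w :=
  (isZeroAt_iff_forall_SL2Z hc).mpr fun γ _ => h γ

/-- Elements of `cuspFn` invariant under a finite index subgroup, as cusp forms. -/
def toCuspForm {Γ : Subgroup SL(2, ℤ)} [Γ.FiniteIndex] (hx : x ∈ cuspFn w)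
    (h : ∀ γ ∈ Γ, x ∣[w] γ = x) : CuspForm (Γ : Subgroup (GL (Fin 2) ℝ)) w where
  toFun := x
  slash_action_eq' := by
    rintro _ ⟨γ, hγ, rfl⟩
    exact h γ hγ
  holo' := hx.1
  zero_at_cusps' hc := isZeroAt_of_forall_SL hx.2.2
    ((Subgroup.IsArithmetic.isCusp_iff_isCusp_SL2Z _).mp hc)

instance Gamma_finiteIndex (n : ℕ) [NeZero n] : (Gamma n).FiniteIndex := inferInstance

instance Gamma0_finiteIndex (n : ℕ) [NeZero n] : (Gamma0 n).FiniteIndex :=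
  (Gamma0_is_congruence n).finiteIndex

lemma Gamma_le_Gamma0 (M : ℕ) : Gamma M ≤ Gamma0 M := fun γ hγ => by
  rw [Gamma_mem] at hγ
  exact Gamma0_mem.mpr hγ.2.2.1

lemma mem_cuspSpace_iff {M : ℕ} [NeZero M] :
    x ∈ cuspSpace M w ↔ x ∈ cuspFn w ∧ ∀ γ ∈ Gamma0 M, x ∣[w] γ = x := by
  constructor
  · rintro ⟨X, rfl⟩
    have hinv : ∀ γ ∈ Gamma0 M, (⇑X : ℍ → ℂ) ∣[w] γ = X := fun γ hγ =>
      X.slash_action_eq' _ (Subgroup.mem_map_of_mem _ hγ)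
    exact ⟨⟨X.holo', ⟨M, NeZero.ne M, fun γ hγ => hinv γ (Gamma_le_Gamma0 M hγ)⟩,
      fun γ => CuspFormClass.zero_at_infty_slash X γ⟩, hinv⟩
  · rintro ⟨h, h'⟩
    exact ⟨toCuspForm h h', rfl⟩

/-- A rational conjugate of a principal congruence subgroup contains another one, and GL₂(ℚ)
permutes the rational cusps. This closure is the reason for not fixing a level. -/
lemma slash_mem_cuspFn (hx : x ∈ cuspFn w) (g : GL (Fin 2) ℚ) :
    x ∣[w] (g.map (Rat.castHom ℝ)) ∈ cuspFn w := by
  obtain ⟨hx1, ⟨n, hn, hxn⟩, hx2⟩ := hx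
  have : NeZero n := ⟨hn⟩
  refine ⟨hx1.slash w _, ?_, fun γ => ?_⟩
  · obtain ⟨m, hm, hmn⟩ := exists_Gamma_le_conj' g n
    refine ⟨m, hm, fun γ hγ => ?_⟩
    have h1 := hmn (Subgroup.smul_mem_pointwise_smul _ _ _ (Subgroup.mem_map_of_mem (mapGL ℝ) hγ))
    obtain ⟨δ, hδ, hδ'⟩ := h1
    rw [ConjAct.smul_def, ConjAct.ofConjAct_toConjAct] at hδ'
    rw [SL_slash_eq, ← SlashAction.slash_mul]
    have h2 : g.map (Rat.castHom ℝ) * mapGL ℝ γ = mapGL ℝ δ * g.map (Rat.castHom ℝ) := by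
      rw [hδ']; group
    rw [h2, SlashAction.slash_mul]
    congr 1
    exact hxn δ hδ
  · rw [SL_slash_eq, ← SlashAction.slash_mul, ← OnePoint.isZeroAt_infty_iff (k := w),
      ← OnePoint.IsZeroAt.smul_iff]
    apply isZeroAt_of_forall_SL hx2
    rw [isCusp_SL2Z_iff]
    refine ⟨(g * mapGL ℚ γ) • ∞, ?_⟩
    rw [← Rat.coe_castHom, OnePoint.map_smul, OnePoint.map_infty, map_mul,
      map_mapGL_rat]

lemma slash_SL_mem_cuspFn (hx : x ∈ cuspFn w) (γ : SL(2, ℤ)) : x ∣[w] γ ∈ cuspFn w := by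
  have := slash_mem_cuspFn hx (mapGL ℚ γ)
  rwa [map_mapGL_rat] at this

lemma slash_diagR_mem_cuspFn (hx : x ∈ cuspFn w) (a d : ℕ) [NeZero a] [NeZero d] :
    x ∣[w] diagR a d ∈ cuspFn w :=
  slash_mem_cuspFn hx (diagQ a d)

lemma cuspSpace_le_cuspFn {M : ℕ} [NeZero M] (hx : x ∈ cuspSpace M w) : x ∈ cuspFn w :=
  (mem_cuspSpace_iff.mp hx).1

lemma cuspSpace_inv {M : ℕ} [NeZero M] (hx : x ∈ cuspSpace M w) {γ : SL(2, ℤ)}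
    (hγ : γ ∈ Gamma0 M) : x ∣[w] γ = x :=
  (mem_cuspSpace_iff.mp hx).2 γ hγ

lemma Gamma0_mem_iff {M : ℕ} {γ : SL(2, ℤ)} : γ ∈ Gamma0 M ↔ (M : ℤ) ∣ γ 1 0 := by
  rw [Gamma0_mem, ZMod.intCast_zmod_eq_zero_iff_dvd]

lemma cuspSpace_mono {M M' : ℕ} [NeZero M] [NeZero M'] (h : M ∣ M') (hx : x ∈ cuspSpace M w) :
    x ∈ cuspSpace M' w := by
  rw [mem_cuspSpace_iff] at hx ⊢
  refine ⟨hx.1, fun γ hγ => hx.2 γ ?_⟩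
  rw [Gamma0_mem_iff] at hγ ⊢
  exact (Int.natCast_dvd_natCast.mpr h).trans hγ

/-! ### The operators `U` and `V` as slash operators -/

lemma T_pow_mem_Gamma0 (M : ℕ) (n : ℤ) : ModularGroup.T ^ n ∈ Gamma0 M := by
  rw [Gamma0_mem_iff, ModularGroup.coe_T_zpow]
  simp

lemma slash_T_pow (n : ℤ) (τ : ℍ) :
    (x ∣[w] (ModularGroup.T ^ n : SL(2, ℤ))) τ = x ((n : ℝ) +ᵥ τ) := by
  have : denom (ModularGroup.T ^ n : SL(2, ℤ)) τ = 1 := by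
    rw [ModularGroup.denom_apply, ModularGroup.coe_T_zpow]
    simp
  rw [ModularForm.SL_slash_apply, modular_T_zpow_smul, this, one_zpow, mul_one]

lemma opV_apply (p : ℕ) [NeZero p] (τ : ℍ) : opV p x τ = x (diagR p 1 • τ) := by
  have : ((p : ℂ) * τ) = ((diagR p 1 • τ : ℍ) : ℂ) := by rw [coe_diagR_smul]; simp
  simp only [opV, LinearMap.coe_mk, AddHom.coe_mk]
  rw [this, ofComplex_apply]

lemma smul_opV (p : ℕ) [NeZero p] (w : ℤ) (x : ℍ → ℂ) :
    (p : ℂ) ^ (w - 1) • opV p x = x ∣[w] diagR p 1 := by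
  funext τ
  rw [Pi.smul_apply, slash_diagR, opV_apply]
  simp

lemma opU_apply (p : ℕ) [NeZero p] (τ : ℍ) :
    opU p x τ = (p : ℂ)⁻¹ * ∑ b ∈ Finset.range p, x (diagR 1 p • (((b : ℤ) : ℝ) +ᵥ τ)) := by
  simp only [opU, LinearMap.coe_mk, AddHom.coe_mk]
  congr 1
  refine Finset.sum_congr rfl fun b _ => ?_
  have : ((τ : ℂ) + b) / p = ((diagR 1 p • (((b : ℤ) : ℝ) +ᵥ τ) : ℍ) : ℂ) := by
    rw [coe_diagR_smul, coe_vadd]; simp [add_comm]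
  rw [this, ofComplex_apply]

lemma opU_eq_sum_slash (p : ℕ) [NeZero p] (w : ℤ) (x : ℍ → ℂ) :
    opU p x = ∑ b ∈ Finset.range p,
      (x ∣[w] diagR 1 p) ∣[w] (ModularGroup.T ^ (b : ℤ) : SL(2, ℤ)) := by
  funext τ
  rw [opU_apply, Finset.sum_apply, Finset.mul_sum]
  refine Finset.sum_congr rfl fun b _ => ?_
  rw [slash_T_pow, slash_diagR]
  have hp : (p : ℂ) ≠ 0 := by simp [NeZero.ne]
  congr 1
  rw [Nat.cast_one, one_mul, ← zpow_add₀ hp, show w - 1 + -w = -1 by ring, zpow_neg_one]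

lemma heckeT_eq (p : ℕ) [NeZero p] (w : ℤ) (x : ℍ → ℂ) :
    heckeT w p x = ∑ b ∈ Finset.range p,
      (x ∣[w] diagR 1 p) ∣[w] (ModularGroup.T ^ (b : ℤ) : SL(2, ℤ)) + x ∣[w] diagR p 1 := by
  rw [heckeT, LinearMap.add_apply, LinearMap.smul_apply, smul_opV, ← opU_eq_sum_slash]

lemma opU_mem_cuspFn (p : ℕ) [NeZero p] (hx : x ∈ cuspFn w) : opU p x ∈ cuspFn w := by
  rw [opU_eq_sum_slash p w]
  exact Submodule.sum_mem _ fun b _ => slash_SL_mem_cuspFn (slash_diagR_mem_cuspFn hx _ _) _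

lemma opV_mem_cuspFn (p : ℕ) [NeZero p] (hx : x ∈ cuspFn w) : opV p x ∈ cuspFn w := by
  have h := Submodule.smul_mem _ ((p : ℂ) ^ (w - 1))⁻¹ (slash_diagR_mem_cuspFn hx p 1)
  rwa [← smul_opV, inv_smul_smul₀] at h
  exact zpow_ne_zero _ (by simp [NeZero.ne])

/-- Summing a `K`-invariant function over representatives of `K \ H` yields an `H`-invariant
function. -/
lemma sum_slash_reps {ι : Type*} [Fintype ι] (K H : Subgroup SL(2, ℤ)) (f : ℍ → ℂ)
    (hf : ∀ γ ∈ K, f ∣[w] γ = f) (r : ι → SL(2, ℤ)) (hr : ∀ i, r i ∈ H)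
    (hsurj : ∀ γ ∈ H, ∃ i, γ * (r i)⁻¹ ∈ K) (hinj : ∀ i j, r i * (r j)⁻¹ ∈ K → i = j)
    (γ : SL(2, ℤ)) (hγ : γ ∈ H) : (∑ i, f ∣[w] r i) ∣[w] γ = ∑ i, f ∣[w] r i := by
  choose π hπ using fun i => hsurj (r i * γ) (H.mul_mem (hr i) hγ)
  have hπi : Function.Injective π := fun i j hij => by
    refine hinj i j ?_
    have h1 := hπ i
    rw [hij] at h1
    have := K.mul_mem h1 (K.inv_mem (hπ j))
    convert! this using 1
    group
  have hb : Function.Bijective π := Finite.injective_iff_bijective.mp hπi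
  rw [SlashAction.sum_slash]
  conv_rhs => rw [← hb.sum_comp]
  refine Finset.sum_congr rfl fun i _ => ?_
  rw [← SlashAction.slash_mul, show r i * γ = (r i * γ * (r (π i))⁻¹) * r (π i) by group,
    SlashAction.slash_mul, hf _ (hπ i)]

/-- The subgroup `Γ₀(M) ∩ Γ⁰(p)`. -/
def Gamma00 (M p : ℕ) : Subgroup SL(2, ℤ) where
  carrier := {γ | (M : ℤ) ∣ γ 1 0 ∧ (p : ℤ) ∣ γ 0 1}
  one_mem' := by simp
  mul_mem' := by
    rintro a b ⟨h1, h2⟩ ⟨h3, h4⟩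
    refine ⟨?_, ?_⟩
    · simp only [coe_mul, Matrix.mul_apply, Fin.sum_univ_two]
      exact dvd_add (h1.mul_right _) (h3.mul_left _)
    · simp only [coe_mul, Matrix.mul_apply, Fin.sum_univ_two]
      exact dvd_add (h4.mul_left _) (h2.mul_right _)
  inv_mem' := by
    rintro a ⟨h1, h2⟩
    change (M : ℤ) ∣ a⁻¹ 1 0 ∧ (p : ℤ) ∣ a⁻¹ 0 1
    rw [SL2_inv_expl]
    simpa using ⟨h1, h2⟩

lemma SL_det (γ : SL(2, ℤ)) : γ 0 0 * γ 1 1 - γ 0 1 * γ 1 0 = 1 := by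
  have := γ.det_coe
  rwa [Matrix.det_fin_two] at this

/-- Conjugating elements with lower left (upper right) entry divisible by `p`. -/
lemma diagR_mul_eq (p : ℕ) [NeZero p] {γ δ : SL(2, ℤ)} (h00 : δ 0 0 = γ 0 0)
    (h01 : p * δ 0 1 = γ 0 1) (h10 : δ 1 0 = p * γ 1 0) (h11 : δ 1 1 = γ 1 1) :
    diagR 1 p * mapGL ℝ γ = mapGL ℝ δ * diagR 1 p := by
  ext i j
  have h01' : (p : ℝ) * δ 0 1 = γ 0 1 := by exact_mod_cast h01
  rw [Matrix.GeneralLinearGroup.coe_mul, Matrix.GeneralLinearGroup.coe_mul, diagR_val]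
  fin_cases i <;> fin_cases j <;>
    simp [Matrix.mul_apply, Fin.sum_univ_two, h00, h10, h11, ← h01', mul_comm]

lemma diagR_mul_eq' (p : ℕ) [NeZero p] {γ δ : SL(2, ℤ)} (h00 : δ 0 0 = γ 0 0)
    (h01 : δ 0 1 = p * γ 0 1) (h10 : p * δ 1 0 = γ 1 0) (h11 : δ 1 1 = γ 1 1) :
    diagR p 1 * mapGL ℝ γ = mapGL ℝ δ * diagR p 1 := by
  ext i j
  have h10' : (p : ℝ) * δ 1 0 = γ 1 0 := by exact_mod_cast h10
  rw [Matrix.GeneralLinearGroup.coe_mul, Matrix.GeneralLinearGroup.coe_mul, diagR_val]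
  fin_cases i <;> fin_cases j <;>
    simp [Matrix.mul_apply, Fin.sum_univ_two, h00, h01, h11, ← h10', mul_comm]

/-- Conjugation by diag(1, p) divides the upper right entry by p and multiplies the lower left one
by p. -/
lemma slash_diagR_inv {M p : ℕ} [NeZero M] [NeZero p] (hx : x ∈ cuspSpace (p * M) w)
    {γ : SL(2, ℤ)} (hγ : γ ∈ Gamma00 M p) : (x ∣[w] diagR 1 p) ∣[w] γ = x ∣[w] diagR 1 p := by
  obtain ⟨⟨c, hc⟩, ⟨b, hb⟩⟩ := hγ
  let δ : SL(2, ℤ) := ⟨!![γ 0 0, b; p * γ 1 0, γ 1 1], by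
    rw [Matrix.det_fin_two]
    have := SL_det γ
    rw [hb] at this
    simp
    linarith⟩
  rw [SL_slash_eq, ← SlashAction.slash_mul, diagR_mul_eq p (γ := γ) (δ := δ)
    (by simp [δ]) (by simp [δ, hb]) (by simp [δ]) (by simp [δ]), SlashAction.slash_mul]
  congr 1
  refine cuspSpace_inv hx ?_
  rw [Gamma0_mem_iff]
  simp only [δ, hc]
  exact ⟨c, by simp [mul_assoc]⟩

lemma opV_mem_cuspSpace {M p : ℕ} [NeZero M] [NeZero p] (hx : x ∈ cuspSpace M w) :
    opV p x ∈ cuspSpace (M * p) w := by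
  rw [mem_cuspSpace_iff]
  refine ⟨opV_mem_cuspFn p (cuspSpace_le_cuspFn hx), fun γ hγ => ?_⟩
  rw [Gamma0_mem_iff] at hγ
  obtain ⟨c, hc⟩ := hγ
  push_cast at hc
  let δ : SL(2, ℤ) := ⟨!![γ 0 0, p * γ 0 1; M * c, γ 1 1], by
    rw [Matrix.det_fin_two]
    have := SL_det γ
    rw [hc] at this
    simp
    linarith⟩
  have hp : ((p : ℂ) ^ (w - 1)) ≠ 0 := zpow_ne_zero _ (by simp [NeZero.ne])
  have key : (x ∣[w] diagR p 1) ∣[w] γ = x ∣[w] diagR p 1 := by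
    rw [SL_slash_eq, ← SlashAction.slash_mul, diagR_mul_eq' p (γ := γ) (δ := δ)
      (by simp [δ]) (by simp [δ]) (by simp [δ, hc]; ring) (by simp [δ]), SlashAction.slash_mul]
    congr 1
    refine cuspSpace_inv hx ?_
    rw [Gamma0_mem_iff]
    simp [δ]
  rw [← smul_opV, ModularForm.SL_smul_slash] at key
  exact smul_right_injective _ hp key

end

section

variable {w : ℤ} {x y : ℍ → ℂ}

/-! ### Hecke operators and levels -/

lemma T_zpow_apply (n : ℤ) (γ : SL(2, ℤ)) :
    (γ * ModularGroup.T ^ n) 0 1 = γ 0 0 * n + γ 0 1 := by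
  rw [coe_mul, ModularGroup.coe_T_zpow, Matrix.mul_apply, Fin.sum_univ_two]
  simp

lemma exists_lt_dvd_sub {p : ℕ} (hp : p.Prime) {a : ℤ} (ha : ¬ (p : ℤ) ∣ a) (c : ℤ) :
    ∃ b : Fin p, (p : ℤ) ∣ a * (-(b : ℕ) : ℤ) + c := by
  have : Fact p.Prime := ⟨hp⟩
  have ha' : (a : ZMod p) ≠ 0 := by rwa [Ne, ZMod.intCast_zmod_eq_zero_iff_dvd]
  refine ⟨⟨((a : ZMod p)⁻¹ * c).val, ZMod.val_lt _⟩, ?_⟩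
  rw [← ZMod.intCast_zmod_eq_zero_iff_dvd]
  push_cast
  rw [ZMod.natCast_zmod_val]
  field_simp
  ring

lemma SL_mul_zero_one (a b : SL(2, ℤ)) : (a * b) 0 1 = a 0 0 * b 0 1 + a 0 1 * b 1 1 := by
  rw [coe_mul, Matrix.mul_apply, Fin.sum_univ_two]

lemma SL_inv_entries (a : SL(2, ℤ)) :
    a⁻¹ 0 0 = a 1 1 ∧ a⁻¹ 0 1 = -a 0 1 ∧ a⁻¹ 1 0 = -a 1 0 ∧ a⁻¹ 1 1 = a 0 0 := by
  rw [SL2_inv_expl]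
  simp

lemma fin_eq_of_dvd_sub {p : ℕ} [NeZero p] {b b' : Fin p}
    (h : (p : ℤ) ∣ ((b : ℕ) : ℤ) - ((b' : ℕ) : ℤ)) : b = b' := by
  have h2 := Int.emod_eq_emod_iff_emod_sub_eq_zero.mpr (Int.emod_eq_zero_of_dvd h)
  rw [Int.emod_eq_of_lt (by positivity) (by exact_mod_cast b.2),
    Int.emod_eq_of_lt (by positivity) (by exact_mod_cast b'.2)] at h2
  exact Fin.ext (by exact_mod_cast h2)

lemma T_zpow_mul_inv (m n : ℤ) :
    (ModularGroup.T ^ m : SL(2, ℤ)) * (ModularGroup.T ^ n)⁻¹ = ModularGroup.T ^ (m - n) := by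
  rw [← zpow_neg, ← zpow_add, sub_eq_add_neg]

/-- When p ∣ L, the upper left entry of an element of Γ₀(L) is prime to p, so the powers T^b, 0 ≤ b
< p, represent all cosets of Γ₀(L) ∩ Γ⁰(p). One factor p of the level is thereby removed. -/
lemma opU_mem_cuspSpace {L p : ℕ} [NeZero L] [NeZero p] (hp : p.Prime) (hpL : p ∣ L)
    (hx : x ∈ cuspSpace (p * L) w) : opU p x ∈ cuspSpace L w := by
  rw [mem_cuspSpace_iff]
  refine ⟨opU_mem_cuspFn p (cuspSpace_le_cuspFn hx), fun γ hγ => ?_⟩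
  rw [opU_eq_sum_slash p w, Finset.sum_range]
  refine sum_slash_reps (Gamma00 L p) (Gamma0 L) (x ∣[w] diagR 1 p)
    (fun γ hγ => slash_diagR_inv hx hγ) (fun b : Fin p => ModularGroup.T ^ ((b : ℕ) : ℤ))
    (fun b => T_pow_mem_Gamma0 _ _) (fun γ hγ => ?_) (fun b b' h => ?_) γ hγ
  · have h10 := Gamma0_mem_iff.mp hγ
    have h00 : ¬ (p : ℤ) ∣ γ 0 0 := fun h => by
      have := SL_det γ
      have h2 : (p : ℤ) ∣ 1 := by
        rw [← this]
        exact dvd_sub (h.mul_right _) (((Int.natCast_dvd_natCast.mpr hpL).trans h10).mul_left _)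
      exact hp.one_lt.ne' (by exact_mod_cast Int.eq_one_of_dvd_one (by positivity) h2)
    obtain ⟨b, hb⟩ := exists_lt_dvd_sub hp h00 (γ 0 1)
    refine ⟨b, ?_⟩
    rw [← zpow_neg]
    refine ⟨Gamma0_mem_iff.mp ((Gamma0 L).mul_mem hγ (T_pow_mem_Gamma0 _ _)), ?_⟩
    rwa [T_zpow_apply]
  · rw [T_zpow_mul_inv] at h
    have := h.2
    rw [ModularGroup.coe_T_zpow] at this
    simp only [Matrix.of_apply, Matrix.cons_val', Matrix.cons_val_one, Matrix.cons_val_zero] at this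
    exact fin_eq_of_dvd_sub this

/-- For p ∤ L there is one more coset of Γ₀(L) ∩ Γ⁰(p), formed by the elements whose upper left
entry is divisible by p. It supplies the V-term of T_p. -/
lemma heckeT_mem_cuspSpace {L p : ℕ} [NeZero L] [NeZero p] (hp : p.Prime) (hpL : ¬ p ∣ L)
    (hx : x ∈ cuspSpace L w) : heckeT w p x ∈ cuspSpace L w := by
  rw [mem_cuspSpace_iff]
  have hp2 : Prime (p : ℤ) := Nat.prime_iff_prime_int.mp hp
  have hx' : x ∈ cuspSpace (p * L) w := cuspSpace_mono (Dvd.intro_left p rfl) hx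
  refine ⟨Submodule.add_mem _ (opU_mem_cuspFn p (cuspSpace_le_cuspFn hx))
    (Submodule.smul_mem _ _ (opV_mem_cuspFn p (cuspSpace_le_cuspFn hx))), fun γ hγ => ?_⟩
  have hcop : IsCoprime (p : ℤ) (L : ℤ) :=
    Nat.isCoprime_iff_coprime.mpr ((Nat.Prime.coprime_iff_not_dvd hp).mpr hpL)
  obtain ⟨v, u, huv⟩ := hcop
  have hu : ¬ (p : ℤ) ∣ u := fun h => by
    have h2 : (p : ℤ) ∣ 1 := by rw [← huv]; exact dvd_add (Dvd.intro_left _ rfl) (h.mul_right _)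
    exact hp.one_lt.ne' (by exact_mod_cast Int.eq_one_of_dvd_one (by positivity) h2)
  -- The determinants are the Bézout relation vp + uL = 1, and diag(1, p) s = s' diag(p, 1).
  let s : SL(2, ℤ) := ⟨!![(p : ℤ), -u; L, v], by rw [Matrix.det_fin_two]; simp; linarith⟩
  let s' : SL(2, ℤ) := ⟨!![1, -u; L, p * v], by rw [Matrix.det_fin_two]; simp; linarith⟩
  have hs : s ∈ Gamma0 L := by rw [Gamma0_mem_iff]; simp [s]
  have hs' : s' ∈ Gamma0 L := by rw [Gamma0_mem_iff]; simp [s']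
  have hss : x ∣[w] diagR p 1 = (x ∣[w] diagR 1 p) ∣[w] s := by
    have : diagR 1 p * mapGL ℝ s = mapGL ℝ s' * diagR p 1 := by
      have e1 : s 0 0 = p ∧ s 0 1 = -u ∧ s 1 0 = L ∧ s 1 1 = v := by simp [s]
      have e2 : s' 0 0 = 1 ∧ s' 0 1 = -u ∧ s' 1 0 = L ∧ s' 1 1 = p * v := by simp [s']
      ext i j
      rw [Matrix.GeneralLinearGroup.coe_mul, Matrix.GeneralLinearGroup.coe_mul, diagR_val,
        diagR_val]
      fin_cases i <;> fin_cases j <;>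
        simp [Matrix.mul_apply, Fin.sum_univ_two, e1, e2, mul_comm]
    rw [SL_slash_eq, ← SlashAction.slash_mul, this, SlashAction.slash_mul]
    congr 1
    exact (cuspSpace_inv hx hs').symm
  have hsum : heckeT w p x = ∑ i : Option (Fin p), (x ∣[w] diagR 1 p) ∣[w]
      (i.elim s fun b => ModularGroup.T ^ ((b : ℕ) : ℤ) : SL(2, ℤ)) := by
    rw [heckeT_eq, Fintype.sum_option, Finset.sum_range, hss, add_comm]
    rfl
  rw [hsum]
  refine sum_slash_reps (Gamma00 L p) (Gamma0 L) (x ∣[w] diagR 1 p)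
    (fun γ hγ => slash_diagR_inv hx' hγ) _ (fun b => ?_) (fun γ hγ => ?_) (fun b b' h => ?_) γ hγ
  · cases b with
    | none => exact hs
    | some b => exact T_pow_mem_Gamma0 _ _
  · by_cases h00 : (p : ℤ) ∣ γ 0 0
    · refine ⟨none, Gamma0_mem_iff.mp ((Gamma0 L).mul_mem hγ ((Gamma0 L).inv_mem hs)), ?_⟩
      change (p : ℤ) ∣ (γ * s⁻¹) 0 1
      rw [SL_mul_zero_one, (SL_inv_entries s).2.2.2]
      exact dvd_add (h00.mul_right _) (Dvd.intro_left _ rfl)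
    · obtain ⟨b, hb⟩ := exists_lt_dvd_sub hp h00 (γ 0 1)
      refine ⟨Option.some b, ?_⟩
      change γ * (ModularGroup.T ^ ((b : ℕ) : ℤ))⁻¹ ∈ _
      rw [← zpow_neg]
      refine ⟨Gamma0_mem_iff.mp ((Gamma0 L).mul_mem hγ (T_pow_mem_Gamma0 _ _)), ?_⟩
      rwa [T_zpow_apply]
  · rcases b with _ | b <;> rcases b' with _ | b'
    · rfl
    · exfalso
      change s * (ModularGroup.T ^ ((b' : ℕ) : ℤ))⁻¹ ∈ _ at h
      rw [← zpow_neg] at h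
      have := h.2
      rw [T_zpow_apply] at this
      simp only [s, Matrix.of_apply, Matrix.cons_val', Matrix.cons_val_one,
        Matrix.cons_val_zero] at this
      exact hu ((dvd_neg).mp ((dvd_add_right (Dvd.intro _ rfl)).mp this))
    · exfalso
      have h' : ((ModularGroup.T ^ ((b : ℕ) : ℤ)) * s⁻¹ : SL(2, ℤ)) ∈ Gamma00 L p := h
      have := h'.2
      rw [SL_mul_zero_one, (SL_inv_entries s).2.2.2, (SL_inv_entries s).2.1,
        ModularGroup.coe_T_zpow] at this
      simp only [s, Matrix.of_apply, Matrix.cons_val', Matrix.cons_val_one,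
        Matrix.cons_val_zero, one_mul, neg_neg] at this
      exact hu ((dvd_add_left (Dvd.intro_left _ rfl)).mp this)
    · change (ModularGroup.T ^ ((b : ℕ) : ℤ) : SL(2, ℤ)) * (ModularGroup.T ^ ((b' : ℕ) : ℤ))⁻¹ ∈ _ at h
      rw [T_zpow_mul_inv] at h
      have := h.2
      rw [ModularGroup.coe_T_zpow] at this
      simp only [Matrix.of_apply, Matrix.cons_val', Matrix.cons_val_one, Matrix.cons_val_zero] at this
      exact congrArg Option.some (fin_eq_of_dvd_sub this)

/-! ### Fourier expansions -/

/-- `1`-periodic holomorphic functions on `ℍ` that are bounded at `i∞`. -/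
structure QFn (x : ℍ → ℂ) : Prop where
  holo : MDifferentiable 𝓘(ℂ) 𝓘(ℂ) x
  per : ∀ τ : ℍ, x ((1 : ℝ) +ᵥ τ) = x τ
  bdd : IsBoundedAtImInfty x

/-- `x = ∑ c(n) q^n`. -/
def HasQ (x : ℍ → ℂ) (c : ℕ → ℂ) : Prop := ∀ τ : ℍ, HasSum (fun n => c n * 𝕢 1 τ ^ n) (x τ)

lemma QFn.periodic (hx : QFn x) : Function.Periodic (x ∘ ofComplex) (1 : ℝ) := by
  intro z
  by_cases hz : 0 < z.im
  · have h1 : 0 < (z + (1 : ℝ)).im := by simpa using hz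
    simp only [Function.comp_apply, ofComplex_apply_of_im_pos h1, ofComplex_apply_of_im_pos hz]
    rw [← hx.per ⟨z, hz⟩]
    congr 1
    ext
    simp [add_comm]
  · have : (z + (1 : ℝ)).im ≤ 0 := by simpa using hz
    rw [Function.comp_apply, Function.comp_apply, ofComplex_apply_of_im_nonpos this,
      ofComplex_apply_of_im_nonpos (not_lt.mp hz)]

lemma QFn.hasQ (hx : QFn x) : HasQ x (fourierCoeff x) := fun τ => by
  simpa [fourierCoeff] using hasSum_qExpansion one_pos hx.periodic hx.holo hx.bdd τ

lemma QFn.fourierCoeff_eq (hx : QFn x) {c : ℕ → ℂ} (hc : HasQ x c) : fourierCoeff x = c := by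
  funext n
  have han := UpperHalfPlane.analyticAt_cuspFunction_zero one_pos hx.periodic hx.holo hx.bdd
  have h1 := (hasFPowerSeriesOnBall_cuspFunction one_pos han (c := c)
    fun τ => by simpa using hc τ).hasFPowerSeriesAt
  have h2 := (hasFPowerSeriesOnBall_cuspFunction one_pos han (c := fourierCoeff x)
    fun τ => by simpa using hx.hasQ τ).hasFPowerSeriesAt
  simpa using congr_arg (FormalMultilinearSeries.coeff · n) (h2.eq_formalMultilinearSeries h1)

lemma HasQ.ext {c : ℕ → ℂ} (hx : HasQ x c) (hy : HasQ y c) : x = y :=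
  funext fun τ => (hx τ).unique (hy τ)

lemma HasQ.add {c d : ℕ → ℂ} (hx : HasQ x c) (hy : HasQ y d) : HasQ (x + y) (c + d) := fun τ => by
  simpa [add_mul] using (hx τ).add (hy τ)

lemma HasQ.sub {c d : ℕ → ℂ} (hx : HasQ x c) (hy : HasQ y d) : HasQ (x - y) (c - d) := fun τ => by
  simpa [sub_mul] using (hx τ).sub (hy τ)

lemma HasQ.smul {c : ℕ → ℂ} (hx : HasQ x c) (a : ℂ) : HasQ (a • x) (a • c) := fun τ => by
  simpa [mul_assoc] using (hx τ).mul_left a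

lemma HasQ.sum {ι : Type*} {s : Finset ι} {f : ι → ℍ → ℂ} {c : ι → ℕ → ℂ}
    (h : ∀ i ∈ s, HasQ (f i) (c i)) : HasQ (∑ i ∈ s, f i) (∑ i ∈ s, c i) := fun τ => by
  simpa [Finset.sum_mul] using hasSum_sum fun i hi => h i hi τ

lemma hasQ_zero : HasQ 0 0 := fun τ => by simp

lemma qParam_one_eq_pow (p : ℕ) [NeZero p] (z : ℂ) : 𝕢 1 z = 𝕢 p z ^ p := by
  have : (p : ℂ) ≠ 0 := by simp [NeZero.ne]
  rw [Function.Periodic.qParam, Function.Periodic.qParam, ← Complex.exp_nat_mul]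
  congr 1
  push_cast
  field_simp

lemma qParam_diagR (p : ℕ) [NeZero p] (b : ℤ) (τ : ℍ) :
    𝕢 1 (diagR 1 p • ((b : ℝ) +ᵥ τ) : ℍ) =
      𝕢 p τ * Complex.exp (2 * Real.pi * Complex.I / p) ^ b := by
  have : (p : ℂ) ≠ 0 := by simp [NeZero.ne]
  rw [Function.Periodic.qParam, Function.Periodic.qParam, ← Complex.exp_int_mul, ← Complex.exp_add,
    coe_diagR_smul, coe_vadd]
  congr 1
  push_cast
  field_simp
  ring

lemma sum_root_of_unity_pow (p : ℕ) [NeZero p] (n : ℕ) :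
    ∑ b ∈ Finset.range p, (Complex.exp (2 * Real.pi * Complex.I / p) ^ b) ^ n =
      if p ∣ n then (p : ℂ) else 0 := by
  have hz := Complex.isPrimitiveRoot_exp p (NeZero.ne p)
  set z := Complex.exp (2 * Real.pi * Complex.I / p)
  simp_rw [← pow_mul, mul_comm _ n, pow_mul]
  split_ifs with h
  · rw [(hz.pow_eq_one_iff_dvd n).mpr h]; simp
  · have h1 : z ^ n ≠ 1 := fun h' => h ((hz.pow_eq_one_iff_dvd n).mp h')
    rw [geom_sum_eq h1, ← pow_mul, mul_comm, pow_mul, hz.pow_eq_one]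
    simp

lemma HasQ.opU {c : ℕ → ℂ} (hx : HasQ x c) (p : ℕ) [NeZero p] :
    HasQ (opU p x) (fun n => c (p * n)) := fun τ => by
  have hp : (p : ℂ) ≠ 0 := by simp [NeZero.ne]
  rw [opU_apply]
  have h1 := (hasSum_sum (s := Finset.range p) fun b _ => hx (diagR 1 p • (((b : ℤ) : ℝ) +ᵥ τ))).mul_left
    (p : ℂ)⁻¹
  have h2 : ∀ n, (p : ℂ)⁻¹ * ∑ b ∈ Finset.range p,
      c n * 𝕢 1 ((diagR 1 p • (((b : ℤ) : ℝ) +ᵥ τ) : ℍ) : ℂ) ^ n =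
      if p ∣ n then c n * 𝕢 p τ ^ n else 0 := fun n => by
    simp_rw [qParam_diagR, zpow_natCast, mul_pow, ← Finset.mul_sum]
    rw [sum_root_of_unity_pow]
    split_ifs with h
    · field_simp
    · simp
  simp_rw [h2] at h1
  have hinj : Function.Injective (fun n : ℕ => p * n) := fun a b h =>
    Nat.eq_of_mul_eq_mul_left (NeZero.pos p) h
  rw [← hinj.hasSum_iff] at h1
  · convert! h1 using 2 with n
    simp [qParam_one_eq_pow p, pow_mul]
  · intro n hn
    rw [if_neg]
    rintro ⟨m, rfl⟩
    exact hn ⟨m, rfl⟩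

lemma HasQ.opV {c : ℕ → ℂ} (hx : HasQ x c) (p : ℕ) [NeZero p] :
    HasQ (opV p x) (fun n => if p ∣ n then c (n / p) else 0) := fun τ => by
  rw [opV_apply]
  have hinj : Function.Injective (fun n : ℕ => p * n) := fun a b h =>
    Nat.eq_of_mul_eq_mul_left (NeZero.pos p) h
  rw [← hinj.hasSum_iff]
  · convert! hx (diagR p 1 • τ) using 2 with n
    have : 𝕢 1 ((diagR p 1 • τ : ℍ) : ℂ) = 𝕢 1 τ ^ p := by
      rw [Function.Periodic.qParam, Function.Periodic.qParam, ← Complex.exp_nat_mul, coe_diagR_smul]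
      congr 1
      push_cast
      ring
    simp [this, pow_mul, Nat.mul_div_cancel_left _ (NeZero.pos p)]
  · intro n hn
    simp only
    rw [if_neg, zero_mul]
    rintro ⟨m, rfl⟩
    exact hn ⟨m, rfl⟩

lemma qfn_of_cuspFn (hx : x ∈ cuspFn w) (hT : x ∣[w] ModularGroup.T = x) : QFn x := by
  refine ⟨hx.1, fun τ => ?_, ?_⟩
  · have := congrFun hT τ
    have h2 := slash_T_pow (w := w) (x := x) 1 τ
    rw [zpow_one, this] at h2
    simpa using h2.symm
  · have := hx.2.2 1
    rw [SlashAction.slash_one] at this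
    exact this.isBoundedAtImInfty

lemma slash_T_of_cuspSpace {M : ℕ} [NeZero M] (hx : x ∈ cuspSpace M w) :
    x ∣[w] ModularGroup.T = x := by
  have := cuspSpace_inv hx (T_pow_mem_Gamma0 M 1)
  rwa [zpow_one] at this

lemma qfn_of_cuspSpace {M : ℕ} [NeZero M] (hx : x ∈ cuspSpace M w) : QFn x :=
  qfn_of_cuspFn (cuspSpace_le_cuspFn hx) (slash_T_of_cuspSpace hx)

lemma fourierCoeff_zero_of_isZero (hx : QFn x) (h0 : IsZeroAtImInfty x) : fourierCoeff x 0 = 0 := by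
  rw [fourierCoeff, qExpansion_coeff_zero one_pos
    (analyticAt_cuspFunction_zero one_pos hx.periodic hx.holo hx.bdd) hx.periodic,
    h0.valueAtInfty_eq_zero]

lemma isZeroAtImInfty_of_cuspFn (hx : x ∈ cuspFn w) : IsZeroAtImInfty x := by
  have := hx.2.2 1
  rwa [SlashAction.slash_one] at this

lemma fourierCoeff_zero {M : ℕ} [NeZero M] (hx : x ∈ cuspSpace M w) : fourierCoeff x 0 = 0 :=
  fourierCoeff_zero_of_isZero (qfn_of_cuspSpace hx)
    (isZeroAtImInfty_of_cuspFn (cuspSpace_le_cuspFn hx))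

end

/-! ### Coefficients of periodic functions, Cauchy estimates and decay at infinity -/

section

variable {w : ℤ} {x y : ℍ → ℂ}

/-- A convergent expansion in q already forces periodicity and boundedness, so only holomorphy has
to be checked for new functions. -/
lemma HasQ.qfn {c : ℕ → ℂ} (hx : HasQ x c) (hol : MDifferentiable 𝓘(ℂ) 𝓘(ℂ) x) : QFn x := by
  refine ⟨hol, fun τ => ?_, isBoundedAtImInfty_of_hasSum_qExpansion (c := c) one_pos
    fun τ => by simpa using hx τ⟩
  have h1 := hx ((1 : ℝ) +ᵥ τ)
  have : 𝕢 1 (((1 : ℝ) +ᵥ τ : ℍ) : ℂ) = 𝕢 1 τ := by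
    rw [coe_vadd, Function.Periodic.qParam, Function.Periodic.qParam,
      show 2 * Real.pi * Complex.I * (((1 : ℝ) : ℂ) + τ) / ((1 : ℝ) : ℂ) =
        2 * Real.pi * Complex.I + 2 * Real.pi * Complex.I * τ / ((1 : ℝ) : ℂ) by push_cast; ring,
      Complex.exp_add, Complex.exp_two_pi_mul_I, one_mul]
  rw [this] at h1
  exact h1.unique (hx τ)

lemma QFn.add (hx : QFn x) (hy : QFn y) : QFn (x + y) := (hx.hasQ.add hy.hasQ).qfn (hx.1.add hy.1)
lemma QFn.sub (hx : QFn x) (hy : QFn y) : QFn (x - y) := (hx.hasQ.sub hy.hasQ).qfn (hx.1.sub hy.1)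
lemma QFn.smul (hx : QFn x) (a : ℂ) : QFn (a • x) := (hx.hasQ.smul a).qfn (hx.1.const_smul a)

lemma QFn.coeff_add (hx : QFn x) (hy : QFn y) (n : ℕ) :
    fourierCoeff (x + y) n = fourierCoeff x n + fourierCoeff y n :=
  congrFun ((hx.add hy).fourierCoeff_eq (hx.hasQ.add hy.hasQ)) n
lemma QFn.coeff_sub (hx : QFn x) (hy : QFn y) (n : ℕ) :
    fourierCoeff (x - y) n = fourierCoeff x n - fourierCoeff y n :=
  congrFun ((hx.sub hy).fourierCoeff_eq (hx.hasQ.sub hy.hasQ)) n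
lemma QFn.coeff_smul (hx : QFn x) (a : ℂ) (n : ℕ) :
    fourierCoeff (a • x) n = a * fourierCoeff x n :=
  congrFun ((hx.smul a).fourierCoeff_eq (hx.hasQ.smul a)) n

lemma QFn.ext (hx : QFn x) (hy : QFn y) (h : ∀ n, fourierCoeff x n = fourierCoeff y n) : x = y := by
  have h1 := hx.hasQ
  rw [funext h] at h1
  exact h1.ext hy.hasQ

lemma QFn.zero : QFn 0 := hasQ_zero.qfn mdifferentiable_const

lemma fourierCoeff_zero_fn (n : ℕ) : fourierCoeff 0 n = 0 :=
  congrFun (QFn.zero.fourierCoeff_eq hasQ_zero) n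

lemma QFn.coeff_opU (hx : QFn x) (p : ℕ) [NeZero p] (hU : QFn (opU p x)) (n : ℕ) :
    fourierCoeff (opU p x) n = fourierCoeff x (p * n) :=
  congrFun (hU.fourierCoeff_eq (hx.hasQ.opU p)) n

lemma QFn.opU (hx : QFn x) (p : ℕ) [NeZero p] : QFn (opU p x) := by
  refine (hx.hasQ.opU p).qfn ?_
  rw [opU_eq_sum_slash p 0]
  have : ∀ s : Finset ℕ, MDifferentiable 𝓘(ℂ) 𝓘(ℂ) (∑ b ∈ s,
      (x ∣[(0 : ℤ)] diagR 1 p) ∣[(0 : ℤ)] (ModularGroup.T ^ (b : ℤ) : SL(2, ℤ))) := fun s => by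
    induction s using Finset.cons_induction with
    | empty => rw [Finset.sum_empty]; exact mdifferentiable_const
    | cons a s h ih =>
      rw [Finset.sum_cons]
      exact ((hx.1.slash 0 _).slash 0 _).add ih
  exact this _

lemma QFn.opV (hx : QFn x) (p : ℕ) [NeZero p] : QFn (opV p x) := by
  refine (hx.hasQ.opV p).qfn ?_
  have h := smul_opV p 1 x
  rw [sub_self, zpow_zero, one_smul] at h
  rw [h]
  exact hx.1.slash 1 _

lemma QFn.coeff_U (hx : QFn x) (p : ℕ) [NeZero p] (n : ℕ) :
    fourierCoeff (SKPullback.opU p x) n = fourierCoeff x (p * n) :=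
  hx.coeff_opU p (hx.opU p) n

lemma QFn.coeff_V (hx : QFn x) (p : ℕ) [NeZero p] (n : ℕ) :
    fourierCoeff (SKPullback.opV p x) n = if p ∣ n then fourierCoeff x (n / p) else 0 :=
  congrFun ((hx.opV p).fourierCoeff_eq (hx.hasQ.opV p)) n

lemma QFn.coeff_T (hx : QFn x) (w : ℤ) (p : ℕ) [NeZero p] (n : ℕ) :
    fourierCoeff (SKPullback.heckeT w p x) n = fourierCoeff x (p * n) +
      (p : ℂ) ^ (w - 1) * (if p ∣ n then fourierCoeff x (n / p) else 0) := by
  rw [SKPullback.heckeT, LinearMap.add_apply, LinearMap.smul_apply,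
    (hx.opU p).coeff_add ((hx.opV p).smul _), (hx.opV p).coeff_smul, hx.coeff_U, hx.coeff_V]

lemma opU_opV (hx : QFn x) (p : ℕ) [NeZero p] : opU p (opV p x) = x := by
  refine ((hx.opV p).opU p).ext hx fun n => ?_
  rw [(hx.opV p).coeff_U, hx.coeff_V, if_pos (Dvd.intro n rfl), Nat.mul_div_cancel_left _ (NeZero.pos p)]

/-- Cauchy's estimate on the horizontal segment at height t. -/
lemma QFn.norm_coeff_le (hx : QFn x) {t K : ℝ} (ht : 0 < t) (hK : ∀ τ : ℍ, τ.im = t → ‖x τ‖ ≤ K)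
    (n : ℕ) : ‖fourierCoeff x n‖ ≤ K * Real.exp (2 * Real.pi * n * t) := by
  rw [fourierCoeff, qExpansion_coeff_eq_intervalIntegral one_pos hx.periodic hx.holo hx.bdd n ht]
  norm_num
  have := intervalIntegral.norm_integral_le_of_norm_le_const (a := (0 : ℝ)) (b := 1)
    (f := fun u : ℝ => (𝕢 1 (u + t * Complex.I) ^ n)⁻¹ * x ⟨u + t * Complex.I, by simpa using ht⟩)
    (C := K * Real.exp (2 * Real.pi * n * t)) (fun u _ => ?_)
  · simpa using this
  · rw [norm_mul, norm_inv, norm_pow, Function.Periodic.norm_qParam, mul_comm]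
    refine mul_le_mul (hK _ (by simp)) (le_of_eq ?_) (by positivity)
      ((norm_nonneg _).trans (hK ⟨u + t * Complex.I, by simpa using ht⟩ (by simp)))
    rw [← Real.exp_nat_mul, ← Real.exp_neg]
    congr 1
    simp
    ring

/-- Let the height t tend to infinity in Cauchy's estimate: since n + 1 ≤ B, a factor exp(−2πt)
survives. -/
lemma QFn.coeff_eq_zero_of_isBigO (hx : QFn x) {B : ℕ}
    (h : x =O[atImInfty] fun τ : ℍ => Real.exp (-2 * Real.pi * B * τ.im)) {n : ℕ} (hn : n < B) :
    fourierCoeff x n = 0 := by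
  obtain ⟨C, hC⟩ := h.bound
  rw [atImInfty, Filter.eventually_comap, Filter.eventually_atTop] at hC
  obtain ⟨A, hA⟩ := hC
  rw [← norm_le_zero_iff]
  have hlim : Tendsto (fun t : ℝ => C * Real.exp (-(2 * Real.pi * t))) atTop (𝓝 (C * 0)) :=
    Tendsto.const_mul _ (Real.tendsto_exp_neg_atTop_nhds_zero.comp
      (tendsto_id.const_mul_atTop Real.two_pi_pos))
  rw [mul_zero] at hlim
  refine ge_of_tendsto hlim ?_
  filter_upwards [eventually_ge_atTop A, eventually_gt_atTop 0] with t ht ht0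
  have hC0 : 0 ≤ C := by
    have := (norm_nonneg _).trans (hA t ht ⟨t * Complex.I, by simpa using ht0⟩ (by simp [← coe_im]))
    rw [Real.norm_of_nonneg (Real.exp_nonneg _)] at this
    exact nonneg_of_mul_nonneg_left this (Real.exp_pos _)
  refine (hx.norm_coeff_le ht0 (K := C * Real.exp (-2 * Real.pi * B * t)) (fun τ hτ => ?_) n).trans ?_
  · have := hA t ht τ hτ
    rwa [Real.norm_of_nonneg (Real.exp_nonneg _), hτ] at this
  · rw [mul_assoc, ← Real.exp_add]
    gcongr
    have : (n : ℝ) + 1 ≤ B := by exact_mod_cast hn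
    have h2 := mul_nonneg (mul_nonneg Real.two_pi_pos.le ht0.le) (sub_nonneg.mpr this)
    nlinarith

/-- The quotient x / q^B is again a power series in q, hence bounded at infinity. -/
lemma QFn.isBigO_of_coeff (hx : QFn x) {B : ℕ} (h : ∀ n < B, fourierCoeff x n = 0) :
    x =O[atImInfty] fun τ : ℍ => Real.exp (-2 * Real.pi * B * τ.im) := by
  have h1 : ∀ τ : ℍ, HasSum (fun n => fourierCoeff x (n + B) • 𝕢 1 τ ^ n) (x τ / 𝕢 1 τ ^ B) :=
    fun τ => by
    have hq : 𝕢 1 (τ : ℂ) ≠ 0 := Function.Periodic.qParam_ne_zero _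
    have := (hasSum_nat_add_iff' B).mpr (hx.hasQ τ)
    rw [Finset.sum_eq_zero (fun i hi => by rw [h i (Finset.mem_range.mp hi), zero_mul]), sub_zero]
      at this
    have h2 := this.div_const (𝕢 1 (τ : ℂ) ^ B)
    refine h2.congr_fun ?_ |> id
    intro n
    rw [pow_add, smul_eq_mul]
    field_simp
  have h2 := isBoundedAtImInfty_of_hasSum_qExpansion one_pos h1
  have h3 : x = fun τ : ℍ => (x τ / 𝕢 1 (τ : ℂ) ^ B) * 𝕢 1 (τ : ℂ) ^ B := by
    funext τ
    rw [div_mul_cancel₀ _ (pow_ne_zero _ (Function.Periodic.qParam_ne_zero _))]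
  rw [h3]
  have h4 : (fun τ : ℍ => 𝕢 1 (τ : ℂ) ^ B) =O[atImInfty]
      fun τ : ℍ => Real.exp (-2 * Real.pi * B * τ.im) := by
    refine Asymptotics.isBigO_of_le _ fun τ => ?_
    rw [norm_pow, Function.Periodic.norm_qParam, ← Real.exp_nat_mul,
      Real.norm_of_nonneg (Real.exp_nonneg _)]
    refine le_of_eq ?_
    congr 1
    simp
    ring
  simpa using Asymptotics.IsBigO.mul (h2 : _ =O[_] _) h4

end

/-! ### Descent of the level, the Sturm bound and finite dimension -/

section

variable {w : ℤ} {x y : ℍ → ℂ}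

lemma slash_SL_T_zpow (hT : x ∣[w] ModularGroup.T = x) (n : ℤ) :
    x ∣[w] (ModularGroup.T ^ n : SL(2, ℤ)) = x := by
  let S : Subgroup SL(2, ℤ) :=
    { carrier := {γ | x ∣[w] γ = x}
      one_mem' := SlashAction.slash_one _ _
      mul_mem' := fun {a b} ha hb => by
        change x ∣[w] (a * b) = x
        rw [SlashAction.slash_mul, ha, hb]
      inv_mem' := fun {a} ha => by
        change x ∣[w] a⁻¹ = x
        conv_lhs => rw [← show x ∣[w] a = x from ha]
        rw [← SlashAction.slash_mul, mul_inv_cancel, SlashAction.slash_one] }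
  exact S.zpow_mem (show ModularGroup.T ∈ S from hT) n

/-- Invariance under `Γ₀(M) ∩ Γ⁰(p)` and `T` implies invariance under `Γ₀(M)`, for `p ∤ M`. -/
lemma inv_of_Gamma00 {M p : ℕ} (hp : p.Prime) 
    (h : ∀ γ ∈ Gamma00 M p, x ∣[w] γ = x) (hT : x ∣[w] ModularGroup.T = x) {γ : SL(2, ℤ)}
    (hγ : γ ∈ Gamma0 M) : x ∣[w] γ = x := by
  have key : ∀ γ ∈ Gamma0 M, ¬ (p : ℤ) ∣ γ 0 0 → x ∣[w] γ = x := fun γ hγ h00 => by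
    obtain ⟨b, hb⟩ := exists_lt_dvd_sub hp h00 (γ 0 1)
    have h1 : x ∣[w] (γ * ModularGroup.T ^ (-((b : ℕ) : ℤ))) = x := by
      refine h _ ⟨Gamma0_mem_iff.mp ((Gamma0 M).mul_mem hγ (T_pow_mem_Gamma0 _ _)), ?_⟩
      rwa [T_zpow_apply]
    have h2 : γ = γ * ModularGroup.T ^ (-((b : ℕ) : ℤ)) * ModularGroup.T ^ ((b : ℕ) : ℤ) := by
      rw [mul_assoc, ← zpow_add]; simp
    rw [h2, SlashAction.slash_mul, h1, slash_SL_T_zpow hT]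
  by_cases h00 : (p : ℤ) ∣ γ 0 0
  -- Multiplying by T on the left changes the upper left entry to γ₀₀ + γ₁₀. By the determinant, p
  -- cannot divide both entries, so the first case applies.
  · have h1 : x ∣[w] (ModularGroup.T * γ) = x := by
      have hm : ModularGroup.T * γ ∈ Gamma0 M := by
        have := T_pow_mem_Gamma0 M 1
        rw [zpow_one] at this
        exact (Gamma0 M).mul_mem this hγ
      refine key _ hm fun hd => ?_
      rw [coe_mul, Matrix.mul_apply, Fin.sum_univ_two] at hd
      simp only [ModularGroup.coe_T, Matrix.of_apply, Matrix.cons_val', Matrix.cons_val_one,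
        Matrix.cons_val_zero, one_mul] at hd
      have h10 := (dvd_add_right h00).mp hd
      have := SL_det γ
      have h2 : (p : ℤ) ∣ 1 := by
        rw [← this]
        exact dvd_sub (h00.mul_right _) (h10.mul_left _)
      exact hp.one_lt.ne' (by exact_mod_cast Int.eq_one_of_dvd_one (by positivity) h2)
    rwa [SlashAction.slash_mul, hT] at h1
  · exact key γ hγ h00

lemma slash_T_of_qfn (hx : QFn x) : x ∣[w] ModularGroup.T = x := by
  funext τ
  have h2 := slash_T_pow (w := w) (x := x) 1 τ
  rw [zpow_one] at h2
  rw [h2]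
  simpa using hx.per τ

lemma diagR_one_mul (p : ℕ) [NeZero p] (τ : ℍ) : diagR p 1 • (diagR 1 p • τ) = τ := by
  have hp : (p : ℂ) ≠ 0 := by simp [NeZero.ne]
  ext
  rw [coe_diagR_smul, coe_diagR_smul]
  field_simp

/-- If `V x` has level `Mp`, and `x` is `1`-periodic, then `x` has level `M`, for `p ∤ M`. -/
lemma mem_cuspSpace_of_opV {M p : ℕ} [NeZero M] [NeZero p] (hp : p.Prime) (hx : QFn x)
    (h : opV p x ∈ cuspSpace (p * M) w) : x ∈ cuspSpace M w := by
  have hp0 : (p : ℂ) ≠ 0 := by simp [NeZero.ne]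
  have hxe : x = ((p : ℂ) ^ (w - 1) * (p : ℂ) ^ (-w))⁻¹ • (opV p x ∣[w] diagR 1 p) := by
    funext τ
    rw [Pi.smul_apply, slash_diagR, opV_apply, diagR_one_mul, smul_eq_mul, Nat.cast_one, one_mul,
      inv_mul_cancel_left₀]
    exact mul_ne_zero (zpow_ne_zero _ hp0) (zpow_ne_zero _ hp0)
  rw [mem_cuspSpace_iff]
  constructor
  · rw [hxe]
    exact Submodule.smul_mem _ _ (slash_diagR_mem_cuspFn (cuspSpace_le_cuspFn h) 1 p)
  · intro γ hγ
    refine inv_of_Gamma00 hp (fun γ hγ => ?_) (slash_T_of_qfn hx) hγ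
    rw [hxe, ModularForm.SL_smul_slash, slash_diagR_inv h hγ]

/-- A cusp form is determined by finitely many of its coefficients. -/
lemma exists_coeff_bound (M : ℕ) [NeZero M] (w : ℤ) :
    ∃ B : ℕ, ∀ x ∈ cuspSpace M w, (∀ n < B, fourierCoeff x n = 0) → x = 0 := by
  let 𝒢 : Subgroup (GL (Fin 2) ℝ) := (Gamma0 M : Subgroup SL(2, ℤ))
  -- The weight of the norm of the form to level one, where W / 12 bounds the order of vanishing of
  -- a non-zero form.
  let W : ℤ := w * Nat.card (𝒮ℒ ⧸ 𝒢.subgroupOf 𝒮ℒ)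
  refine ⟨W.toNat / 12 + 1, ?_⟩
  rintro x ⟨X, rfl⟩ hX
  have hXm : (X : ℍ → ℂ) ∈ cuspSpace M w := ⟨X, rfl⟩
  have hq := qfn_of_cuspSpace hXm
  have hO := hq.isBigO_of_coeff hX
  rw [← ModularForm.norm_eq_zero_iff 𝒮ℒ X]
  have hnq : QFn (ModularForm.norm 𝒮ℒ X) := by
    have h := (ModularForm.norm 𝒮ℒ X)
    refine ⟨(ModularForm.norm 𝒮ℒ X).holo', fun τ => ?_, ModularFormClass.bdd_at_infty _⟩
    exact SlashInvariantForm.vAdd_apply_of_mem_strictPeriods (ModularForm.norm 𝒮ℒ X) τ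
      (by simp)
  refine ModularForm.sturm_bound_levelOne ?_
  refine lt_of_lt_of_le (b := ((W.toNat / 12 + 1 : ℕ) : ℕ∞)) (by exact_mod_cast Nat.lt_succ_self _) ?_
  refine PowerSeries.nat_le_order _ _ fun i hi => ?_
  refine hnq.coeff_eq_zero_of_isBigO (B := W.toNat / 12 + 1) ?_ (by exact_mod_cast hi)
  rw [ModularForm.coe_norm]
  classical
  let := Fintype.ofFinite (𝒮ℒ ⧸ 𝒢.subgroupOf 𝒮ℒ)
  -- The factor of the norm at the trivial coset is the form itself and carries the vanishing. The
  -- other factors are bounded at infinity.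
  have hsplit := Finset.mul_prod_erase Finset.univ
    (fun q : 𝒮ℒ ⧸ 𝒢.subgroupOf 𝒮ℒ => SlashInvariantForm.quotientFunc X q) (Finset.mem_univ ⟦1⟧)
  refine Asymptotics.IsBigO.congr_left ?_ (congrFun hsplit)
  have h1 : SlashInvariantForm.quotientFunc X (⟦1⟧ : 𝒮ℒ ⧸ 𝒢.subgroupOf 𝒮ℒ) = X := by
    rw [SlashInvariantForm.quotientFunc_mk]
    simp
  rw [h1]
  have h2 : (∏ q ∈ Finset.univ.erase (⟦1⟧ : 𝒮ℒ ⧸ 𝒢.subgroupOf 𝒮ℒ),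
      SlashInvariantForm.quotientFunc X q) =O[atImInfty] (1 : ℍ → ℝ) := by
    rw [show (1 : ℍ → ℝ) = (fun x ↦ ∏ i ∈ Finset.univ.erase (⟦1⟧ : 𝒮ℒ ⧸ 𝒢.subgroupOf 𝒮ℒ), 1) by
      ext; simp, Finset.prod_fn]
    refine .finsetProd fun q _ => ?_
    induction q using Quotient.inductionOn with
    | h r =>
      obtain ⟨_, γ, rfl⟩ := r
      rw [SlashInvariantForm.quotientFunc_mk]
      have := CuspFormClass.zero_at_infty_slash X γ⁻¹
      have h3 := this.isBoundedAtImInfty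
      have h4 : ((mapGL ℝ) γ)⁻¹ = mapGL ℝ γ⁻¹ := by simp
      change ((⇑X ∣[w] ((mapGL ℝ) γ)⁻¹ : ℍ → ℂ)) =O[atImInfty] _
      rw [h4]
      exact h3
  refine (hO.mul h2).congr_right fun τ => ?_
  rw [Pi.one_apply, mul_one]

/-- Cusp forms are expressed through finitely many coefficients. -/
lemma exists_dual_basis (M : ℕ) [NeZero M] (w : ℤ) :
    ∃ (B : ℕ) (b : Fin B → ℍ → ℂ), (∀ j, b j ∈ cuspSpace M w) ∧
      ∀ x ∈ cuspSpace M w, x = ∑ j : Fin B, fourierCoeff x j • b j := by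
  obtain ⟨B, hB⟩ := exists_coeff_bound M w
  let L : cuspSpace M w →ₗ[ℂ] (Fin B → ℂ) :=
    { toFun := fun x j => fourierCoeff x.1 j
      map_add' := fun x y => funext fun j =>
        (qfn_of_cuspSpace x.2).coeff_add (qfn_of_cuspSpace y.2) j
      map_smul' := fun c x => funext fun j => (qfn_of_cuspSpace x.2).coeff_smul c j }
  have hL : LinearMap.ker L = ⊥ := by
    rw [LinearMap.ker_eq_bot']
    intro x hx
    exact Subtype.ext (hB x.1 x.2 fun n hn => congrFun hx ⟨n, hn⟩)
  obtain ⟨g, hg⟩ := L.exists_leftInverse_of_injective hL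
  refine ⟨B, fun j => (g (Pi.single j 1)).1, fun j => (g (Pi.single j 1)).2, fun x hx => ?_⟩
  have h1 : g (L ⟨x, hx⟩) = ⟨x, hx⟩ := LinearMap.congr_fun hg _
  have h2 : L ⟨x, hx⟩ = ∑ j : Fin B, fourierCoeff x j • (Pi.single j 1 : Fin B → ℂ) := by
    funext i
    simp [Finset.sum_apply, Pi.single_apply, L]
  rw [h2, map_sum] at h1
  simp only [_root_.map_smul] at h1
  have h3 := congrArg (Submodule.subtype _) h1
  rw [map_sum] at h3
  simpa using h3.symm

instance cuspSpace_finiteDimensional (M : ℕ) [NeZero M] (w : ℤ) :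
    FiniteDimensional ℂ (cuspSpace M w) := by
  obtain ⟨B, b, hb, h⟩ := exists_dual_basis M w
  have := FiniteDimensional.span_of_finite ℂ (Set.finite_range b)
  refine Submodule.finiteDimensional_of_le (S₂ := Submodule.span ℂ (Set.range b)) fun x hx => ?_
  rw [h x hx]
  exact Submodule.sum_mem _ fun j _ => Submodule.smul_mem _ _ (Submodule.subset_span ⟨j, rfl⟩)

/-- A form of level prime to `p` whose coefficients are supported on multiples of `p` vanishes. -/
lemma eq_zero_of_coeff_supported {M p : ℕ} [NeZero M] [NeZero p] (hp : p.Prime) (hpM : ¬ p ∣ M)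
    (hx : x ∈ cuspSpace M w) (h : ∀ n, ¬ p ∣ n → fourierCoeff x n = 0) : x = 0 := by
  -- Such a y equals V(Uy), so Uy descends to level M. Then V y, a multiple of T_p y − U y, has
  -- level M as well instead of level Mp.
  have step : ∀ y ∈ cuspSpace M w, (∀ n, ¬ p ∣ n → fourierCoeff y n = 0) → opV p y ∈ cuspSpace M w :=
    fun y hy hn => by
    have hyq := qfn_of_cuspSpace hy
    have hyV : y = opV p (opU p y) := by
      refine hyq.ext ((hyq.opU p).opV p) fun n => ?_
      rw [(hyq.opU p).coeff_V, hyq.coeff_U]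
      split_ifs with hd
      · rw [Nat.mul_div_cancel' hd]
      · exact hn n hd
    have hU : opU p y ∈ cuspSpace M w := by
      refine mem_cuspSpace_of_opV hp (hyq.opU p) ?_
      rw [← hyV]
      exact cuspSpace_mono (Dvd.intro_left p rfl) hy
    have hT := heckeT_mem_cuspSpace hp hpM hy
    have h1 := Submodule.smul_mem _ ((p : ℂ) ^ (w - 1))⁻¹ (Submodule.sub_mem _ hT hU)
    rw [heckeT, LinearMap.add_apply, add_sub_cancel_left, LinearMap.smul_apply, inv_smul_smul₀] at h1
    · exact h1
    · exact zpow_ne_zero _ (by simp [NeZero.ne])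
  obtain ⟨B, hB⟩ := exists_coeff_bound M w
  have iter : ∀ j : ℕ, (opV p)^[j] x ∈ cuspSpace M w ∧
      ∀ n, fourierCoeff ((opV p)^[j] x) n = if p ^ j ∣ n then fourierCoeff x (n / p ^ j) else 0 := by
    intro j
    induction j with
    | zero => exact ⟨hx, fun n => by simp⟩
    | succ j ih =>
      rw [Function.iterate_succ_apply']
      refine ⟨step _ ih.1 fun n hn => ?_, fun n => ?_⟩
      · rw [ih.2]
        split_ifs with hd
        · rcases Nat.eq_zero_or_pos j with rfl | hj
          · simpa using h n hn
          · exact absurd ((dvd_pow_self p hj.ne').trans hd) hn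
        · rfl
      · rw [(qfn_of_cuspSpace ih.1).coeff_V]
        by_cases hd : p ∣ n
        · obtain ⟨m, rfl⟩ := hd
          rw [if_pos (Dvd.intro m rfl), Nat.mul_div_cancel_left _ (NeZero.pos p), ih.2, pow_succ',
            Nat.mul_div_mul_left _ _ (NeZero.pos p)]
          simp only [Nat.mul_dvd_mul_iff_left (NeZero.pos p)]
        · rw [if_neg hd, if_neg]
          exact fun h' => hd ((dvd_pow_self p (Nat.succ_ne_zero j)).trans h')
  -- All iterates of V stay in level M. The coefficients of V^B x at 0 < n < B vanish because B <
  -- p^B, so the Sturm bound applies.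
  have hzero : (opV p)^[B] x = 0 := by
    refine hB _ (iter B).1 fun n hn => ?_
    rw [(iter B).2]
    split_ifs with hd
    · rcases Nat.eq_zero_or_pos n with rfl | hn0
      · rw [Nat.zero_div]; exact fourierCoeff_zero hx
      · have := Nat.le_of_dvd hn0 hd
        have h2 := Nat.lt_pow_self (n := B) hp.one_lt
        omega
    · rfl
  refine (qfn_of_cuspSpace hx).ext QFn.zero fun n => ?_
  have h1 := (iter B).2 (p ^ B * n)
  rw [hzero, if_pos (Dvd.intro n rfl), Nat.mul_div_cancel_left _ (pow_pos (NeZero.pos p) B)] at h1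
  rw [← h1, fourierCoeff_zero_fn, fourierCoeff_zero_fn]

end

/-! ### The hyperbolic measure and the standard fundamental domain -/

section

variable {w : ℤ} {x y : ℍ → ℂ}

/-- The group of all elements of `SL₂(ℤ)` leaving `F` invariant. -/
def stab (F : ℍ → ℂ) : Subgroup SL(2, ℤ) where
  carrier := {γ | ∀ τ : ℍ, F (γ • τ) = F τ}
  one_mem' := fun τ => by rw [one_smul]
  mul_mem' := fun {a b} ha hb τ => by rw [mul_smul, ha, hb]
  inv_mem' := fun {a} ha τ => by
    rw [← ha (a⁻¹ • τ), smul_inv_smul]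

lemma volume_eq_zero_of_image {s : Set ℍ} (h : volume ((↑) '' s : Set ℂ) = 0) :
    volume s = 0 := by
  rw [volume_eq_lintegral, setLIntegral_measure_zero _ _ h]

lemma volume_re_eq (a : ℝ) : volume {z : ℂ | z.re = a} = 0 := by
  have h := Complex.volume_preserving_equiv_real_prod.measure_preimage
    (s := {a} ×ˢ Set.univ) ((measurableSet_singleton a).prod MeasurableSet.univ).nullMeasurableSet
  rw [Measure.volume_eq_prod, Measure.prod_prod, Real.volume_singleton, zero_mul] at h
  rw [← h]
  congr 1
  ext z
  simp

lemma volume_fd_diff_fdo : volume (𝒟 \ 𝒟ᵒ) = 0 := by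
  refine volume_eq_zero_of_image (measure_mono_null (t := Metric.sphere 0 1 ∪
    ({z : ℂ | z.re = 1 / 2} ∪ {z : ℂ | z.re = -(1 / 2)})) ?_ ?_)
  · rintro _ ⟨τ, ⟨⟨h1, h2⟩, h3⟩, rfl⟩
    by_cases h4 : 1 < Complex.normSq τ
    · right
      have h5 : ¬ |τ.re| < 1 / 2 := fun h5 => h3 ⟨h4, h5⟩
      have h6 := le_antisymm h2 (not_lt.mp h5)
      rcases abs_eq (by norm_num : (0 : ℝ) ≤ 1 / 2) |>.mp h6 with h | h
      · left; exact h
      · right; exact h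
    · left
      have h5 := le_antisymm (not_lt.mp h4) h1
      rw [Complex.normSq_eq_norm_sq] at h5
      rw [mem_sphere_zero_iff_norm]
      nlinarith [norm_nonneg (τ : ℂ)]
  · rw [measure_union_null_iff, measure_union_null_iff]
    exact ⟨Measure.addHaar_sphere _ _ _, volume_re_eq _, volume_re_eq _⟩

/-- The domain lies in the strip |Re τ| ≤ 1/2, Im τ > 1/4, which has finite mass for du dv / v². -/
lemma volume_fd_lt_top : volume 𝒟 < ⊤ := by
  have h1 : Integrable (Set.indicator (Set.Icc (-(1 / 2) : ℝ) (1 / 2)) fun _ => (1 : ℝ)) := by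
    rw [integrable_indicator_iff measurableSet_Icc]
    exact integrableOn_const (by simp)
  have h2 : Integrable (Set.indicator (Set.Ioi (1 / 4 : ℝ)) fun y => y ^ (-2 : ℝ)) := by
    rw [integrable_indicator_iff measurableSet_Ioi]
    exact integrableOn_Ioi_rpow_of_lt (by norm_num) (by norm_num)
  have h3 := h1.mul_prod h2
  rw [← Measure.volume_eq_prod] at h3
  have h4 := (Complex.volume_preserving_equiv_real_prod.integrable_comp_emb
    Complex.measurableEquivRealProd.measurableEmbedding).mpr h3
  refine lt_of_le_of_lt ?_ h4.2
  rw [volume_eq_lintegral]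
  refine (setLIntegral_mono' (g := fun z : ℂ => ‖(Set.indicator (Set.Icc (-(1 / 2) : ℝ) (1 / 2))
    (fun _ => (1 : ℝ)) z.re * Set.indicator (Set.Ioi (1 / 4 : ℝ)) (fun y => y ^ (-2 : ℝ)) z.im)‖ₑ)
    (measurableEmbedding_coe.measurableSet_image.mpr ModularGroup.isClosed_fd.measurableSet) ?_).trans
    (setLIntegral_le_lintegral _ _)
  rintro _ ⟨τ, hτ, rfl⟩
  have h5 := ModularGroup.three_le_four_mul_im_sq_of_mem_fd hτ
  have h6 : (1 : ℝ) / 4 < (τ : ℂ).im := by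
    by_contra h
    have := τ.im_pos
    have h' : τ.im ≤ 1 / 4 := not_lt.mp h
    nlinarith
  have h7 : (τ : ℂ).re ∈ Set.Icc (-(1 / 2) : ℝ) (1 / 2) := abs_le.mp hτ.2
  rw [Set.indicator_of_mem h7, Set.indicator_of_mem (show (τ : ℂ).im ∈ Set.Ioi (1 / 4 : ℝ) from h6),
    one_mul]
  refine le_of_eq ?_
  rw [enorm_eq_nnnorm]
  congr 1
  ext
  have := τ.im_pos
  rw [coe_nnnorm, Real.rpow_neg (by simpa using this.le), norm_inv]
  simp

instance : (volume : Measure ℍ).IsOpenPosMeasure where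
  open_pos U hU hne h0 := by
    rw [volume_eq_lintegral] at h0
    have hm : Measurable fun z : ℂ => (((1 / ‖z.im‖₊) ^ 2 : NNReal) : ENNReal) := by fun_prop
    have h1 := (setLIntegral_pos_iff hm (s := (↑) '' U)).not.mp (by rw [h0]; exact lt_irrefl _)
    rw [Set.inter_eq_right.mpr] at h1
    · exact h1 ((UpperHalfPlane.isOpenEmbedding_coe.isOpenMap U hU).measure_pos _ (hne.image _))
    · rintro _ ⟨τ, -, rfl⟩
      have := τ.im_ne_zero
      simp [this]

lemma volume_fd_ne_zero : volume 𝒟 ≠ 0 := by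
  have h : (𝒟ᵒ).Nonempty := ⟨⟨2 * Complex.I, by simp⟩, by
    constructor
    · simp [Complex.normSq_apply]; norm_num
    · simp [← coe_re]⟩
  have h1 := ModularGroup.isOpen_fdo.measure_pos volume h
  exact (h1.trans_le (measure_mono ModularGroup.fdo_subset_fd)).ne'

/-! ### Fundamental domains of congruence subgroups -/

lemma measurePreserving_GL (g : GL (Fin 2) ℝ) :
    MeasurePreserving (fun τ : ℍ => g • τ) volume volume := measurePreserving_smul g volume

lemma measurePreserving_SL (g : SL(2, ℤ)) :
    MeasurePreserving (fun τ : ℍ => g • τ) volume volume := measurePreserving_GL (mapGL ℝ g)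

/-- The group of transformations of `ℍ` given by a subgroup of `SL₂(ℤ)`. -/
def permGroup (Γ : Subgroup SL(2, ℤ)) : Subgroup (Equiv.Perm ℍ) :=
  Γ.map (MulAction.toPermHom SL(2, ℤ) ℍ)

instance (Γ : Subgroup SL(2, ℤ)) : SMulInvariantMeasure (permGroup Γ) ℍ volume where
  measure_preimage_smul := by
    rintro ⟨_, γ, hγ, rfl⟩ s hs
    exact (measurePreserving_SL γ).measure_preimage hs.nullMeasurableSet

instance (Γ : Subgroup SL(2, ℤ)) : MeasurableConstSMul (permGroup Γ) ℍ where
  measurable_const_smul := by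
    rintro ⟨_, γ, hγ, rfl⟩
    exact (measurePreserving_SL γ).measurable

instance : Countable SL(2, ℤ) := by
  have : Countable (Matrix (Fin 2) (Fin 2) ℤ) := inferInstanceAs (Countable (Fin 2 → Fin 2 → ℤ))
  exact Subtype.coe_injective.countable

instance (Γ : Subgroup SL(2, ℤ)) : Countable (permGroup Γ) := by
  refine Function.Surjective.countable (f := fun γ : Γ =>
    (⟨MulAction.toPermHom SL(2, ℤ) ℍ γ, Subgroup.mem_map_of_mem _ γ.2⟩ : permGroup Γ)) ?_
  rintro ⟨_, γ, hγ, rfl⟩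
  exact ⟨⟨γ, hγ⟩, rfl⟩

/-- The union of translates of `𝒟` under representatives of the cosets of `Γ`. -/
def fdSet (Γ : Subgroup SL(2, ℤ)) : Set ℍ := ⋃ q : SL(2, ℤ) ⧸ Γ, (fun τ : ℍ => q.out • τ) ⁻¹' 𝒟

lemma measurableSet_fd_preimage (g : SL(2, ℤ)) : MeasurableSet ((fun τ : ℍ => g • τ) ⁻¹' 𝒟) :=
  (measurePreserving_SL g).measurable ModularGroup.isClosed_fd.measurableSet

/-- Interior points of 𝒟 are reduced uniquely up to sign, so any other overlap lies in a translate
of the boundary, which is null. -/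
lemma eq_or_eq_neg_of_not_null {g h : SL(2, ℤ)}
    (hgh : volume (((fun τ : ℍ => g • τ) ⁻¹' 𝒟) ∩ ((fun τ : ℍ => h • τ) ⁻¹' 𝒟)) ≠ 0) :
    h = g ∨ h = -g := by
  by_contra hne
  refine hgh (measure_mono_null (t := (fun τ : ℍ => g • τ) ⁻¹' (𝒟 \ 𝒟ᵒ)) ?_ ?_)
  · rintro τ ⟨h1, h2⟩
    refine ⟨h1, fun h3 => hne ?_⟩
    have h4 : (h * g⁻¹) • (g • τ) ∈ 𝒟 := by rwa [smul_smul, inv_mul_cancel_right]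
    rcases ModularGroup.eq_one_or_neg_one_of_mem_fdo_mem_fd h3 h4 with h5 | h5
    · left; rwa [mul_inv_eq_one] at h5
    · right; rw [mul_inv_eq_iff_eq_mul] at h5; rw [h5, neg_one_mul]
  · rw [(measurePreserving_SL g).measure_preimage (ModularGroup.isClosed_fd.measurableSet.diff
      ModularGroup.isOpen_fdo.measurableSet).nullMeasurableSet, volume_fd_diff_fdo]

lemma coset_aedisjoint {Γ : Subgroup SL(2, ℤ)} (hneg : -1 ∈ Γ) :
    Pairwise (Function.onFun (AEDisjoint volume)
      fun q : SL(2, ℤ) ⧸ Γ => (fun τ : ℍ => q.out • τ) ⁻¹' 𝒟) := by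
  intro q q' hqq'
  by_contra h
  refine hqq' ?_
  rw [← QuotientGroup.out_eq' q, ← QuotientGroup.out_eq' q', QuotientGroup.eq]
  rcases eq_or_eq_neg_of_not_null h with h1 | h1
  · rw [h1, inv_mul_cancel]; exact Γ.one_mem
  · rw [h1, mul_neg, inv_mul_cancel]; exact hneg

instance (Γ : Subgroup SL(2, ℤ)) : Countable (SL(2, ℤ) ⧸ Γ) :=
  Quotient.mk''_surjective.countable

-- The acting group consists of transformations rather than matrices because −1 acts trivially,
-- whereas distinct elements must have almost disjoint translates. The hypothesis −1 ∈ Γ ensures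
-- that matrices equal up to sign give the same coset.
open Pointwise in
lemma isFundamentalDomain_fdSet {Γ : Subgroup SL(2, ℤ)} (hneg : -1 ∈ Γ) :
    IsFundamentalDomain (permGroup Γ) (fdSet Γ) volume where
  nullMeasurableSet := (MeasurableSet.iUnion fun q => measurableSet_fd_preimage _).nullMeasurableSet
  ae_covers := ae_of_all _ fun τ => by
    obtain ⟨g, hg⟩ := ModularGroup.exists_smul_mem_fd τ
    have h1 : (QuotientGroup.mk (s := Γ) g).out⁻¹ * g ∈ Γ :=
      QuotientGroup.eq.mp (QuotientGroup.out_eq' _)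
    refine ⟨⟨MulAction.toPermHom SL(2, ℤ) ℍ _, Subgroup.mem_map_of_mem _ h1⟩, ?_⟩
    refine Set.mem_iUnion.mpr ⟨QuotientGroup.mk g, ?_⟩
    change (QuotientGroup.mk (s := Γ) g).out • (((QuotientGroup.mk (s := Γ) g).out⁻¹ * g) • τ) ∈ 𝒟
    rwa [smul_smul, mul_inv_cancel_left]
  aedisjoint := by
    rintro ⟨_, γ, hγ, rfl⟩ ⟨_, δ, hδ, rfl⟩ hne
    have hsm : ∀ ε : SL(2, ℤ), ∀ hε : MulAction.toPermHom SL(2, ℤ) ℍ ε ∈ permGroup Γ,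
        (⟨MulAction.toPermHom SL(2, ℤ) ℍ ε, hε⟩ : permGroup Γ) • fdSet Γ =
        ⋃ q : SL(2, ℤ) ⧸ Γ, (fun τ : ℍ => (q.out * ε⁻¹) • τ) ⁻¹' 𝒟 := fun ε hε => by
      ext τ
      rw [Set.mem_smul_set_iff_inv_smul_mem, fdSet, Set.mem_iUnion, Set.mem_iUnion]
      refine exists_congr fun q => ?_
      rw [Set.mem_preimage, Set.mem_preimage, mul_smul]
      rfl
    refine (congrArg₂ (AEDisjoint volume) (hsm γ (Subgroup.mem_map_of_mem _ hγ))
      (hsm δ (Subgroup.mem_map_of_mem _ hδ))).mpr ?_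
    rw [AEDisjoint, Set.iUnion_inter]
    refine measure_iUnion_null fun q => ?_
    rw [Set.inter_iUnion]
    refine measure_iUnion_null fun q' => ?_
    by_contra h
    refine hne ?_
    have h1 := eq_or_eq_neg_of_not_null h
    have hq : q = q' := by
      rw [← QuotientGroup.out_eq' q, ← QuotientGroup.out_eq' q', QuotientGroup.eq]
      rcases h1 with h1 | h1
      · rw [mul_inv_eq_iff_eq_mul] at h1
        rw [h1, mul_assoc, inv_mul_cancel_left]
        exact Γ.mul_mem (Γ.inv_mem hγ) hδ
      · rw [mul_inv_eq_iff_eq_mul] at h1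
        rw [h1, neg_mul, mul_assoc, mul_neg, inv_mul_cancel_left, ← neg_one_mul]
        exact Γ.mul_mem hneg (Γ.mul_mem (Γ.inv_mem hγ) hδ)
    subst hq
    refine Subtype.ext (Equiv.ext fun τ => ?_)
    change γ • τ = δ • τ
    rcases h1 with h1 | h1
    · rw [mul_right_inj, inv_inj] at h1
      rw [h1]
    · rw [← mul_neg, mul_right_inj] at h1
      have : δ = -γ := by
        have := congrArg (·⁻¹) h1
        simpa using this
      rw [this, ModularGroup.SL_neg_smul]

end

section

/-! ### Averages over `Γ \ ℍ` -/

/-- The average of `F` over `Γ \ ℍ`, normalised so that the constant `1` has average `vol 𝒟`. -/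
def avg (Γ : Subgroup SL(2, ℤ)) (F : ℍ → ℂ) : ℂ :=
  (Γ.index : ℂ)⁻¹ * ∑ᶠ q : SL(2, ℤ) ⧸ Γ, ∫ τ in 𝒟, F ((Quotient.out q)⁻¹ • τ)

/-- The average of `F` over `Γ \ ℍ` for any `Γ` of finite index leaving `F` invariant. -/
def mean (F : ℍ → ℂ) : ℂ := avg (stab F) F

/-- Bounded continuous functions on `ℍ` that are invariant under a congruence subgroup. -/
structure AutFn (F : ℍ → ℂ) : Prop where
  cont : Continuous F
  bdd : ∃ C : ℝ, ∀ τ, ‖F τ‖ ≤ C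
  cong : IsCongruenceSubgroup (stab F)

variable {F G : ℍ → ℂ} {Γ Γ' : Subgroup SL(2, ℤ)}

lemma neg_one_mem_stab : -1 ∈ stab F := fun τ => by rw [ModularGroup.SL_neg_smul, one_smul]

/-- Every fibre of the map of coset spaces has [Γ : Γ'] elements, on which the integrals agree, and
the index normalisation removes that factor. Averages are thus independent of the level, so that
forms of levels N and Np can be compared. -/
lemma avg_eq_avg_of_le [Γ'.FiniteIndex] (hle : Γ' ≤ Γ) (hF : Γ ≤ stab F) : avg Γ' F = avg Γ F := by
  have : Γ.FiniteIndex := Subgroup.finiteIndex_of_le hle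
  let J : SL(2, ℤ) ⧸ Γ → ℂ := fun q => ∫ τ in 𝒟, F ((Quotient.out q)⁻¹ • τ)
  let e := Subgroup.quotientEquivProdOfLE hle
  classical
  have : Fintype (SL(2, ℤ) ⧸ Γ) := Fintype.ofFinite _
  have : Fintype (SL(2, ℤ) ⧸ Γ') := Fintype.ofFinite _
  have : Finite (Γ ⧸ Γ'.subgroupOf Γ) := inferInstance
  have : Fintype (Γ ⧸ Γ'.subgroupOf Γ) := Fintype.ofFinite _
  have hJ : ∀ q : SL(2, ℤ) ⧸ Γ', ∫ τ in 𝒟, F ((Quotient.out q)⁻¹ • τ) = J (e q).1 := fun q => by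
    have h1 : (e q).1 = QuotientGroup.mk (s := Γ) (Quotient.out q) := by
      conv_lhs => rw [← QuotientGroup.out_eq' q]
      rfl
    have h2 : (Quotient.out (e q).1)⁻¹ * Quotient.out q ∈ Γ := by
      rw [← QuotientGroup.eq, h1]
      exact QuotientGroup.out_eq' _
    refine integral_congr_ae (ae_of_all _ fun τ => ?_)
    have h3 := hF h2 ((Quotient.out q)⁻¹ • τ)
    change F ((Quotient.out q)⁻¹ • τ) = F ((Quotient.out (e q).1)⁻¹ • τ)
    rw [← h3, smul_smul, mul_inv_cancel_right]
  have hidx : Γ'.index = Fintype.card (Γ ⧸ Γ'.subgroupOf Γ) * Γ.index := by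
    rw [← Subgroup.relIndex_mul_index hle, Subgroup.relIndex, Subgroup.index, Nat.card_eq_fintype_card]
  rw [avg, avg, finsum_eq_sum_of_fintype, finsum_eq_sum_of_fintype, Finset.sum_congr rfl fun q _ => hJ q,
    Equiv.sum_comp e (fun z => J z.1), Fintype.sum_prod_type]
  simp only [Finset.sum_const, Finset.card_univ, nsmul_eq_mul, ← Finset.mul_sum]
  rw [hidx]
  have h0 : (Fintype.card (Γ ⧸ Γ'.subgroupOf Γ) : ℂ) ≠ 0 := by
    exact_mod_cast Fintype.card_ne_zero
  have h1 : (Γ.index : ℂ) ≠ 0 := by exact_mod_cast Subgroup.FiniteIndex.index_ne_zero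
  push_cast
  field_simp
  rfl

lemma avg_eq_mean [Γ.FiniteIndex] (h : Γ ≤ stab F) : avg Γ F = mean F :=
  avg_eq_avg_of_le h le_rfl

lemma volume_fdSet [Γ.FiniteIndex] (hneg : -1 ∈ Γ) :
    volume (fdSet Γ) = Γ.index * volume 𝒟 := by
  have : Fintype (SL(2, ℤ) ⧸ Γ) := Fintype.ofFinite _
  rw [fdSet, measure_iUnion₀ (coset_aedisjoint hneg)
    fun q => (measurableSet_fd_preimage _).nullMeasurableSet]
  simp_rw [(measurePreserving_SL _).measure_preimage
    ModularGroup.isClosed_fd.measurableSet.nullMeasurableSet]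
  rw [tsum_fintype, Finset.sum_const, Finset.card_univ, nsmul_eq_mul, Subgroup.index,
    Nat.card_eq_fintype_card]

lemma volume_fdSet_lt_top [Γ.FiniteIndex] (hneg : -1 ∈ Γ) : volume (fdSet Γ) < ⊤ := by
  rw [volume_fdSet hneg]
  exact ENNReal.mul_lt_top (ENNReal.natCast_lt_top _) volume_fd_lt_top

lemma integrableOn_of_bdd (hc : Continuous F) (hb : ∃ C : ℝ, ∀ τ, ‖F τ‖ ≤ C) {s : Set ℍ}
    (hs : volume s < ⊤) : IntegrableOn F s := by
  obtain ⟨C, hC⟩ := hb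
  exact Measure.integrableOn_of_bounded hs.ne hc.aestronglyMeasurable (ae_of_all _ hC)

lemma avg_eq_setIntegral [Γ.FiniteIndex] (hneg : -1 ∈ Γ) (hc : Continuous F)
    (hb : ∃ C : ℝ, ∀ τ, ‖F τ‖ ≤ C) :
    avg Γ F = (Γ.index : ℂ)⁻¹ * ∫ τ in fdSet Γ, F τ := by
  have : Fintype (SL(2, ℤ) ⧸ Γ) := Fintype.ofFinite _
  have hInt := integrableOn_of_bdd hc hb (volume_fdSet_lt_top hneg)
  rw [fdSet] at hInt
  rw [avg, fdSet, integral_iUnion_ae (fun q => (measurableSet_fd_preimage _).nullMeasurableSet)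
    (coset_aedisjoint hneg) hInt, tsum_fintype, finsum_eq_sum_of_fintype]
  congr 1
  refine Finset.sum_congr rfl fun q _ => ?_
  have h1 := (measurePreserving_SL q.out).setIntegral_preimage_emb
    ((Homeomorph.smul (mapGL ℝ q.out : GL (Fin 2) ℝ)).measurableEmbedding)
    (fun τ => F (q.out⁻¹ • τ)) 𝒟
  rw [← h1]
  simp only [inv_smul_smul]

/-- The isometry g carries a fundamental domain of Γ₂ = g⁻¹Γ₁g to one of Γ₁, and the integral of an
invariant function does not depend on the domain. -/
lemma avg_comp {Γ₁ Γ₂ : Subgroup SL(2, ℤ)} [Γ₁.FiniteIndex] [Γ₂.FiniteIndex] (h₁ : -1 ∈ Γ₁)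
    (h₂ : -1 ∈ Γ₂) (g : GL (Fin 2) ℝ)
    (h12 : ∀ δ ∈ Γ₁, ∃ γ ∈ Γ₂, mapGL ℝ δ * g = g * mapGL ℝ γ)
    (h21 : ∀ γ ∈ Γ₂, ∃ δ ∈ Γ₁, mapGL ℝ δ * g = g * mapGL ℝ γ)
    (hF : Γ₁ ≤ stab F) (hc : Continuous F) (hb : ∃ C : ℝ, ∀ τ, ‖F τ‖ ≤ C) :
    avg Γ₂ (fun τ => F (g • τ)) = avg Γ₁ F := by
  have hmp := measurePreserving_GL g
  have hemb := (Homeomorph.smul (α := ℍ) g).measurableEmbedding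
  have hmem : ∀ σ : permGroup Γ₁, (MulAction.toPerm g)⁻¹ * σ.1 * MulAction.toPerm g ∈ permGroup Γ₂ := by
    rintro ⟨_, δ, hδ, rfl⟩
    obtain ⟨γ, hγ, h⟩ := h12 δ hδ
    refine ⟨γ, hγ, Equiv.ext fun τ => ?_⟩
    change γ • τ = g⁻¹ • (δ • (g • τ))
    have : δ • (g • τ) = g • (γ • τ) := by
      change mapGL ℝ δ • (g • τ) = g • (mapGL ℝ γ • τ)
      rw [smul_smul, h, mul_smul]
    rw [this, inv_smul_smul]
  have hFD : IsFundamentalDomain (permGroup Γ₂) ((fun τ : ℍ => g • τ) ⁻¹' fdSet Γ₁) volume := by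
    refine (isFundamentalDomain_fdSet h₁).preimage_of_equiv hmp.quasiMeasurePreserving
      (e := fun σ => ⟨_, hmem σ⟩) ⟨fun σ σ' h => ?_, ?_⟩ fun σ τ => ?_
    · have := congrArg Subtype.val h
      simp only [mul_left_inj, mul_right_inj] at this
      exact Subtype.ext this
    · rintro ⟨_, γ, hγ, rfl⟩
      obtain ⟨δ, hδ, h⟩ := h21 γ hγ
      refine ⟨⟨_, Subgroup.mem_map_of_mem _ hδ⟩, Subtype.ext (Equiv.ext fun τ => ?_)⟩
      change g⁻¹ • (δ • (g • τ)) = γ • τ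
      have : δ • (g • τ) = g • (γ • τ) := by
        change mapGL ℝ δ • (g • τ) = g • (mapGL ℝ γ • τ)
        rw [smul_smul, h, mul_smul]
      rw [this, inv_smul_smul]
    · change g • (g⁻¹ • (σ.1 (g • τ))) = σ.1 (g • τ)
      rw [smul_inv_smul]
  have hinv : ∀ (σ : permGroup Γ₂) (τ : ℍ), F (g • (σ • τ)) = F (g • τ) := by
    rintro ⟨_, γ, hγ, rfl⟩ τ
    obtain ⟨δ, hδ, h⟩ := h21 γ hγ
    rw [← hF hδ (g • τ)]
    change F (g • (mapGL ℝ γ • τ)) = F (mapGL ℝ δ • (g • τ))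
    rw [smul_smul, smul_smul, h]
  -- Two fundamental domains of Γ₂ have equal volume. This forces the indices of Γ₁ and Γ₂ in SL₂(ℤ)
  -- to agree.
  have hvol := (isFundamentalDomain_fdSet h₂).measure_eq hFD
  rw [hmp.measure_preimage (isFundamentalDomain_fdSet h₁).nullMeasurableSet, volume_fdSet h₁,
    volume_fdSet h₂, ENNReal.mul_left_inj volume_fd_ne_zero volume_fd_lt_top.ne] at hvol
  have hidx : Γ₂.index = Γ₁.index := by exact_mod_cast hvol
  rw [avg_eq_setIntegral h₁ hc hb, avg_eq_setIntegral (F := fun τ => F (g • τ)) h₂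
    (hc.comp (continuous_const_smul g)) (hb.imp fun _ hC _ => hC _), hidx,
    (isFundamentalDomain_fdSet h₂).setIntegral_eq hFD hinv, hmp.setIntegral_preimage_emb hemb]

lemma AutFn.finiteIndex (hF : AutFn F) : (stab F).FiniteIndex := hF.cong.finiteIndex

lemma AutFn.of_le (hc : Continuous F) (hb : ∃ C : ℝ, ∀ τ, ‖F τ‖ ≤ C)
    (hΓ : IsCongruenceSubgroup Γ) (h : Γ ≤ stab F) : AutFn F :=
  ⟨hc, hb, isCongruenceSubgroup_trans _ _ h hΓ⟩

lemma conj_invariant (F : ℍ → ℂ) (g : GL (Fin 2) ℝ) :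
    conjGL (stab F) g ≤ stab fun τ => F (g • τ) := by
  rintro γ hγ τ
  obtain ⟨δ, hδ, h⟩ := mem_conjGL.mp hγ
  refine Eq.trans ?_ (hδ (g • τ))
  change F (g • (mapGL ℝ γ • τ)) = F (mapGL ℝ δ • (g • τ))
  rw [smul_smul, smul_smul]
  congr 2
  have h' : mapGL ℝ δ = g * mapGL ℝ γ * g⁻¹ := h
  rw [h', inv_mul_cancel_right]

lemma AutFn.comp (hF : AutFn F) (g : GL (Fin 2) ℚ) :
    AutFn (fun τ => F (g.map (Rat.castHom ℝ) • τ)) :=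
  AutFn.of_le (hF.cont.comp (continuous_const_smul _)) (hF.bdd.imp fun _ hC _ => hC _)
    (hF.cong.conjGL g) (conj_invariant F _)

/-- The stabiliser of F need not be conjugated into SL₂(ℤ) by g. The change of variables is
therefore made on Γ₂ = g⁻¹ Stab(F) g ∩ SL₂(ℤ) and its conjugate back, which g interchanges exactly.
-/
lemma mean_comp (hF : AutFn F) (g : GL (Fin 2) ℚ) :
    mean (fun τ => F (g.map (Rat.castHom ℝ) • τ)) = mean F := by
  have hc2 := hF.cong.conjGL g
  have hc1 := hc2.conjGL g⁻¹
  set gR : GL (Fin 2) ℝ := g.map (Rat.castHom ℝ) with hgR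
  have hinv : (g⁻¹).map (Rat.castHom ℝ) = gR⁻¹ := map_inv _ _
  rw [hinv] at hc1
  have := hc1.finiteIndex
  have := hc2.finiteIndex
  have hle : conjGL (conjGL (stab F) gR) gR⁻¹ ≤ stab F := by
    intro δ hδ
    obtain ⟨γ, hγ, h⟩ := mem_conjGL.mp hδ
    obtain ⟨δ', hδ', h'⟩ := mem_conjGL.mp hγ
    have : δ' = δ := by
      refine mapGL_injective (S := ℝ) ?_
      change mapGL ℝ δ' = gR * mapGL ℝ γ * gR⁻¹ at h'
      change mapGL ℝ γ = gR⁻¹ * mapGL ℝ δ * gR⁻¹⁻¹ at h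
      rw [h', h]; group
    rwa [← this]
  have hneg : ∀ (Γ : Subgroup SL(2, ℤ)) (g : GL (Fin 2) ℝ), -1 ∈ Γ → -1 ∈ conjGL Γ g := fun Γ g h => by
    refine mem_conjGL.mpr ⟨-1, h, ?_⟩
    change mapGL ℝ (-1) = g * mapGL ℝ (-1) * g⁻¹
    have : mapGL ℝ (-1 : SL(2, ℤ)) = -1 := by ext i j; simp
    rw [this]; simp
  have h2neg := hneg _ gR (neg_one_mem_stab (F := F))
  rw [← avg_eq_mean (conj_invariant F gR), ← avg_eq_mean hle]
  refine avg_comp (hneg _ _ h2neg) h2neg gR (fun δ hδ => ?_) (fun γ hγ => ?_) hle hF.cont hF.bdd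
  · obtain ⟨γ, hγ, h⟩ := mem_conjGL.mp hδ
    refine ⟨γ, hγ, ?_⟩
    change mapGL ℝ γ = gR⁻¹ * mapGL ℝ δ * gR⁻¹⁻¹ at h
    rw [h]; group
  · obtain ⟨δ, hδ, h⟩ := mem_conjGL.mp hγ
    change mapGL ℝ δ = gR * mapGL ℝ γ * gR⁻¹ at h
    refine ⟨δ, mem_conjGL.mpr ⟨γ, hγ, ?_⟩, ?_⟩
    · change mapGL ℝ γ = gR⁻¹ * mapGL ℝ δ * gR⁻¹⁻¹
      rw [h]; group
    · rw [h]; group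

lemma isCongruenceSubgroup_inf (h : IsCongruenceSubgroup Γ) (h' : IsCongruenceSubgroup Γ') :
    IsCongruenceSubgroup (Γ ⊓ Γ') := by
  obtain ⟨n, hn, h⟩ := h
  obtain ⟨m, hm, h'⟩ := h'
  refine ⟨n * m, mul_ne_zero hn hm, le_inf (le_trans ?_ h) (le_trans ?_ h')⟩
  · exact Gamma_le_of_dvd (Dvd.intro m rfl)
  · exact Gamma_le_of_dvd (Dvd.intro_left n rfl)

end

section

variable {F G : ℍ → ℂ} {Γ : Subgroup SL(2, ℤ)} {w : ℤ} {x y z : ℍ → ℂ}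

open ComplexConjugate

lemma stab_inf_le_add : stab F ⊓ stab G ≤ stab (F + G) := fun γ hγ τ => by
  rw [Pi.add_apply, hγ.1, hγ.2, Pi.add_apply]

lemma AutFn.integrableOn (hF : AutFn F) (g : SL(2, ℤ)) : IntegrableOn (fun τ => F (g • τ)) 𝒟 :=
  integrableOn_of_bdd (hF.cont.comp (continuous_const_smul (mapGL ℝ g))) (hF.bdd.imp fun _ h _ => h _)
    volume_fd_lt_top

lemma mean_add (hF : AutFn F) (hG : AutFn G) : mean (F + G) = mean F + mean G := by
  have := (isCongruenceSubgroup_inf hF.cong hG.cong).finiteIndex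
  have : Fintype (SL(2, ℤ) ⧸ (stab F ⊓ stab G)) := Fintype.ofFinite _
  rw [← avg_eq_mean stab_inf_le_add, ← avg_eq_mean (inf_le_left : stab F ⊓ stab G ≤ stab F),
    ← avg_eq_mean (inf_le_right : stab F ⊓ stab G ≤ stab G), avg, avg, avg, ← mul_add,
    finsum_eq_sum_of_fintype, finsum_eq_sum_of_fintype, finsum_eq_sum_of_fintype,
    ← Finset.sum_add_distrib]
  congr 1
  refine Finset.sum_congr rfl fun q _ => ?_
  rw [← integral_add (hF.integrableOn _) (hG.integrableOn _)]
  rfl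

lemma stab_le_comp (φ : ℂ → ℂ) : stab F ≤ stab (fun τ => φ (F τ)) := fun γ hγ τ => by
  simp only [hγ τ]

lemma mean_smul (hF : AutFn F) (c : ℂ) : mean (c • F) = c * mean F := by
  have := hF.finiteIndex
  have : Fintype (SL(2, ℤ) ⧸ stab F) := Fintype.ofFinite _
  rw [← avg_eq_mean (show stab F ≤ stab (c • F) from stab_le_comp (c * ·)), mean, avg, avg,
    mul_left_comm, finsum_eq_sum_of_fintype, finsum_eq_sum_of_fintype, Finset.mul_sum _ _ c]
  congr 1
  refine Finset.sum_congr rfl fun q _ => ?_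
  rw [← integral_const_mul]
  rfl

lemma mean_conj (hF : AutFn F) : mean (fun τ => conj (F τ)) = conj (mean F) := by
  have := hF.finiteIndex
  have : Fintype (SL(2, ℤ) ⧸ stab F) := Fintype.ofFinite _
  rw [← avg_eq_mean (show stab F ≤ stab (fun τ => conj (F τ)) from stab_le_comp conj), mean, avg, avg,
    map_mul, finsum_eq_sum_of_fintype, finsum_eq_sum_of_fintype, map_sum (starRingEnd ℂ), map_inv₀,
    map_natCast, Finset.sum_congr rfl fun (q : SL(2, ℤ) ⧸ stab F) _ =>
      integral_conj (μ := volume.restrict 𝒟) (f := fun τ => F ((Quotient.out q)⁻¹ • τ))]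

/-! ### The Petersson product -/

lemma autFn_petersson (hx : x ∈ cuspFn w) (hy : y ∈ cuspFn w) : AutFn (petersson w y x) := by
  obtain ⟨n, hn, hxn⟩ := hx.2.1
  obtain ⟨m, hm, hym⟩ := hy.2.1
  have : NeZero (n * m) := ⟨mul_ne_zero hn hm⟩
  have hx' : ∀ γ ∈ Gamma (n * m), x ∣[w] γ = x := fun γ hγ =>
    hxn γ (Gamma_le_of_dvd (Dvd.intro m rfl) hγ)
  have hy' : ∀ γ ∈ Gamma (n * m), y ∣[w] γ = y := fun γ hγ =>
    hym γ (Gamma_le_of_dvd (Dvd.intro_left n rfl) hγ)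
  refine AutFn.of_le (petersson_continuous w hy.1.continuous hx.1.continuous) ?_
    (Gamma_is_cong_sub (n * m)) fun γ hγ τ => ?_
  · exact CuspFormClass.petersson_bounded_left w _ (toCuspForm hy hy') (toCuspForm hx hx')
  · rw [← petersson_slash_SL, hx' γ hγ, hy' γ hγ]

/-- The Petersson product of two cusp forms of arbitrary levels. -/
def pet (w : ℤ) (x y : ℍ → ℂ) : ℂ := mean (petersson w y x)

lemma peterssonProduct_eq {M : ℕ} [NeZero M] (hx : x ∈ cuspSpace M w) (hy : y ∈ cuspSpace M w) :
    peterssonProduct M w x y = pet w x y := by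
  refine avg_eq_mean (Γ := Gamma0 M) (F := petersson w y x) fun γ hγ τ => ?_
  rw [← petersson_slash_SL, cuspSpace_inv hx hγ, cuspSpace_inv hy hγ]

lemma pet_add_left (hx : x ∈ cuspFn w) (hy : y ∈ cuspFn w) (hz : z ∈ cuspFn w) :
    pet w (x + y) z = pet w x z + pet w y z := by
  rw [pet, pet, pet, ← mean_add (autFn_petersson hx hz) (autFn_petersson hy hz)]
  congr 1
  funext τ
  simp only [petersson, Pi.add_apply]
  ring

lemma pet_smul_left (hx : x ∈ cuspFn w) (hy : y ∈ cuspFn w) (c : ℂ) :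
    pet w (c • x) y = c * pet w x y := by
  rw [pet, pet, ← mean_smul (autFn_petersson hx hy)]
  congr 1
  funext τ
  simp only [petersson, Pi.smul_apply, smul_eq_mul]
  ring

lemma pet_symm (hx : x ∈ cuspFn w) (hy : y ∈ cuspFn w) : pet w x y = conj (pet w y x) := by
  rw [pet, pet, ← mean_conj (autFn_petersson hy hx)]
  congr 1
  funext τ
  exact petersson_symm w x y τ

lemma pet_add_right (hx : x ∈ cuspFn w) (hy : y ∈ cuspFn w) (hz : z ∈ cuspFn w) :
    pet w x (y + z) = pet w x y + pet w x z := by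
  rw [pet_symm hx (add_mem hy hz), pet_add_left hy hz hx, map_add, ← pet_symm hx hy, ← pet_symm hx hz]

lemma pet_smul_right (hx : x ∈ cuspFn w) (hy : y ∈ cuspFn w) (c : ℂ) :
    pet w x (c • y) = conj c * pet w x y := by
  rw [pet_symm hx (Submodule.smul_mem _ c hy), pet_smul_left hy hx, map_mul, ← pet_symm hx hy]

lemma pet_sub_left (hx : x ∈ cuspFn w) (hy : y ∈ cuspFn w) (hz : z ∈ cuspFn w) :
    pet w (x - y) z = pet w x z - pet w y z := by
  have h : x - y = x + (-1 : ℂ) • y := by simp [sub_eq_add_neg]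
  rw [h, pet_add_left hx (Submodule.smul_mem _ _ hy) hz, pet_smul_left hy hz]
  ring

lemma pet_sub_right (hx : x ∈ cuspFn w) (hy : y ∈ cuspFn w) (hz : z ∈ cuspFn w) :
    pet w x (y - z) = pet w x y - pet w x z := by
  have h : y - z = y + (-1 : ℂ) • z := by simp [sub_eq_add_neg]
  rw [h, pet_add_right hx hy (Submodule.smul_mem _ _ hz), pet_smul_right hx hz]
  simp
  ring

lemma pet_zero_left (hy : y ∈ cuspFn w) : pet w 0 y = 0 := by
  have := pet_smul_left (zero_mem (cuspFn w)) hy 0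
  rwa [zero_smul, zero_mul] at this

lemma pet_sum_left {ι : Type*} (s : Finset ι) (f : ι → ℍ → ℂ) (hf : ∀ i ∈ s, f i ∈ cuspFn w)
    (hy : y ∈ cuspFn w) : pet w (∑ i ∈ s, f i) y = ∑ i ∈ s, pet w (f i) y := by
  classical
  induction s using Finset.induction_on with
  | empty => rw [Finset.sum_empty, Finset.sum_empty, pet_zero_left hy]
  | insert a s ha ih =>
    rw [Finset.sum_insert ha, Finset.sum_insert ha, pet_add_left (hf a (Finset.mem_insert_self _ _))
      (Submodule.sum_mem _ fun i hi => hf i (Finset.mem_insert_of_mem hi)) hy,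
      ih fun i hi => hf i (Finset.mem_insert_of_mem hi)]

/-- The slash action normalised by det^{w−1} multiplies the invariant integrand by det^{w−2}, and
the mean is unchanged under g. -/
lemma pet_slash (hx : x ∈ cuspFn w) (hy : y ∈ cuspFn w) (g : GL (Fin 2) ℚ)
    (hg : 0 < (g.map (Rat.castHom ℝ)).det.val) :
    pet w (x ∣[w] g.map (Rat.castHom ℝ)) (y ∣[w] g.map (Rat.castHom ℝ)) =
      (((g.map (Rat.castHom ℝ)).det.val : ℝ) : ℂ) ^ (w - 2) * pet w x y := by
  have h := autFn_petersson hx hy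
  rw [pet, pet, ← mean_comp h g, ← mean_smul (h.comp g)]
  congr 1
  funext τ
  rw [petersson_slash, abs_of_pos hg, σ, if_pos hg]
  rfl

lemma pet_slash_SL (hx : x ∈ cuspFn w) (hy : y ∈ cuspFn w) (γ : SL(2, ℤ)) :
    pet w (x ∣[w] γ) (y ∣[w] γ) = pet w x y := by
  have hd : (mapGL ℝ γ).det.val = 1 := by simp
  have h := pet_slash hx hy (mapGL ℚ γ) (by rw [map_mapGL_rat, hd]; exact one_pos)
  rw [map_mapGL_rat, hd, Complex.ofReal_one, one_zpow, one_mul] at h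
  exact h

lemma pet_slash_diagR (hx : x ∈ cuspFn w) (hy : y ∈ cuspFn w) (a d : ℕ) [NeZero a] [NeZero d] :
    pet w (x ∣[w] diagR a d) (y ∣[w] diagR a d) = ((a : ℂ) * d) ^ (w - 2) * pet w x y := by
  have h := pet_slash hx hy (diagQ a d) (diagR_det_pos a d)
  have h2 : ((Matrix.GeneralLinearGroup.map (Rat.castHom ℝ)) (diagQ a d)).det.val = a * d :=
    diagR_det a d
  rw [h2] at h
  push_cast at h
  exact h

lemma slash_diagR_diagR (p : ℕ) [NeZero p] :
    (x ∣[w] diagR p 1) ∣[w] diagR 1 p = (p : ℂ) ^ (w - 2) • x := by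
  have hp : (p : ℂ) ≠ 0 := by simp [NeZero.ne]
  funext τ
  rw [slash_diagR, slash_diagR, diagR_one_mul, Pi.smul_apply, smul_eq_mul]
  simp only [Nat.cast_one, one_zpow, mul_one, one_mul]
  rw [← mul_assoc, ← zpow_add₀ hp, ← zpow_add₀ hp]
  congr 2
  ring

/-- The matrices diag(1, p) and diag(p, 1) multiply to the scalar p, so each is the adjoint of the
other. -/
lemma pet_slash_one (p : ℕ) [NeZero p] (hx : x ∈ cuspFn w) (hy : y ∈ cuspFn w) :
    pet w (x ∣[w] diagR 1 p) y = pet w x (y ∣[w] diagR p 1) := by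
  have hp : (p : ℂ) ^ (w - 2) ≠ 0 := zpow_ne_zero _ (by simp [NeZero.ne])
  have h := pet_slash_diagR hx (slash_diagR_mem_cuspFn hy p 1) 1 p
  rw [slash_diagR_diagR, pet_smul_right (slash_diagR_mem_cuspFn hx 1 p) hy, map_zpow₀,
    Complex.conj_natCast, Nat.cast_one, one_mul] at h
  exact mul_left_cancel₀ hp h

/-- Since y is invariant under T, all p translates in U contribute p^{w−1}⟨x, Vy⟩. -/
lemma pet_opU_left (p : ℕ) [NeZero p] (hx : x ∈ cuspFn w) (hy : y ∈ cuspFn w)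
    (hyT : y ∣[w] ModularGroup.T = y) : pet w (opU p x) y = (p : ℂ) ^ w * pet w x (opV p y) := by
  have hp : (p : ℂ) ≠ 0 := by simp [NeZero.ne]
  have hxD := slash_diagR_mem_cuspFn hx 1 p
  rw [opU_eq_sum_slash p w, pet_sum_left _ _ (fun b _ => slash_SL_mem_cuspFn hxD _) hy]
  have h1 : ∀ b ∈ Finset.range p, pet w ((x ∣[w] diagR 1 p) ∣[w] (ModularGroup.T ^ (b : ℤ) : SL(2, ℤ))) y =
      (p : ℂ) ^ (w - 1) * pet w x (opV p y) := fun b _ => by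
    conv_lhs => rw [← slash_SL_T_zpow hyT b]
    rw [pet_slash_SL hxD hy, pet_slash_one p hx hy, ← smul_opV,
      pet_smul_right hx (opV_mem_cuspFn p hy), map_zpow₀, Complex.conj_natCast]
  rw [Finset.sum_congr rfl h1, Finset.sum_const, Finset.card_range, nsmul_eq_mul, ← mul_assoc,
    ← zpow_one_add₀ hp]
  congr 2
  ring

lemma pet_opV_opV (p : ℕ) [NeZero p] (hx : x ∈ cuspFn w) (hy : y ∈ cuspFn w) :
    pet w (opV p x) (opV p y) = (p : ℂ) ^ (-w) * pet w x y := by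
  have hp : (p : ℂ) ≠ 0 := by simp [NeZero.ne]
  have h := pet_slash_diagR hx hy p 1
  rw [← smul_opV, ← smul_opV, pet_smul_left (opV_mem_cuspFn p hx)
    (Submodule.smul_mem _ _ (opV_mem_cuspFn p hy)), pet_smul_right (opV_mem_cuspFn p hx)
    (opV_mem_cuspFn p hy), map_zpow₀, Complex.conj_natCast, Nat.cast_one, mul_one, ← mul_assoc,
    ← zpow_add₀ hp] at h
  have h2 : (p : ℂ) ^ (w - 1 + (w - 1)) ≠ 0 := zpow_ne_zero _ hp
  refine mul_left_cancel₀ h2 ?_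
  rw [h, ← mul_assoc, ← zpow_add₀ hp]
  congr 2
  ring

/-- For p ∤ M the matrices diag(p, 1) and diag(1, p) lie in one double coset of Γ₀(M), as diag(p, 1)
s = s' diag(1, p). Hence V is self-adjoint between forms of level M. -/
lemma pet_opV_comm {M p : ℕ} [NeZero M] [NeZero p] (hp : p.Prime) (hpM : ¬ p ∣ M)
    (hx : x ∈ cuspSpace M w) (hy : y ∈ cuspSpace M w) : pet w x (opV p y) = pet w (opV p x) y := by
  have hp0 : (p : ℂ) ^ (w - 1) ≠ 0 := zpow_ne_zero _ (by simp [NeZero.ne])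
  have hx' := cuspSpace_le_cuspFn hx
  have hy' := cuspSpace_le_cuspFn hy
  have hcop : IsCoprime (p : ℤ) (M : ℤ) :=
    Nat.isCoprime_iff_coprime.mpr ((Nat.Prime.coprime_iff_not_dvd hp).mpr hpM)
  obtain ⟨v, u, huv⟩ := hcop
  let s : SL(2, ℤ) := ⟨!![1, -u; M, p * v], by rw [Matrix.det_fin_two]; simp; linarith⟩
  let s' : SL(2, ℤ) := ⟨!![(p : ℤ), -u; M, v], by rw [Matrix.det_fin_two]; simp; linarith⟩
  have hs : s ∈ Gamma0 M := by rw [Gamma0_mem_iff]; simp [s]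
  have hs' : s' ∈ Gamma0 M := by rw [Gamma0_mem_iff]; simp [s']
  have hss : (y ∣[w] diagR p 1) ∣[w] s = y ∣[w] diagR 1 p := by
    have : diagR p 1 * mapGL ℝ s = mapGL ℝ s' * diagR 1 p := by
      have e1 : s 0 0 = 1 ∧ s 0 1 = -u ∧ s 1 0 = M ∧ s 1 1 = p * v := by simp [s]
      have e2 : s' 0 0 = p ∧ s' 0 1 = -u ∧ s' 1 0 = M ∧ s' 1 1 = v := by simp [s']
      ext i j
      rw [Matrix.GeneralLinearGroup.coe_mul, Matrix.GeneralLinearGroup.coe_mul, diagR_val,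
        diagR_val]
      fin_cases i <;> fin_cases j <;>
        simp [Matrix.mul_apply, Fin.sum_univ_two, e1, e2, mul_comm]
    rw [SL_slash_eq, ← SlashAction.slash_mul, this, SlashAction.slash_mul]
    congr 1
    exact cuspSpace_inv hy hs'
  have h1 : pet w x (y ∣[w] diagR p 1) = pet w (x ∣[w] diagR p 1) y := by
    rw [← pet_slash_SL hx' (slash_diagR_mem_cuspFn hy' p 1) s, hss, cuspSpace_inv hx hs,
      pet_symm hx' (slash_diagR_mem_cuspFn hy' 1 p), pet_slash_one p hy' hx',
      ← pet_symm (slash_diagR_mem_cuspFn hx' p 1) hy']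
  rw [← smul_opV, ← smul_opV, pet_smul_right hx' (opV_mem_cuspFn p hy'),
    pet_smul_left (opV_mem_cuspFn p hx') hy', map_zpow₀, Complex.conj_natCast] at h1
  exact mul_left_cancel₀ hp0 h1

/-- Both halves of T_p are expressed through V. Combined with the self-adjointness of T_p, this
evaluates ⟨x, Vφ⟩ for an eigenform φ. -/
lemma pet_heckeT_left {M p : ℕ} [NeZero M] [NeZero p] (hp : p.Prime) (hpM : ¬ p ∣ M)
    (hx : x ∈ cuspSpace M w) (hy : y ∈ cuspSpace M w) :
    pet w (heckeT w p x) y = ((p : ℂ) ^ w + (p : ℂ) ^ (w - 1)) * pet w x (opV p y) := by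
  have hx' := cuspSpace_le_cuspFn hx
  have hy' := cuspSpace_le_cuspFn hy
  rw [heckeT, LinearMap.add_apply, LinearMap.smul_apply, pet_add_left (opU_mem_cuspFn p hx')
    (Submodule.smul_mem _ _ (opV_mem_cuspFn p hx')) hy', pet_smul_left (opV_mem_cuspFn p hx') hy',
    pet_opU_left p hx' hy' (slash_T_of_cuspSpace hy), pet_opV_comm hp hpM hx hy]
  ring

/-- `T_p` is self-adjoint on forms of level prime to `p`. -/
lemma pet_heckeT_comm {M p : ℕ} [NeZero M] [NeZero p] (hp : p.Prime) (hpM : ¬ p ∣ M)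
    (hx : x ∈ cuspSpace M w) (hy : y ∈ cuspSpace M w) :
    pet w (heckeT w p x) y = pet w x (heckeT w p y) := by
  have hx' := cuspSpace_le_cuspFn hx
  have hy' := cuspSpace_le_cuspFn hy
  rw [pet_heckeT_left hp hpM hx hy, pet_symm hx' (cuspSpace_le_cuspFn (heckeT_mem_cuspSpace hp hpM hy)),
    pet_heckeT_left hp hpM hy hx, map_mul, ← pet_symm (opV_mem_cuspFn p hx') hy',
    pet_opV_comm hp hpM hx hy]
  simp

lemma integral_petersson_self (g : SL(2, ℤ)) : ∫ τ in 𝒟, petersson w x x (g • τ) =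
    ((∫ τ in 𝒟, ‖x (g • τ)‖ ^ 2 * (g • τ).im ^ w : ℝ) : ℂ) := by
  rw [← integral_complex_ofReal]
  refine integral_congr_ae (ae_of_all _ fun τ => ?_)
  simp [petersson, Complex.conj_mul']

/-- The Petersson product is positive definite. -/
lemma pet_self_eq_zero (hx : x ∈ cuspFn w) (h : pet w x x = 0) : x = 0 := by
  have hA := autFn_petersson hx hx
  have := hA.finiteIndex
  have : Fintype (SL(2, ℤ) ⧸ stab (petersson w x x)) := Fintype.ofFinite _
  have hidx : ((stab (petersson w x x)).index : ℂ) ≠ 0 := by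
    exact_mod_cast Subgroup.FiniteIndex.index_ne_zero
  rw [pet, mean, avg, mul_eq_zero, or_iff_right (inv_ne_zero hidx), finsum_eq_sum_of_fintype] at h
  simp only [integral_petersson_self] at h
  have hnn : ∀ (g : SL(2, ℤ)) (τ : ℍ), 0 ≤ ‖x (g • τ)‖ ^ 2 * (g • τ).im ^ w := fun g τ =>
    mul_nonneg (sq_nonneg _) (zpow_nonneg (g • τ).im_pos.le _)
  have h1 : ∑ q : SL(2, ℤ) ⧸ stab (petersson w x x), ∫ τ in 𝒟,
      ‖x ((Quotient.out q)⁻¹ • τ)‖ ^ 2 * ((Quotient.out q)⁻¹ • τ).im ^ w = 0 := by exact_mod_cast h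
  rw [Finset.sum_eq_zero_iff_of_nonneg fun q _ => integral_nonneg (hnn _)] at h1
  have h4 := h1 (QuotientGroup.mk 1) (Finset.mem_univ _)
  set g : SL(2, ℤ) := (Quotient.out (QuotientGroup.mk (s := stab (petersson w x x)) 1))⁻¹
  have hcont : Continuous fun τ : ℍ => g • τ := continuous_const_smul (mapGL ℝ g)
  have hInt : IntegrableOn (fun τ : ℍ => ‖x (g • τ)‖ ^ 2 * (g • τ).im ^ w) 𝒟 := by
    have := (hA.integrableOn g).norm
    refine this.congr (ae_of_all _ fun τ => ?_)
    simp only [petersson]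
    rw [norm_mul, norm_mul, RCLike.norm_conj, norm_zpow, Complex.norm_real,
      Real.norm_of_nonneg (g • τ).im_pos.le, sq]
  rw [setIntegral_eq_zero_iff_of_nonneg_ae (ae_of_all _ (hnn g)) hInt] at h4
  have h5 : ∀ τ ∈ 𝒟ᵒ, x (g • τ) = 0 := by
    by_contra! hne
    obtain ⟨τ, hτ, hτ0⟩ := hne
    have hopen : IsOpen (𝒟ᵒ ∩ {τ | x (g • τ) ≠ 0}) :=
      ModularGroup.isOpen_fdo.inter (isOpen_ne_fun (hx.1.continuous.comp hcont) continuous_const)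
    have hpos := hopen.measure_pos volume ⟨τ, hτ, hτ0⟩
    refine hpos.ne' ?_
    rw [Filter.EventuallyEq, ae_restrict_iff' ModularGroup.isClosed_fd.measurableSet] at h4
    refine measure_mono_null ?_ h4
    rintro σ ⟨h6, h7⟩ h8
    have h9 := h8 (ModularGroup.fdo_subset_fd h6)
    rw [Pi.zero_apply, mul_eq_zero, or_iff_left (zpow_ne_zero _ (g • σ).im_ne_zero)] at h9
    exact h7 (by simpa using h9)
  have h6 : (𝒟ᵒ).Nonempty := ⟨⟨2 * Complex.I, by simp⟩, by
    constructor
    · simp [Complex.normSq_apply]; norm_num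
    · simp [← coe_re]⟩
  obtain ⟨τ, hτ⟩ := h6
  -- The form vanishes on a translate of the interior of 𝒟, hence everywhere by the identity
  -- theorem.
  refine UpperHalfPlane.eq_zero_of_frequently hx.1 (τ := g • τ) ?_
  refine Filter.Eventually.frequently ?_
  have hU : (fun σ : ℍ => g⁻¹ • σ) ⁻¹' 𝒟ᵒ ∈ 𝓝 (g • τ) :=
    (ModularGroup.isOpen_fdo.preimage (continuous_const_smul (mapGL ℝ g⁻¹))).mem_nhds (by
      change g⁻¹ • (g • τ) ∈ 𝒟ᵒ
      rwa [inv_smul_smul])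
  filter_upwards [mem_nhdsWithin_of_mem_nhds hU] with σ hσ
  have := h5 _ hσ
  rwa [smul_inv_smul] at this

end

/-! ### Simultaneous diagonalisation of the Hecke operators -/

section

variable {w : ℤ} {x y z : ℍ → ℂ}

open ComplexConjugate

lemma pet_self_re_nonneg : 0 ≤ (pet w x x).re := by
  rw [pet, mean, avg]
  simp only [integral_petersson_self]
  by_cases hf : (Function.support fun q : SL(2, ℤ) ⧸ stab (petersson w x x) =>
      ((∫ τ in 𝒟, ‖x ((Quotient.out q)⁻¹ • τ)‖ ^ 2 * ((Quotient.out q)⁻¹ • τ).im ^ w : ℝ) : ℂ)).Finite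
  · rw [finsum_eq_sum _ hf]
    rw [← Complex.ofReal_sum, ← Complex.ofReal_natCast, ← Complex.ofReal_inv, ← Complex.ofReal_mul,
      Complex.ofReal_re]
    refine mul_nonneg (by positivity) (Finset.sum_nonneg fun q _ => integral_nonneg fun τ =>
      mul_nonneg (sq_nonneg _) (zpow_nonneg (UpperHalfPlane.im_pos _).le _))
  -- An infinitely supported sum is 0 by convention, so positivity needs no hypothesis on x.
  · rw [finsum_of_infinite_support hf]; simp

/-- Commuting operators that are self-adjoint for a definite hermitian form are simultaneously
diagonalisable. -/
lemma iSup_iInf_eigenspace_eq_top {V : Type*} [AddCommGroup V] [Module ℂ V] [FiniteDimensional ℂ V]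
    (c : InnerProductSpace.Core ℂ V) {ι : Type*} (T : ι → V →ₗ[ℂ] V)
    (hT : ∀ i x y, c.inner (T i x) y = c.inner x (T i y)) (hc : ∀ i j, Commute (T i) (T j)) :
    ⨆ χ : ι → ℂ, ⨅ i, Module.End.eigenspace (T i) (χ i) = ⊤ := by
  let := c.toNormedAddCommGroup
  let : InnerProductSpace ℂ V := .ofCore c.toCore
  exact LinearMap.IsSymmetric.iSup_iInf_eq_top_of_commute (fun i x y => hT i x y)
    fun i j _ => hc i j

/-! ### Commutation of Hecke operators -/

lemma opU_comm (hx : QFn x) (a b : ℕ) [NeZero a] [NeZero b] : opU a (opU b x) = opU b (opU a x) := by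
  refine ((hx.opU b).opU a).ext ((hx.opU a).opU b) fun n => ?_
  rw [(hx.opU b).coeff_U, hx.coeff_U, (hx.opU a).coeff_U, hx.coeff_U]
  congr 1
  ring

lemma opV_comm (a b : ℕ) [NeZero a] [NeZero b] : opV a (opV b x) = opV b (opV a x) := by
  funext τ
  rw [opV_apply, opV_apply, opV_apply, opV_apply]
  congr 1
  ext
  rw [coe_diagR_smul, coe_diagR_smul, coe_diagR_smul, coe_diagR_smul]
  ring

lemma opU_opV_comm (hx : QFn x) {a b : ℕ} [NeZero a] [NeZero b] (hab : a.Coprime b) :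
    opU a (opV b x) = opV b (opU a x) := by
  refine ((hx.opV b).opU a).ext ((hx.opU a).opV b) fun n => ?_
  rw [(hx.opV b).coeff_U, hx.coeff_V, (hx.opU a).coeff_V, hx.coeff_U]
  by_cases h : b ∣ n
  · rw [if_pos h, if_pos (h.mul_left a), Nat.mul_div_assoc _ h]
  · rw [if_neg h, if_neg fun h' => h (hab.symm.dvd_of_dvd_mul_left h')]

lemma heckeT_apply (l : ℕ) : heckeT w l x = opU l x + (l : ℂ) ^ (w - 1) • opV l x := rfl

lemma heckeT_opU_comm (hx : QFn x) {a b : ℕ} [NeZero a] [NeZero b] (hab : a.Coprime b) :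
    heckeT w a (opU b x) = opU b (heckeT w a x) := by
  rw [heckeT_apply, heckeT_apply, map_add, _root_.map_smul, opU_comm hx, opU_opV_comm hx hab.symm]

lemma heckeT_opV_comm (hx : QFn x) {a b : ℕ} [NeZero a] [NeZero b] (hab : a.Coprime b) :
    heckeT w a (opV b x) = opV b (heckeT w a x) := by
  rw [heckeT_apply, heckeT_apply, map_add, _root_.map_smul, opV_comm, opU_opV_comm hx hab]

lemma heckeT_comm (hx : QFn x) {a b : ℕ} [NeZero a] [NeZero b] (hab : a.Coprime b) :
    heckeT w a (heckeT w b x) = heckeT w b (heckeT w a x) := by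
  rw [heckeT_apply b, map_add, _root_.map_smul, heckeT_opU_comm hx hab, heckeT_opV_comm hx hab]
  rfl

/-! ### The isotypic decomposition -/

variable {M : ℕ} [NeZero M] {φ : ℍ → ℂ}

/-- Self-adjointness of T_l gives e(l)⟨x, y⟩ = conj(e'(l))⟨x, y⟩. Taking both arguments equal to y ≠
0 first shows that e'(l) is real. -/
lemma pet_eigenspaces (e e' : ℕ → ℂ) (hx : x ∈ heckeEigenspace M w e)
    (hy : y ∈ heckeEigenspace M w e') {l : ℕ} (hl : l.Prime) (hlM : ¬ l ∣ M) (hne : e' l ≠ e l) :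
    pet w x y = 0 := by
  have : NeZero l := ⟨hl.ne_zero⟩
  have key : ∀ (a b : ℍ → ℂ) (e₁ e₂ : ℕ → ℂ), a ∈ heckeEigenspace M w e₁ →
      b ∈ heckeEigenspace M w e₂ → e₁ l * pet w a b = conj (e₂ l) * pet w a b := fun a b e₁ e₂ ha hb => by
    have h := pet_heckeT_comm hl hlM ha.1 hb.1
    rwa [ha.2 l hl hlM, hb.2 l hl hlM, pet_smul_left (cuspSpace_le_cuspFn ha.1)
      (cuspSpace_le_cuspFn hb.1), pet_smul_right (cuspSpace_le_cuspFn ha.1)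
      (cuspSpace_le_cuspFn hb.1)] at h
  by_cases hy0 : pet w y y = 0
  · rw [pet_self_eq_zero (cuspSpace_le_cuspFn hy.1) hy0, pet_symm (cuspSpace_le_cuspFn hx.1) (zero_mem _),
      pet_zero_left (cuspSpace_le_cuspFn hx.1), map_zero]
  · have hreal := mul_right_cancel₀ hy0 (key y y e' e' hy hy)
    by_contra h0
    have h1 := mul_right_cancel₀ h0 (key x y e e' hx hy)
    exact hne (hreal.trans h1.symm)

lemma pet_isotypicCompl (hx : x ∈ isotypicCompl M w φ) (hy : y ∈ isotypic M w φ) :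
    pet w x y = 0 := by
  have hy' := cuspSpace_le_cuspFn hy.1
  let K : Submodule ℂ (ℍ → ℂ) :=
    { carrier := {x | x ∈ cuspFn w ∧ pet w x y = 0}
      zero_mem' := ⟨zero_mem _, pet_zero_left hy'⟩
      add_mem' := fun {a b} ha hb => ⟨add_mem ha.1 hb.1, by
        rw [pet_add_left ha.1 hb.1 hy', ha.2, hb.2, add_zero]⟩
      smul_mem' := fun c a ha => ⟨Submodule.smul_mem _ _ ha.1, by
        rw [pet_smul_left ha.1 hy', ha.2, mul_zero]⟩ }
  have hK : isotypicCompl M w φ ≤ K := iSup₂_le fun e he z hz => by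
    obtain ⟨l, hl, hlM, hne⟩ := he
    exact ⟨cuspSpace_le_cuspFn hz.1, pet_eigenspaces e _ hz hy hl hlM hne.symm⟩
  exact (hK hx).2

/-- The operators T_l, l ∤ M, commute and are self-adjoint for a definite form on a
finite-dimensional space, so the simultaneous eigenspaces span it. Each of them is either the
φ-component or one of the others. -/
lemma exists_isotypic_decomposition (hx : x ∈ cuspSpace M w) :
    ∃ x' ∈ isotypic M w φ, x - x' ∈ isotypicCompl M w φ := by
  let ι := {l : ℕ // l.Prime ∧ ¬ l ∣ M}
  have hne : ∀ i : ι, NeZero i.1 := fun i => ⟨i.2.1.ne_zero⟩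
  let T : ι → cuspSpace M w →ₗ[ℂ] cuspSpace M w := fun i =>
    (heckeT w i.1).restrict fun x hx => heckeT_mem_cuspSpace i.2.1 i.2.2 hx
  have hcf : ∀ x : cuspSpace M w, x.1 ∈ cuspFn w := fun x => cuspSpace_le_cuspFn x.2
  let c : InnerProductSpace.Core ℂ (cuspSpace M w) :=
    -- The arguments are exchanged because an inner product is here conjugate-linear in its first
    -- variable.
    { inner := fun x y => pet w y.1 x.1
      conj_inner_symm := fun x y => (pet_symm (hcf y) (hcf x)).symm
      re_inner_nonneg := fun x => pet_self_re_nonneg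
      add_left := fun x y z => pet_add_right (hcf z) (hcf x) (hcf y)
      smul_left := fun x y r => pet_smul_right (hcf y) (hcf x) r
      definite := fun x h => Subtype.ext (pet_self_eq_zero (hcf x) h) }
  have htop := iSup_iInf_eigenspace_eq_top c T
    (fun i x y => (pet_heckeT_comm i.2.1 i.2.2 y.2 x.2).symm) (fun i j => by
      by_cases hij : i = j
      · rw [hij]
      · refine LinearMap.ext fun x => Subtype.ext ?_
        exact heckeT_comm (qfn_of_cuspSpace x.2)
          ((Nat.coprime_primes i.2.1 j.2.1).mpr fun h => hij (Subtype.ext h)))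
  have hle : (⊤ : Submodule ℂ (cuspSpace M w)) ≤
      (isotypic M w φ ⊔ isotypicCompl M w φ).comap (cuspSpace M w).subtype := by
    rw [← htop]
    refine iSup_le fun χ v hv => ?_
    classical
    let e : ℕ → ℂ := fun l => if h : l.Prime ∧ ¬ l ∣ M then χ ⟨l, h⟩ else 0
    have hve : v.1 ∈ heckeEigenspace M w e := by
      refine ⟨v.2, fun l hl hlM => ?_⟩
      have h1 := Module.End.mem_eigenspace_iff.mp ((Submodule.mem_iInf _).mp hv ⟨l, hl, hlM⟩)
      have h2 : e l = χ ⟨l, hl, hlM⟩ := dif_pos ⟨hl, hlM⟩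
      rw [h2]
      exact congrArg Subtype.val h1
    by_cases h : ∃ l : ℕ, l.Prime ∧ ¬ l ∣ M ∧ e l ≠ fourierCoeff φ l
    · exact Submodule.mem_sup_right (Submodule.mem_iSup_of_mem e (Submodule.mem_iSup_of_mem h hve))
    · push Not at h
      exact Submodule.mem_sup_left ⟨hve.1, fun l hl hlM => by
        change heckeT w l v.1 = fourierCoeff φ l • v.1
        rw [hve.2 l hl hlM, h l hl hlM]⟩
  obtain ⟨a, ha, b, hb, hab⟩ := Submodule.mem_sup.mp (hle (Submodule.mem_top (x := ⟨x, hx⟩)))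
  refine ⟨a, ha, ?_⟩
  have : x = a + b := hab.symm
  rwa [this, add_sub_cancel_left]

lemma isotypicProj_spec (hx : x ∈ cuspSpace M w) :
    isotypicProj M w φ x ∈ isotypic M w φ ∧ x - isotypicProj M w φ x ∈ isotypicCompl M w φ := by
  have h := exists_isotypic_decomposition (φ := φ) hx
  rw [isotypicProj, dif_pos h]
  exact h.choose_spec

/-- The difference of two candidates lies in the φ-component and in its complement. These are
orthogonal, so it is orthogonal to itself. -/
lemma isotypicProj_unique (hx : x ∈ cuspSpace M w) {x' : ℍ → ℂ} (h1 : x' ∈ isotypic M w φ)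
    (h2 : x - x' ∈ isotypicCompl M w φ) : isotypicProj M w φ x = x' := by
  have h := isotypicProj_spec (φ := φ) hx
  have h3 := sub_mem h.1 h1
  have h4 : isotypicProj M w φ x - x' ∈ isotypicCompl M w φ := by
    have := sub_mem h2 h.2
    rwa [sub_sub_sub_cancel_left] at this
  exact sub_eq_zero.mp (pet_self_eq_zero (cuspSpace_le_cuspFn h3.1) (pet_isotypicCompl h4 h3))

lemma isotypicProj_add (hx : x ∈ cuspSpace M w) (hy : y ∈ cuspSpace M w) :
    isotypicProj M w φ (x + y) = isotypicProj M w φ x + isotypicProj M w φ y := by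
  have h := isotypicProj_spec (φ := φ) hx
  have h' := isotypicProj_spec (φ := φ) hy
  refine isotypicProj_unique (add_mem hx hy) (add_mem h.1 h'.1) ?_
  rw [add_sub_add_comm]
  exact add_mem h.2 h'.2

lemma isotypicProj_smul (hx : x ∈ cuspSpace M w) (c : ℂ) :
    isotypicProj M w φ (c • x) = c • isotypicProj M w φ x := by
  have h := isotypicProj_spec (φ := φ) hx
  refine isotypicProj_unique (Submodule.smul_mem _ _ hx) (Submodule.smul_mem _ _ h.1) ?_
  rw [← smul_sub]
  exact Submodule.smul_mem _ _ h.2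

lemma pet_isotypicProj (hx : x ∈ cuspSpace M w) (hy : y ∈ isotypic M w φ) :
    pet w (isotypicProj M w φ x) y = pet w x y := by
  have h := isotypicProj_spec (φ := φ) hx
  have h1 := pet_isotypicCompl h.2 hy
  rw [pet_sub_left (cuspSpace_le_cuspFn hx) (cuspSpace_le_cuspFn h.1.1) (cuspSpace_le_cuspFn hy.1),
    sub_eq_zero] at h1
  exact h1.symm

lemma opU_mem_cuspSpace' {p : ℕ} [NeZero p] (hp : p.Prime) (hpM : p ∣ M) (hx : x ∈ cuspSpace M w) :
    opU p x ∈ cuspSpace M w :=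
  opU_mem_cuspSpace hp hpM (cuspSpace_mono (Dvd.intro_left p rfl) hx)

lemma opU_mem_heckeEigenspace {p : ℕ} [NeZero p] (hp : p.Prime) (hpM : p ∣ M) {e : ℕ → ℂ}
    (hx : x ∈ heckeEigenspace M w e) : opU p x ∈ heckeEigenspace M w e := by
  refine ⟨opU_mem_cuspSpace' hp hpM hx.1, fun l hl hlM => ?_⟩
  have : NeZero l := ⟨hl.ne_zero⟩
  have hlp : l.Coprime p := (Nat.coprime_primes hl hp).mpr fun h => hlM (h ▸ hpM)
  rw [heckeT_opU_comm (qfn_of_cuspSpace hx.1) hlp, hx.2 l hl hlM, _root_.map_smul]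

/-- For p ∣ M the operator U_p commutes with all T_l, l ∤ M, and so preserves every eigenspace in
the decomposition. -/
lemma isotypicProj_opU {p : ℕ} [NeZero p] (hp : p.Prime) (hpM : p ∣ M) (hx : x ∈ cuspSpace M w) :
    isotypicProj M w φ (opU p x) = opU p (isotypicProj M w φ x) := by
  have h := isotypicProj_spec (φ := φ) hx
  refine isotypicProj_unique (opU_mem_cuspSpace' hp hpM hx) (opU_mem_heckeEigenspace hp hpM h.1) ?_
  rw [← map_sub]
  have hle : isotypicCompl M w φ ≤ (isotypicCompl M w φ).comap (opU p) :=
    iSup₂_le fun e he z hz => Submodule.mem_iSup_of_mem e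
      (Submodule.mem_iSup_of_mem he (opU_mem_heckeEigenspace hp hpM hz))
  exact hle h.2

end

section

variable {w : ℤ} {x y z : ℍ → ℂ}

/-! ### Strong multiplicity one -/

/-- Coefficients prime to the level are determined by the Hecke eigenvalues. -/
lemma coeff_mul_of_coprime {M : ℕ} [NeZero M] {e : ℕ → ℂ} (hx : x ∈ heckeEigenspace M w e)
    (hy : y ∈ heckeEigenspace M w e) (n : ℕ) (hn : n.Coprime M) :
    fourierCoeff x n * fourierCoeff y 1 = fourierCoeff x 1 * fourierCoeff y n := by
  induction n using Nat.strong_induction_on with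
  | _ n ih =>
    rcases Nat.eq_zero_or_pos n with rfl | hn0
    · rw [fourierCoeff_zero hx.1, fourierCoeff_zero hy.1, zero_mul, mul_zero]
    by_cases h1 : n = 1
    · rw [h1]
    have hl := Nat.minFac_prime h1
    obtain ⟨m, hm⟩ := Nat.minFac_dvd n
    set l := n.minFac
    have : NeZero l := ⟨hl.ne_zero⟩
    have hlM : ¬ l ∣ M := fun h => hl.one_lt.ne'
      (Nat.dvd_one.mp (hn ▸ Nat.dvd_gcd ⟨m, hm⟩ h))
    have hmM : m.Coprime M := hn.coprime_dvd_left ⟨l, by rw [hm, mul_comm]⟩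
    have hm0 : 0 < m := Nat.pos_of_ne_zero fun h => by simp [h] at hm; omega
    have hmn : m < n := by rw [hm]; exact lt_mul_of_one_lt_left hm0 hl.one_lt
    have hrec : ∀ u ∈ heckeEigenspace M w e, fourierCoeff u n = e l * fourierCoeff u m -
        (l : ℂ) ^ (w - 1) * (if l ∣ m then fourierCoeff u (m / l) else 0) := fun u hu => by
      have hq := qfn_of_cuspSpace hu.1
      have h := hq.coeff_T w l m
      rw [hu.2 l hl hlM, hq.coeff_smul, ← hm] at h
      rw [h, add_sub_cancel_right]
    rw [hrec x hx, hrec y hy]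
    have h2 := ih m hmn hmM
    split_ifs with hd
    · have h3 := ih (m / l) ((Nat.div_le_self _ _).trans_lt hmn)
        (hmM.coprime_dvd_left (Nat.div_dvd_of_dvd hd))
      linear_combination e l * h2 - (l : ℂ) ^ (w - 1) * h3
    · linear_combination e l * h2

/-- The depletion of a cusp form at a set of primes dividing its level. -/
lemma exists_depletion {M : ℕ} [NeZero M] (s : Finset ℕ) (hs : ∀ l ∈ s, l.Prime ∧ l ∣ M)
    (hx : x ∈ cuspSpace M w) : ∃ X ∈ cuspSpace (M * ∏ l ∈ s, l) w,
      ∀ n, fourierCoeff X n = if ∀ l ∈ s, ¬ l ∣ n then fourierCoeff x n else 0 := by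
  induction s using Finset.induction_on with
  | empty => exact ⟨x, by simpa using hx, fun n => by simp⟩
  | insert l s hls ih =>
    obtain ⟨X, hX, hXn⟩ := ih fun l hl => hs l (Finset.mem_insert_of_mem hl)
    obtain ⟨hl, hlM⟩ := hs l (Finset.mem_insert_self _ _)
    have h0 : NeZero (∏ l ∈ s, l) := ⟨Finset.prod_ne_zero_iff.mpr fun l hl =>
      (hs l (Finset.mem_insert_of_mem hl)).1.ne_zero⟩
    have : NeZero l := ⟨hl.ne_zero⟩
    have hq := qfn_of_cuspSpace hX
    rw [Finset.prod_insert hls, show M * (l * ∏ l ∈ s, l) = (M * ∏ l ∈ s, l) * l by ring]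
    -- V_l U_l keeps exactly the coefficients at multiples of l.
    refine ⟨X - opV l (opU l X), sub_mem (cuspSpace_mono (Dvd.intro _ rfl) hX)
      (opV_mem_cuspSpace (opU_mem_cuspSpace' hl (hlM.mul_right _) hX)), fun n => ?_⟩
    rw [hq.coeff_sub ((hq.opU l).opV l), (hq.opU l).coeff_V, hq.coeff_U]
    simp only [Finset.forall_mem_insert]
    by_cases hd : l ∣ n
    · rw [if_pos hd, Nat.mul_div_cancel' hd, sub_self, if_neg fun h => h.1 hd]
    · rw [if_neg hd, sub_zero, hXn]
      simp only [hd, not_false_eq_true, true_and]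

lemma coprime_iff_primeFactors {n N : ℕ} (hN : N ≠ 0) :
    (∀ l ∈ N.primeFactors, ¬ l ∣ n) ↔ n.Coprime N := by
  rw [Nat.coprime_comm]
  constructor
  · intro h
    exact Nat.Coprime.symm (Nat.coprime_of_dvd fun l hl h1 h2 =>
      h l (Nat.mem_primeFactors.mpr ⟨hl, h2, hN⟩) h1)
  · intro h l hl hd
    have hp := Nat.prime_of_mem_primeFactors hl
    exact hp.one_lt.ne' (Nat.dvd_one.mp (h ▸ Nat.dvd_gcd (Nat.dvd_of_mem_primeFactors hl) hd))

section StrongMultiplicityOne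

variable {N p : ℕ} [NeZero N] [NeZero p] {φ : ℍ → ℂ}

lemma IsNormalisedEigenform.qfn (hφ : IsNormalisedEigenform N w φ) : QFn φ :=
  qfn_of_cuspSpace hφ.mem

lemma IsNormalisedEigenform.mem_isotypic (hφ : IsNormalisedEigenform N w φ) :
    φ ∈ isotypic (N * p) w φ :=
  ⟨cuspSpace_mono (Dvd.intro _ rfl) hφ.mem, fun l hl hlM =>
    hφ.hecke l hl fun h => hlM (h.mul_right _)⟩

lemma IsNormalisedEigenform.coeff_prime_mul (hφ : IsNormalisedEigenform N w φ) {l : ℕ}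
    (hl : l.Prime) (hlN : ¬ l ∣ N) (n : ℕ) : fourierCoeff φ (l * n) =
      fourierCoeff φ l * fourierCoeff φ n -
        (l : ℂ) ^ (w - 1) * (if l ∣ n then fourierCoeff φ (n / l) else 0) := by
  have : NeZero l := ⟨hl.ne_zero⟩
  have h := hφ.qfn.coeff_T w l n
  rw [hφ.hecke l hl hlN, hφ.qfn.coeff_smul] at h
  rw [h, add_sub_cancel_right]

lemma opU_mem_isotypic {l M : ℕ} [NeZero M] [NeZero l] (hl : l.Prime) (hlM : l ∣ M)
    (hx : x ∈ isotypic M w φ) : opU l x ∈ isotypic M w φ := opU_mem_heckeEigenspace hl hlM hx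

lemma coeff_of_isotypic_coprime (hφ : IsNormalisedEigenform N w φ)
    (hx : x ∈ isotypic (N * p) w φ) {n : ℕ} (hn : n.Coprime (N * p)) :
    fourierCoeff x n = fourierCoeff x 1 * fourierCoeff φ n := by
  have h := coeff_mul_of_coprime hx hφ.mem_isotypic n hn
  rwa [hφ.coeff_one, mul_one] at h

/-- A form of level `N * p` with the eigenvalues of `φ` is, away from `N`, a combination of `φ` and
`V_p φ`. -/
lemma coeff_of_isotypic (hp : p.Prime) (hpN : ¬ p ∣ N) (hφ : IsNormalisedEigenform N w φ)
    (hx : x ∈ isotypic (N * p) w φ) {n : ℕ} (hn : n.Coprime N) :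
    fourierCoeff x n = fourierCoeff x 1 * fourierCoeff φ n +
      (fourierCoeff x p - fourierCoeff x 1 * fourierCoeff φ p) *
        (if p ∣ n then fourierCoeff φ (n / p) else 0) := by
  have hN0 : N ≠ 0 := NeZero.ne N
  set Q := ∏ l ∈ N.primeFactors, l with hQ
  have hs : ∀ l ∈ N.primeFactors, l.Prime ∧ l ∣ N := fun l hl =>
    ⟨Nat.prime_of_mem_primeFactors hl, Nat.dvd_of_mem_primeFactors hl⟩
  have : NeZero Q := ⟨Finset.prod_ne_zero_iff.mpr fun l hl => (hs l hl).1.ne_zero⟩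
  have hpQ : ¬ p ∣ Q := fun h => by
    obtain ⟨l, hl, hd⟩ := (Prime.dvd_finsetProd_iff hp.prime _).mp h
    exact hpN (((Nat.prime_dvd_prime_iff_eq hp (hs l hl).1).mp hd) ▸ (hs l hl).2)
  obtain ⟨X, hX, hXn⟩ := exists_depletion N.primeFactors
    (fun l hl => ⟨(hs l hl).1, (hs l hl).2.mul_right p⟩) hx.1
  obtain ⟨Φ, hΦ, hΦn⟩ := exists_depletion N.primeFactors hs hφ.mem
  rw [← hQ] at hX hΦ
  simp only [coprime_iff_primeFactors hN0] at hXn hΦn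
  have hpL : ¬ p ∣ N * Q := fun h => (hp.dvd_mul.mp h).elim hpN hpQ
  have hXL : X ∈ cuspSpace (p * (N * Q)) w := by
    rwa [show p * (N * Q) = N * p * Q by ring]
  have hΦL : Φ ∈ cuspSpace (p * (N * Q)) w := cuspSpace_mono (Dvd.intro_left _ rfl) hΦ
  have hXq := qfn_of_cuspSpace hXL
  have hΦq := qfn_of_cuspSpace hΦ
  set c := fourierCoeff x 1
  -- After depletion at the primes of N, the eigenvalues at primes not dividing Np fix every
  -- coefficient of X prime to p. Hence Y is supported on multiples of p, Y = V(UY), and UY descends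
  -- to the level NQ, which is prime to p.
  set Y := X - c • Φ with hY
  have hYL : Y ∈ cuspSpace (p * (N * Q)) w := sub_mem hXL (Submodule.smul_mem _ _ hΦL)
  have hYq := qfn_of_cuspSpace hYL
  have hYn : ∀ n, fourierCoeff Y n =
      if n.Coprime N then fourierCoeff x n - c * fourierCoeff φ n else 0 := fun n => by
    rw [hY, hXq.coeff_sub (hΦq.smul c), hΦq.coeff_smul, hXn, hΦn]
    split_ifs <;> simp
  have hcop : ∀ n : ℕ, n.Coprime N → ¬ p ∣ n → n.Coprime (N * p) := fun n h1 h2 =>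
    h1.mul_right ((Nat.coprime_comm.mp ((Nat.Prime.coprime_iff_not_dvd hp).mpr h2)))
  have hVU : opV p (opU p Y) = Y := by
    refine ((hYq.opU p).opV p).ext hYq fun n => ?_
    rw [(hYq.opU p).coeff_V, hYq.coeff_U]
    split_ifs with hd
    · rw [Nat.mul_div_cancel' hd]
    · rw [hYn]
      split_ifs with hc
      · rw [coeff_of_isotypic_coprime hφ hx (hcop n hc hd), sub_self]
      · rfl
  have hz : opU p Y ∈ cuspSpace (N * Q) w :=
    mem_cuspSpace_of_opV hp (hYq.opU p) (by rwa [hVU])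
  set c' := fourierCoeff x p - c * fourierCoeff φ p with hc'
  have hpc : p.Coprime N := (Nat.Prime.coprime_iff_not_dvd hp).mpr hpN
  -- The constant c' is chosen so that this difference, of level prime to p, has coefficients only
  -- at multiples of p. Such a form vanishes.
  have hz0 : opU p Y - c' • Φ = 0 := by
    refine eq_zero_of_coeff_supported hp hpL (sub_mem hz (Submodule.smul_mem _ _ hΦ)) fun n hd => ?_
    rw [(hYq.opU p).coeff_sub (hΦq.smul c'), hΦq.coeff_smul, hYq.coeff_U, hYn, hΦn]
    by_cases hc : n.Coprime N
    · rw [if_pos (hpc.mul_left hc), if_pos hc, hφ.coeff_prime_mul hp hpN, if_neg hd]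
      have h1 := coeff_of_isotypic_coprime hφ (opU_mem_isotypic hp (Dvd.intro_left _ rfl) hx)
        (hcop n hc hd)
      rw [(qfn_of_cuspSpace hx.1).coeff_U, (qfn_of_cuspSpace hx.1).coeff_U, mul_one] at h1
      rw [h1, hc']
      ring
    · rw [if_neg hc, if_neg fun h => hc (h.coprime_dvd_left (Dvd.intro_left _ rfl))]
      simp
  have hXe : Y = c' • opV p Φ := by
    rw [← hVU, sub_eq_zero.mp hz0, _root_.map_smul]
  have h := congrFun (congrArg fourierCoeff hXe) n
  rw [hYn, if_pos hn, (hΦq.opV p).coeff_smul, hΦq.coeff_V] at h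
  rw [sub_eq_iff_eq_add.mp h, add_comm]
  congr 2
  split_ifs with hd
  · rw [hΦn, if_pos (hn.coprime_dvd_left (Nat.div_dvd_of_dvd hd))]
  · rfl

/-- On the isotypic component of level `N * p` the operator `U_p` satisfies the Hecke polynomial
of `φ` at `p`. -/
theorem opU_opU_of_isotypic (hp : p.Prime) (hpN : ¬ p ∣ N) (hφ : IsNormalisedEigenform N w φ)
    (hx : x ∈ isotypic (N * p) w φ) :
    opU p (opU p x) - fourierCoeff φ p • opU p x + (p : ℂ) ^ (w - 1) • x = 0 := by
  have hpc : p.Coprime N := (Nat.Prime.coprime_iff_not_dvd hp).mpr hpN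
  have hq : ∀ x ∈ isotypic (N * p) w φ,
      QFn (opU p (opU p x) - fourierCoeff φ p • opU p x + (p : ℂ) ^ (w - 1) • x) := fun x hx => by
    have h := qfn_of_cuspSpace hx.1
    exact (((h.opU p).opU p).sub ((h.opU p).smul _)).add (h.smul _)
  have hco : ∀ x ∈ isotypic (N * p) w φ, ∀ n, fourierCoeff
      (opU p (opU p x) - fourierCoeff φ p • opU p x + (p : ℂ) ^ (w - 1) • x) n =
      fourierCoeff x (p * (p * n)) - fourierCoeff φ p * fourierCoeff x (p * n) +
        (p : ℂ) ^ (w - 1) * fourierCoeff x n := fun x hx n => by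
    have h := qfn_of_cuspSpace hx.1
    rw [(((h.opU p).opU p).sub ((h.opU p).smul _)).coeff_add (h.smul _),
      ((h.opU p).opU p).coeff_sub ((h.opU p).smul _), (h.opU p).coeff_U, h.coeff_U,
      (h.opU p).coeff_smul, h.coeff_U, h.coeff_smul]
  refine (hq x hx).ext QFn.zero fun n => ?_
  rw [fourierCoeff_zero_fn, hco x hx]
  -- The form x must vary: if a prime l divides both n and N, the coefficients are read off from U_l
  -- x, which stays in the component, at n / l. If n is prime to N, all coefficients involved are
  -- combinations of those of φ and Vφ.
  induction n using Nat.strong_induction_on generalizing x with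
  | _ n ih =>
    rcases Nat.eq_zero_or_pos n with rfl | hn0
    · simp [fourierCoeff_zero hx.1]
    by_cases hn : n.Coprime N
    · rw [coeff_of_isotypic hp hpN hφ hx (hpc.mul_left (hpc.mul_left hn)),
        coeff_of_isotypic hp hpN hφ hx (hpc.mul_left hn), coeff_of_isotypic hp hpN hφ hx hn,
        hφ.coeff_prime_mul hp hpN (p * n), hφ.coeff_prime_mul hp hpN n,
        if_pos (Dvd.intro _ rfl), if_pos (Dvd.intro _ rfl), Nat.mul_div_cancel_left _ hp.pos,
        Nat.mul_div_cancel_left _ hp.pos, hφ.coeff_prime_mul hp hpN n]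
      ring
    · obtain ⟨l, hl, hln, hlN⟩ := Nat.Prime.not_coprime_iff_dvd.mp hn
      have : NeZero l := ⟨hl.ne_zero⟩
      obtain ⟨m, rfl⟩ := hln
      have hm0 : 0 < m := Nat.pos_of_mul_pos_left hn0
      have h := ih m (lt_mul_of_one_lt_left hm0 hl.one_lt)
        (opU_mem_isotypic hl (hlN.mul_right p) hx)
      have hxq := qfn_of_cuspSpace hx.1
      rw [hxq.coeff_U, hxq.coeff_U, hxq.coeff_U] at h
      rw [← h]
      congr 2
      · congr 1; ring
      · congr 2; ring

end StrongMultiplicityOne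

end

section

/-! ### Powers of `p`-adic units -/

section PadicPowers

variable {p : ℕ} [hp : Fact p.Prime]

lemma norm_p_padicComplex : ‖(p : ℂ_[p])‖ = (p : ℝ)⁻¹ := by
  have h := PadicComplex.norm_extends' p (p : ℚ_[p])
  rw [Padic.norm_p] at h
  rw [← h]
  congr 1
  simp

lemma norm_pow_sub_one_le {y : ℂ_[p]} (hy : ‖y‖ ≤ 1) (n : ℕ) : ‖y ^ n - 1‖ ≤ ‖y - 1‖ := by
  rw [← mul_geom_sum, norm_mul]
  refine mul_le_of_le_one_right (norm_nonneg _) ?_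
  refine IsUltrametricDist.norm_sum_le_of_forall_le_of_nonneg zero_le_one fun i _ => ?_
  rw [norm_pow]
  exact pow_le_one₀ (norm_nonneg _) hy

/-- From y^p − 1 = (y − 1)(∑ (y^i − 1) + p): raising to the power p improves a congruence to 1. -/
lemma norm_pow_prime_sub_one_le {y : ℂ_[p]} (hy : ‖y‖ ≤ 1) :
    ‖y ^ p - 1‖ ≤ ‖y - 1‖ * max ‖y - 1‖ (p : ℝ)⁻¹ := by
  rw [← mul_geom_sum, norm_mul]
  refine mul_le_mul_of_nonneg_left ?_ (norm_nonneg _)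
  have : ∑ i ∈ Finset.range p, y ^ i = ∑ i ∈ Finset.range p, (y ^ i - 1) + p := by
    simp [Finset.sum_sub_distrib]
  rw [this]
  refine (IsUltrametricDist.norm_add_le_max _ _).trans (max_le_max ?_ norm_p_padicComplex.le)
  exact IsUltrametricDist.norm_sum_le_of_forall_le_of_nonneg (norm_nonneg _)
    fun i _ => norm_pow_sub_one_le hy i

lemma norm_pow_prime_pow_sub_one_le {y : ℂ_[p]} (hy : ‖y‖ ≤ 1) (a : ℕ) :
    ‖y ^ p ^ a - 1‖ ≤ ‖y - 1‖ * max ‖y - 1‖ (p : ℝ)⁻¹ ^ a := by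
  induction a with
  | zero => simp
  | succ a ih =>
    have hy' : ‖y ^ p ^ a‖ ≤ 1 := by rw [norm_pow]; exact pow_le_one₀ (norm_nonneg _) hy
    rw [pow_succ, pow_mul]
    refine (norm_pow_prime_sub_one_le hy').trans ?_
    rw [pow_succ, ← mul_assoc]
    exact mul_le_mul ih (max_le_max (norm_pow_sub_one_le hy _) le_rfl) (by positivity)
      (by positivity)

/-- Some power of an algebraic unit is congruent to `1`. -/
lemma exists_norm_pow_sub_one_lt_of_algebraic {a : PadicAlgCl p} (ha : ‖a‖ = 1) :
    ∃ m, 0 < m ∧ ‖a ^ m - 1‖ < 1 := by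
  have hInt : IsIntegral ℚ_[p] a := (PadicAlgCl.isAlgebraic p).isAlgebraic a |>.isIntegral
  set f := minpoly ℚ_[p] a
  -- The norm of a is the spectral value of its minimal polynomial, so norm 1 makes that polynomial
  -- integral.
  have hf : ∀ n, ‖f.coeff n‖ ≤ 1 := (spectralValue_le_one_iff (minpoly.monic hInt)).mp
    (by rw [← ha, ← PadicAlgCl.spectralNorm_eq]; rfl)
  have hl : f ∈ Polynomial.lifts (algebraMap ℤ_[p] ℚ_[p]) :=
    (Polynomial.lifts_iff_coeff_lifts f).mpr fun n => ⟨⟨f.coeff n, hf n⟩, rfl⟩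
  obtain ⟨g, hgf, -, hg⟩ := Polynomial.lifts_and_natDegree_eq_and_monic hl (minpoly.monic hInt)
  set ψ : ℤ_[p] →+* PadicAlgCl p := (algebraMap ℚ_[p] (PadicAlgCl p)).comp (algebraMap ℤ_[p] ℚ_[p])
  have hψ : ∀ c, ‖ψ c‖ = ‖c‖ := fun c => PadicAlgCl.norm_extends p c
  have hga : g.eval₂ ψ a = 0 := by
    rw [← Polynomial.eval₂_map, hgf]
    exact minpoly.aeval _ _
  let r : ℕ → Polynomial ℤ_[p] := fun i => Polynomial.X ^ i %ₘ g
  have hr : ∀ i, a ^ i = ∑ t : Fin g.natDegree, ψ ((r i).coeff t) * a ^ (t : ℕ) := fun i => by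
    have h1 : (r i).eval₂ ψ a = a ^ i := by
      have := congrArg (Polynomial.eval₂ ψ a) (Polynomial.modByMonic_add_div (Polynomial.X ^ i) g)
      rwa [Polynomial.eval₂_add, Polynomial.eval₂_mul, hga, zero_mul, add_zero,
        Polynomial.eval₂_X_pow] at this
    have h0 : g ≠ 1 := by rintro h; simp [h] at hga
    rw [← h1, Polynomial.eval₂_eq_sum_range' ψ (Polynomial.natDegree_modByMonic_lt _ hg h0),
      Finset.sum_range]
  -- Pigeonhole: the remainders of X^i modulo g have only finitely many reductions mod p, so two
  -- powers of a are congruent.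
  obtain ⟨i, j, hij, he⟩ := Finite.exists_ne_map_eq_of_infinite
    (fun (i : ℕ) (t : Fin g.natDegree) => PadicInt.toZMod ((r i).coeff t))
  wlog hlt : i < j generalizing i j
  · exact this j i hij.symm he.symm (lt_of_le_of_ne (not_lt.mp hlt) hij.symm)
  refine ⟨j - i, by omega, ?_⟩
  have hp1 : (p : ℝ)⁻¹ < 1 := inv_lt_one_of_one_lt₀ (by exact_mod_cast hp.out.one_lt)
  have h1 : ‖a ^ j - a ^ i‖ ≤ (p : ℝ)⁻¹ := by
    rw [hr, hr, ← Finset.sum_sub_distrib]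
    refine IsUltrametricDist.norm_sum_le_of_forall_le_of_nonneg (by positivity) fun t _ => ?_
    rw [← sub_mul, ← map_sub, norm_mul, norm_pow, ha, one_pow, mul_one, hψ]
    have h2 : (r j).coeff t - (r i).coeff t ∈ RingHom.ker (PadicInt.toZMod (p := p)) := by
      rw [RingHom.mem_ker, map_sub, sub_eq_zero]
      exact (congrFun he t).symm
    rw [PadicInt.ker_toZMod, PadicInt.maximalIdeal_eq_span_p, Ideal.mem_span_singleton] at h2
    obtain ⟨c, hc⟩ := h2
    rw [hc, norm_mul, PadicInt.norm_p]
    exact mul_le_of_le_one_right (by positivity) (PadicInt.norm_le_one _)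
  have h3 : a ^ j - a ^ i = a ^ i * (a ^ (j - i) - 1) := by
    rw [mul_sub, ← pow_add, Nat.add_sub_cancel' hlt.le, mul_one]
  rw [h3, norm_mul, norm_pow, ha, one_pow, one_mul] at h1
  exact h1.trans_lt hp1

/-- Approximate u by an algebraic a with |u − a| < 1. The ultrametric inequality gives |a| = 1 and
|u^m − a^m| < 1. -/
lemma exists_norm_pow_sub_one_lt {u : ℂ_[p]} (hu : ‖u‖ = 1) : ∃ m, 0 < m ∧ ‖u ^ m - 1‖ < 1 := by
  obtain ⟨a, ha⟩ := UniformSpace.Completion.denseRange_coe.exists_dist_lt u one_pos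
  rw [dist_eq_norm] at ha
  have hau : ‖(a : ℂ_[p])‖ = 1 := by
    have h := IsUltrametricDist.norm_eq_of_add_norm_lt_max (x := u) (y := -(a : ℂ_[p]))
      (by rw [← sub_eq_add_neg, hu]; exact lt_max_of_lt_left ha)
    rw [norm_neg] at h
    rw [← h, hu]
  obtain ⟨m, hm, h⟩ := exists_norm_pow_sub_one_lt_of_algebraic
    (by rwa [PadicComplex.norm_extends] at hau : ‖a‖ = 1)
  refine ⟨m, hm, ?_⟩
  have h1 : ‖(a : ℂ_[p]) ^ m - 1‖ < 1 := by
    rw [← PadicComplex.norm_extends] at h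
    convert h using 2
    rw [PadicComplex.coe_eq, PadicComplex.coe_eq, map_sub, map_pow, map_one]
  have h2 : ‖u ^ m - (a : ℂ_[p]) ^ m‖ < 1 := by
    rw [← Commute.mul_geom_sum₂ (Commute.all _ _), norm_mul]
    refine lt_of_le_of_lt (mul_le_of_le_one_right (norm_nonneg _) ?_) ha
    refine IsUltrametricDist.norm_sum_le_of_forall_le_of_nonneg zero_le_one fun i _ => ?_
    rw [norm_mul, norm_pow, norm_pow, hu, hau, one_pow, one_pow, one_mul]
  rw [← sub_add_sub_cancel _ ((a : ℂ_[p]) ^ m)]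
  exact (IsUltrametricDist.norm_add_le_max _ _).trans_lt (max_lt h2 h1)

/-- `u ^ j! → 1` for every unit `u` of `ℂ_p`. -/
theorem tendsto_pow_factorial {u : ℂ_[p]} (hu : ‖u‖ = 1) :
    Tendsto (fun j : ℕ => u ^ j.factorial) atTop (𝓝 1) := by
  obtain ⟨m, hm, h⟩ := exists_norm_pow_sub_one_lt hu
  have hy : ‖u ^ m‖ ≤ 1 := by rw [norm_pow, hu, one_pow]
  set r := max ‖u ^ m - 1‖ (p : ℝ)⁻¹
  have hr0 : 0 ≤ r := le_max_of_le_left (norm_nonneg _)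
  have hr : r < 1 := max_lt h (inv_lt_one_of_one_lt₀ (by exact_mod_cast hp.out.one_lt))
  rw [Metric.tendsto_atTop]
  intro ε hε
  obtain ⟨a, ha⟩ := exists_pow_lt_of_lt_one hε hr
  refine ⟨m * p ^ a, fun j hj => ?_⟩
  -- For j ≥ m p^a the factorial is divisible by m p^a: the factor m brings u near 1 and p^a
  -- sharpens the congruence.
  obtain ⟨t, ht⟩ := Nat.dvd_factorial (Nat.mul_pos hm (pow_pos hp.out.pos a)) hj
  rw [dist_eq_norm, ht, pow_mul, pow_mul]
  refine lt_of_le_of_lt ?_ ha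
  have h1 : ‖(u ^ m) ^ p ^ a‖ ≤ 1 := by rw [norm_pow]; exact pow_le_one₀ (norm_nonneg _) hy
  refine (norm_pow_sub_one_le h1 t).trans ((norm_pow_prime_pow_sub_one_le hy a).trans ?_)
  exact mul_le_of_le_one_left (pow_nonneg hr0 a) h.le

lemma tendsto_pow_factorial_zero {u : ℂ_[p]} (hu : ‖u‖ < 1) :
    Tendsto (fun j : ℕ => u ^ j.factorial) atTop (𝓝 0) :=
  (tendsto_pow_atTop_nhds_zero_of_norm_lt_one hu).comp
    (tendsto_atTop_mono Nat.self_le_factorial tendsto_id)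

end PadicPowers

/-! ### The ordinary projector on the isotypic component -/

section OrdinaryProjector

variable {w : ℤ} {x y : ℍ → ℂ} {N p : ℕ} [NeZero N] [hp : Fact p.Prime] {φ : ℍ → ℂ} {α β : ℂ}

lemma opU_iterate_eigen (p : ℕ) (hx : opU p x = α • x) (j : ℕ) : (opU p)^[j] x = α ^ j • x := by
  induction j with
  | zero => simp
  | succ j ih => rw [Function.iterate_succ_apply, hx, ← Module.End.pow_apply, _root_.map_smul,
      Module.End.pow_apply, ih, smul_smul, pow_succ']

lemma ordProj_unique {M : ℕ} [NeZero M] (ι : ℂ ≃+* ℂ_[p]) {x' : ℍ → ℂ} (h1 : x' ∈ cuspSpace M w)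
    (h2 : ∀ n, Tendsto (fun j : ℕ => ι (fourierCoeff ((opU p)^[j.factorial] x) n)) atTop
      (𝓝 (ι (fourierCoeff x' n)))) : ordProj p ι M w x = x' := by
  have h : ∃ x' ∈ cuspSpace M w, ∀ n : ℕ,
      Tendsto (fun j : ℕ => ι (fourierCoeff ((opU p)^[j.factorial] x) n)) atTop
        (𝓝 (ι (fourierCoeff x' n))) := ⟨x', h1, h2⟩
  rw [ordProj, dif_pos h]
  exact (qfn_of_cuspSpace h.choose_spec.1).ext (qfn_of_cuspSpace h1) fun n =>
    ι.injective (tendsto_nhds_unique (h.choose_spec.2 n) (h2 n))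

/-- On the two eigenvectors U^{j!} acts by α^{j!} → 1 and β^{j!} → 0. -/
lemma ordProj_eigen_add {M : ℕ} [NeZero M] (ι : ℂ ≃+* ℂ_[p]) (hα : ‖ι α‖ = 1) (hβ : ‖ι β‖ < 1)
    (hx : x ∈ cuspSpace M w) (hy : y ∈ cuspSpace M w) (hxα : opU p x = α • x)
    (hyβ : opU p y = β • y) : ordProj p ι M w (x + y) = x := by
  refine ordProj_unique ι hx fun n => ?_
  have hxq := qfn_of_cuspSpace hx
  have hyq := qfn_of_cuspSpace hy
  have h : ∀ j : ℕ, ι (fourierCoeff ((opU p)^[j.factorial] (x + y)) n) =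
      ι α ^ j.factorial * ι (fourierCoeff x n) + ι β ^ j.factorial * ι (fourierCoeff y n) :=
    fun j => by
    rw [← Module.End.pow_apply, map_add, Module.End.pow_apply, Module.End.pow_apply,
      opU_iterate_eigen p hxα, opU_iterate_eigen p hyβ, (hxq.smul _).coeff_add (hyq.smul _),
      hxq.coeff_smul, hyq.coeff_smul]
    simp
  simp only [h]
  have := ((tendsto_pow_factorial hα).mul_const (ι (fourierCoeff x n))).add
    ((tendsto_pow_factorial_zero hβ).mul_const (ι (fourierCoeff y n)))
  simpa using this

/-- On the isotypic component of an ordinary eigenform, `e_ord` is the projector onto the `U_p`-eigenspace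
of the unit root. -/
theorem ordProj_of_isotypic (hpN : ¬ p ∣ N) (ι : ℂ ≃+* ℂ_[p])
    (hφ : IsNormalisedEigenform N w φ) (hsum : α + β = fourierCoeff φ p)
    (hprod : α * β = (p : ℂ) ^ (w - 1)) (hα : ‖ι α‖ = 1) (hβ : ‖ι β‖ < 1)
    (hx : x ∈ isotypic (N * p) w φ) :
    ordProj p ι (N * p) w x = (α - β)⁻¹ • (opU p x - β • x) := by
  have hp0 : NeZero p := ⟨hp.out.ne_zero⟩
  have hne : α - β ≠ 0 := fun h => by rw [sub_eq_zero.mp h] at hα; linarith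
  have hU := opU_opU_of_isotypic hp.out hpN hφ hx
  rw [← hsum, ← hprod] at hU
  have hUx := (opU_mem_isotypic hp.out (Dvd.intro_left N rfl) hx).1
  have hUU : opU p (opU p x) = (α + β) • opU p x - (α * β) • x := by
    rw [eq_sub_iff_add_eq, ← sub_eq_zero, ← hU]; abel
  -- Split x as (α − β)⁻¹((U − β)x − (U − α)x). By the quadratic relation the two terms are
  -- eigenvectors for α and β.
  have h := ordProj_eigen_add (w := w) (M := N * p) ι hα hβ
    (x := (α - β)⁻¹ • (opU p x - β • x)) (y := -((α - β)⁻¹ • (opU p x - α • x)))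
    (Submodule.smul_mem _ _ (sub_mem hUx (Submodule.smul_mem _ _ hx.1)))
    (neg_mem (Submodule.smul_mem _ _ (sub_mem hUx (Submodule.smul_mem _ _ hx.1))))
    (by rw [_root_.map_smul, map_sub, _root_.map_smul, hUU, smul_comm]; congr 1; module)
    (by rw [map_neg, _root_.map_smul, map_sub, _root_.map_smul, hUU, smul_neg, smul_comm β]
        congr 2; module)
  rw [← h]
  congr 1
  rw [← sub_eq_add_neg, ← smul_sub, eq_inv_smul_iff₀ hne]
  module

end OrdinaryProjector

end

/-! ### The ordinary functional, its eigenproperties and the non-vanishing of the denominators -/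

section

open ComplexConjugate

variable {w : ℤ} {x y : ℍ → ℂ}

/-- A normalised eigenform `φ` of level `N`, ordinary at `p ∤ N`, with its Satake parameters. -/
structure IsOrdinary (N p : ℕ) [Fact p.Prime] (w : ℤ) (ι : ℂ ≃+* ℂ_[p]) (φ : ℍ → ℂ) (α β : ℂ) :
    Prop where
  eigen : IsNormalisedEigenform N w φ
  not_dvd : ¬ p ∣ N
  add_eq : α + β = fourierCoeff φ p
  mul_eq : α * β = (p : ℂ) ^ (w - 1)
  norm_unit : ‖ι α‖ = 1
  norm_lt : ‖ι β‖ < 1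

/-- The functional `x ↦ ⟨e_ord e_φ x, y⟩`, with the ordinary projector written in terms of `U_p`. -/
def ordFunctional (w : ℤ) (p : ℕ) (α β : ℂ) (y x : ℍ → ℂ) : ℂ :=
  (α - β)⁻¹ * (pet w (opU p x) y - β * pet w x y)

section OrdFunctional

variable {N p : ℕ} [NeZero N] [hp : Fact p.Prime] {ι : ℂ ≃+* ℂ_[p]} {φ : ℍ → ℂ} {α β : ℂ}

instance neZero_of_fact_prime : NeZero p := ⟨hp.out.ne_zero⟩

lemma opV_mem_isotypic (hφ : IsNormalisedEigenform N w φ) : opV p φ ∈ isotypic (N * p) w φ := by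
  refine ⟨opV_mem_cuspSpace hφ.mem, fun l hl hlM => ?_⟩
  have : NeZero l := ⟨hl.ne_zero⟩
  have hlp : l.Coprime p := (Nat.coprime_primes hl hp.out).mpr fun h =>
    hlM (h ▸ Dvd.intro_left N rfl)
  rw [heckeT_opV_comm hφ.qfn hlp, hφ.hecke l hl fun h => hlM (h.mul_right p), _root_.map_smul]

lemma stabilisation_mem_isotypic (hφ : IsNormalisedEigenform N w φ) :
    stabilisation p β φ ∈ isotypic (N * p) w φ :=
  sub_mem hφ.mem_isotypic (Submodule.smul_mem _ _ (opV_mem_isotypic hφ))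

lemma IsOrdinary.opU_eigen (H : IsOrdinary N p w ι φ α β) : opU p φ =
    (α + β) • φ - (α * β) • opV p φ := by
  have h := H.eigen.hecke p hp.out H.not_dvd
  rw [heckeT_apply, ← H.add_eq, ← H.mul_eq] at h
  rw [← h, add_sub_cancel_right]

lemma IsOrdinary.opU_stabilisation (H : IsOrdinary N p w ι φ α β) :
    opU p (stabilisation p β φ) = α • stabilisation p β φ := by
  rw [stabilisation, map_sub, _root_.map_smul, opU_opV H.eigen.qfn, H.opU_eigen]
  module

lemma IsOrdinary.sub_ne_zero (H : IsOrdinary N p w ι φ α β) : α - β ≠ 0 := fun h => by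
  have h1 := H.norm_unit
  have h2 := H.norm_lt
  rw [sub_eq_zero.mp h] at h1
  linarith

lemma IsOrdinary.unit_ne_zero (H : IsOrdinary N p w ι φ α β) : α ≠ 0 := fun h => by
  have h1 := H.norm_unit
  simp [h] at h1

lemma ordFunctional_add (hx : x ∈ cuspFn w) (hy : y ∈ cuspFn w) {z : ℍ → ℂ} (hz : z ∈ cuspFn w) :
    ordFunctional w p α β z (x + y) = ordFunctional w p α β z x + ordFunctional w p α β z y := by
  rw [ordFunctional, map_add, pet_add_left (opU_mem_cuspFn p hx) (opU_mem_cuspFn p hy) hz,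
    pet_add_left hx hy hz, ordFunctional, ordFunctional]
  ring

lemma ordFunctional_smul (hx : x ∈ cuspFn w) {z : ℍ → ℂ} (hz : z ∈ cuspFn w) (c : ℂ) :
    ordFunctional w p α β z (c • x) = c * ordFunctional w p α β z x := by
  rw [ordFunctional, _root_.map_smul, pet_smul_left (opU_mem_cuspFn p hx) hz,
    pet_smul_left hx hz, ordFunctional]
  ring

lemma ordFunctional_sub (hx : x ∈ cuspFn w) (hy : y ∈ cuspFn w) {z : ℍ → ℂ} (hz : z ∈ cuspFn w) :
    ordFunctional w p α β z (x - y) = ordFunctional w p α β z x - ordFunctional w p α β z y := by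
  rw [ordFunctional, map_sub, pet_sub_left (opU_mem_cuspFn p hx) (opU_mem_cuspFn p hy) hz,
    pet_sub_left hx hy hz, ordFunctional, ordFunctional]
  ring

/-- The projector e_φ commutes with U and is orthogonal, and φ_α lies in its image. It can therefore
be dropped, leaving a formula in U alone. -/
lemma IsOrdinary.pet_ordProj (H : IsOrdinary N p w ι φ α β) (hx : x ∈ cuspSpace (N * p) w) :
    pet w (ordProj p ι (N * p) w (isotypicProj (N * p) w φ x)) (stabilisation p β φ) =
      ordFunctional w p α β (stabilisation p β φ) x := by
  have hs := stabilisation_mem_isotypic (p := p) (β := β) H.eigen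
  have hs' := cuspSpace_le_cuspFn hs.1
  have he := (isotypicProj_spec (φ := φ) hx).1
  have hU := opU_mem_isotypic hp.out (Dvd.intro_left N rfl) he
  have hUx := opU_mem_cuspSpace' hp.out (Dvd.intro_left N rfl) hx
  have hc := cuspSpace_le_cuspFn he.1
  have hUc := cuspSpace_le_cuspFn hU.1
  rw [ordProj_of_isotypic H.not_dvd ι H.eigen H.add_eq H.mul_eq H.norm_unit H.norm_lt he,
    pet_smul_left (sub_mem hUc (Submodule.smul_mem _ _ hc)) hs',
    pet_sub_left hUc (Submodule.smul_mem _ _ hc) hs', pet_smul_left hc hs',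
    ← isotypicProj_opU hp.out (Dvd.intro_left N rfl) hx, pet_isotypicProj hUx hs,
    pet_isotypicProj hx hs, ordFunctional]

/-- The Hecke polynomial on the φ-component says (U − β)U = α(U − β). -/
lemma IsOrdinary.ordFunctional_opU (H : IsOrdinary N p w ι φ α β)
    (hx : x ∈ cuspSpace (N * p) w) :
    ordFunctional w p α β (stabilisation p β φ) (opU p x) =
      α * ordFunctional w p α β (stabilisation p β φ) x := by
  have hs := stabilisation_mem_isotypic (p := p) (β := β) H.eigen
  have hs' := cuspSpace_le_cuspFn hs.1
  have hpN : p ∣ N * p := Dvd.intro_left N rfl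
  have he := (isotypicProj_spec (φ := φ) hx).1
  have hU := opU_mem_isotypic hp.out hpN he
  have hUx := opU_mem_cuspSpace' hp.out hpN hx
  have hUUx := opU_mem_cuspSpace' hp.out hpN hUx
  have h := opU_opU_of_isotypic hp.out H.not_dvd H.eigen he
  rw [← H.add_eq, ← H.mul_eq] at h
  have h1 : opU p (opU p (isotypicProj (N * p) w φ x)) =
      (α + β) • opU p (isotypicProj (N * p) w φ x) - (α * β) • isotypicProj (N * p) w φ x := by
    rw [eq_sub_iff_add_eq, ← _root_.sub_eq_zero, ← h]; abel
  have h2 : pet w (opU p (opU p x)) (stabilisation p β φ) =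
      (α + β) * pet w (opU p x) (stabilisation p β φ) -
        (α * β) * pet w x (stabilisation p β φ) := by
    rw [← pet_isotypicProj hUUx hs, ← pet_isotypicProj hUx hs, ← pet_isotypicProj hx hs,
      isotypicProj_opU hp.out hpN hUx, isotypicProj_opU hp.out hpN hx, h1,
      pet_sub_left (Submodule.smul_mem _ _ (cuspSpace_le_cuspFn hU.1))
        (Submodule.smul_mem _ _ (cuspSpace_le_cuspFn he.1)) hs',
      pet_smul_left (cuspSpace_le_cuspFn hU.1) hs', pet_smul_left (cuspSpace_le_cuspFn he.1) hs']
  rw [ordFunctional, ordFunctional, h2]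
  ring

/-- Apply the previous rule to Vx and use UV = 1. -/
lemma IsOrdinary.ordFunctional_opV (H : IsOrdinary N p w ι φ α β) (hx : x ∈ cuspSpace N w) :
    ordFunctional w p α β (stabilisation p β φ) (opV p x) =
      α⁻¹ * ordFunctional w p α β (stabilisation p β φ) x := by
  have h := H.ordFunctional_opU (opV_mem_cuspSpace hx)
  rw [opU_opV (qfn_of_cuspSpace hx)] at h
  rw [h, inv_mul_cancel_left₀ H.unit_ne_zero]

lemma add_zpow_ne_zero (w : ℤ) : (p : ℂ) ^ w + (p : ℂ) ^ (w - 1) ≠ 0 := by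
  have : (p : ℂ) ^ w + (p : ℂ) ^ (w - 1) = (((p : ℝ) ^ w + (p : ℝ) ^ (w - 1) : ℝ) : ℂ) := by
    push_cast; rfl
  rw [this, Complex.ofReal_ne_zero]
  have : (0 : ℝ) < p := by exact_mod_cast hp.out.pos
  positivity

lemma pet_opV_right_of_eigen (hφ : IsNormalisedEigenform N w φ) (hpN : ¬ p ∣ N)
    (hx : x ∈ cuspSpace N w) : pet w x (opV p φ) =
      conj (fourierCoeff φ p) / ((p : ℂ) ^ w + (p : ℂ) ^ (w - 1)) * pet w x φ := by
  have h1 := pet_heckeT_left hp.out hpN hx hφ.mem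
  have h2 := pet_heckeT_comm hp.out hpN hx hφ.mem
  rw [hφ.hecke p hp.out hpN, pet_smul_right (cuspSpace_le_cuspFn hx)
    (cuspSpace_le_cuspFn hφ.mem), h1] at h2
  rw [div_mul_eq_mul_div, eq_div_iff (add_zpow_ne_zero w), ← h2, mul_comm]

/-- On forms of level `N` the functional is proportional to the product with `φ`. -/
lemma IsOrdinary.exists_ordFunctional_eq (H : IsOrdinary N p w ι φ α β) : ∃ κ : ℂ,
    ∀ x ∈ cuspSpace N w, ordFunctional w p α β (stabilisation p β φ) x = κ * pet w x φ := by
  set a := fourierCoeff φ p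
  set e := conj a / ((p : ℂ) ^ w + (p : ℂ) ^ (w - 1))
  have hφ' := cuspSpace_le_cuspFn H.eigen.mem
  have hV' := opV_mem_cuspFn p hφ'
  -- The result of writing U = T_p − p^{w−1}V and expanding, each product being a multiple of ⟨x,
  -- φ⟩; here e is the ratio ⟨x, Vφ⟩ / ⟨x, φ⟩. The value cancels in the final quotient, only its
  -- non-vanishing matters.
  refine ⟨(α - β)⁻¹ * ((conj a - (p : ℂ) ^ (w - 1) * e - conj β * (conj a * e -
    (p : ℂ) ^ (w - 1) * (p : ℂ) ^ (-w))) - β * (1 - conj β * e)), fun x hx => ?_⟩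
  have hx' := cuspSpace_le_cuspFn hx
  have hT := heckeT_mem_cuspSpace hp.out H.not_dvd hx
  have hT' := cuspSpace_le_cuspFn hT
  have hVx := opV_mem_cuspFn p hx'
  have hU : opU p x = heckeT w p x - (p : ℂ) ^ (w - 1) • opV p x := by
    rw [heckeT_apply, add_sub_cancel_right]
  have hTφ : pet w (heckeT w p x) φ = conj a * pet w x φ := by
    rw [pet_heckeT_comm hp.out H.not_dvd hx H.eigen.mem, H.eigen.hecke p hp.out H.not_dvd,
      pet_smul_right hx' hφ']
  have hsp : ∀ y ∈ cuspFn w, pet w y (stabilisation p β φ) =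
      pet w y φ - conj β * pet w y (opV p φ) := fun y hy => by
    rw [stabilisation, pet_sub_right hy hφ' (Submodule.smul_mem _ _ hV'), pet_smul_right hy hV']
  have hxV : pet w x (opV p φ) = e * pet w x φ := pet_opV_right_of_eigen H.eigen H.not_dvd hx
  rw [ordFunctional, hsp _ hx', hsp _ (opU_mem_cuspFn p hx'), hU,
    pet_sub_left hT' (Submodule.smul_mem _ _ hVx) hφ', pet_sub_left hT' (Submodule.smul_mem _ _ hVx) hV',
    pet_smul_left hVx hφ', pet_smul_left hVx hV', pet_opV_opV p hx' hφ',
    ← pet_opV_comm hp.out H.not_dvd hx H.eigen.mem, hTφ,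
    pet_opV_right_of_eigen H.eigen H.not_dvd hT, hTφ, hxV]
  ring

lemma IsNormalisedEigenform.pet_ne_zero (hφ : IsNormalisedEigenform N w φ) : pet w φ φ ≠ 0 :=
  fun h => by
    have := hφ.coeff_one
    rw [pet_self_eq_zero (cuspSpace_le_cuspFn hφ.mem) h, fourierCoeff_zero_fn] at this
    exact zero_ne_one this

lemma pet_stabilisation_ne_zero (hφ : IsNormalisedEigenform N w φ) :
    pet w (stabilisation p β φ) (stabilisation p β φ) ≠ 0 := fun h => by
  have hs := stabilisation_mem_isotypic (p := p) (β := β) hφ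
  have h1 : fourierCoeff (stabilisation p β φ) 1 = 1 := by
    rw [stabilisation, hφ.qfn.coeff_sub ((hφ.qfn.opV p).smul β), (hφ.qfn.opV p).coeff_smul,
      hφ.qfn.coeff_V, if_neg (fun h => hp.out.one_lt.ne' (Nat.dvd_one.mp h)), hφ.coeff_one]
    simp
  rw [pet_self_eq_zero (cuspSpace_le_cuspFn hs.1) h, fourierCoeff_zero_fn] at h1
  exact zero_ne_one h1

/-- `⟨φ_α, φ_α⟩ = (1 - β/α) κ ⟨φ, φ⟩`. -/
lemma IsOrdinary.pet_stabilisation (H : IsOrdinary N p w ι φ α β) {κ : ℂ}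
    (hκ : ∀ x ∈ cuspSpace N w, ordFunctional w p α β (stabilisation p β φ) x = κ * pet w x φ) :
    pet w (stabilisation p β φ) (stabilisation p β φ) = (1 - β / α) * κ * pet w φ φ := by
  have hs := stabilisation_mem_isotypic (p := p) (β := β) H.eigen
  have hs' := cuspSpace_le_cuspFn hs.1
  have hφ' := cuspSpace_le_cuspFn H.eigen.mem
  have hV' := opV_mem_cuspFn p hφ'
  have h1 : ordFunctional w p α β (stabilisation p β φ) (stabilisation p β φ) =
      pet w (stabilisation p β φ) (stabilisation p β φ) := by
    rw [ordFunctional, H.opU_stabilisation, pet_smul_left hs' hs', ← sub_mul,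
      inv_mul_cancel_left₀ H.sub_ne_zero]
  rw [← h1]
  conv_lhs => rw [stabilisation]
  change ordFunctional w p α β (stabilisation p β φ) _ = _
  rw [ordFunctional_sub hφ' (Submodule.smul_mem _ _ hV') hs', ordFunctional_smul hV' hs',
    H.ordFunctional_opV H.eigen.mem, hκ φ H.eigen.mem]
  ring

/-- For k > 1 the two sides have different p-adic norms. For k = 1 equality means α = ±1 and β = pα,
so a_p(φ) = ±(p + 1); the Petersson norm of φ_α would then vanish, against definiteness. -/
lemma IsOrdinary.sq_ne {k : ℕ} (H : IsOrdinary N p (k + 1) ι φ α β) (hk : 1 ≤ k) :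
    α ^ 2 ≠ (p : ℂ) ^ (k - 1) := fun h => by
  have hk1 : k = 1 := by
    by_contra hne
    have h1 := congrArg (fun z => ‖ι z‖) h
    simp only [map_pow, map_natCast, norm_pow, H.norm_unit, norm_p_padicComplex, one_pow] at h1
    have h2 : (p : ℝ)⁻¹ < 1 := inv_lt_one_of_one_lt₀ (by exact_mod_cast hp.out.one_lt)
    have h3 := pow_lt_one₀ (by positivity) h2 (by omega : k - 1 ≠ 0)
    linarith
  subst hk1
  have hβ : β = p * α := by
    have h1 : α * β = p := by simpa using H.mul_eq
    have h2 : α ^ 2 = 1 := by simpa using h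
    linear_combination α * h1 - β * h2
  have hαc : conj α = α := by
    have h2 : α ^ 2 = 1 := by simpa using h
    rcases mul_self_eq_one_iff.mp ((sq α).symm.trans h2) with h | h <;> simp [h]
  have hp0 : (p : ℂ) ≠ 0 := NeZero.ne _
  have hp1 : (p : ℂ) + 1 ≠ 0 := by exact_mod_cast Nat.succ_ne_zero p
  -- With ⟨φ, Vφ⟩ = (α/p)⟨φ, φ⟩ and ⟨Vφ, Vφ⟩ = p⁻²⟨φ, φ⟩, the expansion of ⟨φ − pαVφ, φ − pαVφ⟩ is
  -- (1 − 2 + 1)⟨φ, φ⟩.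
  refine pet_stabilisation_ne_zero (p := p) (β := β) H.eigen ?_
  have hφ' := cuspSpace_le_cuspFn H.eigen.mem
  have hV' := opV_mem_cuspFn p hφ'
  have hβV := Submodule.smul_mem (cuspFn ((1 : ℕ) + 1)) β hV'
  have hα2 : α ^ 2 = 1 := by simpa using h
  rw [stabilisation, pet_sub_left hφ' hβV (sub_mem hφ' hβV), pet_sub_right hφ' hφ' hβV,
    pet_sub_right hβV hφ' hβV, pet_smul_left hV' hφ', pet_smul_left hV' hβV,
    pet_smul_right hφ' hV', pet_smul_right hV' hV', pet_opV_opV p hφ' hφ',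
    ← pet_opV_comm hp.out H.not_dvd H.eigen.mem H.eigen.mem,
    pet_opV_right_of_eigen H.eigen H.not_dvd H.eigen.mem, ← H.add_eq, hβ]
  simp only [map_add, map_mul, hαc, Complex.conj_natCast]
  have e1 : (p : ℂ) ^ (((1 : ℕ) : ℤ) + 1) = p ^ 2 := by norm_num
  have e2 : (p : ℂ) ^ (((1 : ℕ) : ℤ) + 1 - 1) = p := by norm_num
  have e3 : (p : ℂ) ^ (-(((1 : ℕ) : ℤ) + 1)) = ((p : ℂ) ^ 2)⁻¹ := by rw [zpow_neg, e1]
  rw [e1, e2, e3]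
  have e4 : (p : ℂ) ^ 2 + p ≠ 0 := by
    rw [show (p : ℂ) ^ 2 + p = p * (p + 1) by ring]; exact mul_ne_zero hp0 hp1
  field_simp
  ring_nf
  simp only [hα2]
  ring

/-- The first factor vanishes only if α = β. The second vanishes only if β = pα, that is α² =
p^{k−1}, since αβ = p^k. -/
lemma IsOrdinary.eulerAd_ne_zero {k : ℕ} (H : IsOrdinary N p (k + 1) ι φ α β) (hk : 1 ≤ k) :
    eulerAd p α β ≠ 0 := by
  have hp0 : (p : ℂ) ≠ 0 := NeZero.ne _
  have hα := H.unit_ne_zero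
  refine mul_ne_zero (fun h => H.sub_ne_zero ?_) fun h => H.sq_ne hk ?_
  · field_simp at h
    simpa using h
  · have h1 : α * β = p ^ k := by simpa using H.mul_eq
    field_simp at h
    have h2 : β = p * α := by linear_combination -h
    obtain ⟨j, rfl⟩ := Nat.exists_eq_add_of_le' hk
    have h3 : (p : ℂ) * α ^ 2 = p * p ^ j := by
      rw [← pow_succ', ← h1, h2]; ring
    simpa using mul_left_cancel₀ hp0 h3

end OrdFunctional

end

section

/-! ### The theta function -/

/-- The factor `cτ + d`. -/
def den (γ : SL(2, ℤ)) (τ : ℍ) : ℂ := (γ 1 0 : ℂ) * τ + γ 1 1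

lemma den_ne_zero (γ : SL(2, ℤ)) (τ : ℍ) : den γ τ ≠ 0 := by
  have h := denom_ne_zero (mapGL ℝ γ) τ
  simpa [den, denom] using h

lemma coe_SL_smul (γ : SL(2, ℤ)) (τ : ℍ) :
    ((γ • τ : ℍ) : ℂ) = ((γ 0 0 : ℂ) * τ + γ 0 1) / den γ τ := by
  rw [coe_specialLinearGroup_apply]
  simp [den]

lemma SL_det_complex (γ : SL(2, ℤ)) : (γ 0 0 : ℂ) * γ 1 1 - γ 0 1 * γ 1 0 = 1 := by
  exact_mod_cast SL_det γ

lemma SL_mul_entry (γ δ : SL(2, ℤ)) (i j : Fin 2) :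
    (γ * δ) i j = γ i 0 * δ 0 j + γ i 1 * δ 1 j := by
  simp [Matrix.mul_apply, Fin.sum_univ_two]

lemma den_mul (γ δ : SL(2, ℤ)) (τ : ℍ) : den (γ * δ) τ = den γ (δ • τ) * den δ τ := by
  have h := den_ne_zero δ τ
  rw [den, den, coe_SL_smul, SL_mul_entry, SL_mul_entry, add_mul, mul_assoc, div_mul_cancel₀ _ h]
  rw [den]
  push_cast
  ring

lemma slash_SL_apply (w : ℤ) (x : ℍ → ℂ) (γ : SL(2, ℤ)) (τ : ℍ) :
    (x ∣[w] γ) τ = x (γ • τ) * den γ τ ^ (-w) := by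
  rw [ModularForm.SL_slash_apply]
  simp [den, denom]

lemma jacobiTheta₂_add_int_mul (z τ : ℂ) (m : ℤ) : jacobiTheta₂ (z + m * τ) τ =
    Complex.exp (-Real.pi * Complex.I * (m ^ 2 * τ + 2 * m * z)) * jacobiTheta₂ z τ := by
  conv_rhs => rw [jacobiTheta₂, ← tsum_mul_left, ← (Equiv.addRight m).tsum_eq]
  refine tsum_congr (fun n ↦ ?_)
  simp_rw [jacobiTheta₂_term, ← Complex.exp_add, Equiv.coe_addRight, Int.cast_add]
  ring_nf

/-- The Jacobi transformation law of `θ(τ, z) = ∑ exp(2πi(n²τ + nz))` under `γ`, with an unspecified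
factor whose fourth power is `(cτ + d)²`. -/
def IsThetaTransform (γ : SL(2, ℤ)) : Prop := ∃ J : ℍ → ℂ, (∀ τ, J τ ^ 4 = den γ τ ^ 2) ∧
  ∀ τ z, jacobiTheta₂ (z / den γ τ) (2 * (γ • τ : ℍ)) =
    J τ * Complex.exp (2 * Real.pi * Complex.I * (γ 1 0 * z ^ 2 / (4 * den γ τ))) *
      jacobiTheta₂ z (2 * τ)

lemma IsThetaTransform.mul {γ δ : SL(2, ℤ)} (hγ : IsThetaTransform γ) (hδ : IsThetaTransform δ) :
    IsThetaTransform (γ * δ) := by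
  obtain ⟨J, hJ, h⟩ := hγ
  obtain ⟨J', hJ', h'⟩ := hδ
  refine ⟨fun τ => J (δ • τ) * J' τ, fun τ => ?_, fun τ z => ?_⟩
  · rw [mul_pow, hJ, hJ', den_mul, mul_pow]
  · have h1 := den_ne_zero γ (δ • τ)
    have h2 := den_ne_zero δ τ
    have e : (γ * δ) 1 0 * z ^ 2 / (4 * den (γ * δ) τ) =
        γ 1 0 * (z / den δ τ) ^ 2 / (4 * den γ (δ • τ)) + δ 1 0 * z ^ 2 / (4 * den δ τ) := by
      rw [den_mul]
      have h3 : den γ (δ • τ) * den δ τ = den (γ * δ) τ := (den_mul _ _ _).symm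
      have h4 : ((γ * δ) 1 0 : ℂ) * den δ τ = γ 1 0 + δ 1 0 * (den γ (δ • τ) * den δ τ) := by
        rw [h3, den, den, SL_mul_entry, SL_mul_entry]
        push_cast
        linear_combination (γ 1 0 : ℂ) * SL_det_complex δ
      field_simp
      linear_combination z ^ 2 * h4
    rw [mul_smul, e, mul_add, Complex.exp_add, den_mul, mul_comm (den γ _), ← div_div, h, h']
    ring

lemma den_inv_mul (γ : SL(2, ℤ)) (τ : ℍ) : den γ (γ⁻¹ • τ) * den γ⁻¹ τ = 1 := by
  rw [← den_mul, mul_inv_cancel, den]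
  simp

lemma IsThetaTransform.inv {γ : SL(2, ℤ)} (hγ : IsThetaTransform γ) : IsThetaTransform γ⁻¹ := by
  obtain ⟨J, hJ, h⟩ := hγ
  have hJ0 : ∀ τ, J τ ≠ 0 := fun τ h0 => by
    have := hJ τ
    rw [h0, zero_pow four_ne_zero] at this
    exact pow_ne_zero 2 (den_ne_zero γ τ) this.symm
  refine ⟨fun τ => (J (γ⁻¹ • τ))⁻¹, fun τ => ?_, fun τ z => ?_⟩
  · rw [inv_pow, hJ, ← inv_pow, inv_eq_of_mul_eq_one_right (den_inv_mul γ τ)]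
  · have h1 := h (γ⁻¹ • τ) (z / den γ⁻¹ τ)
    rw [smul_inv_smul, div_div, mul_comm (den γ⁻¹ τ), den_inv_mul, div_one] at h1
    rw [h1, (SL_inv_entries γ).2.2.1]
    have e : (γ 1 0 : ℂ) * (z / den γ⁻¹ τ) ^ 2 / (4 * den γ (γ⁻¹ • τ)) =
        -(((-γ 1 0 : ℤ) : ℂ) * z ^ 2 / (4 * den γ⁻¹ τ)) := by
      rw [eq_inv_of_mul_eq_one_left (den_inv_mul γ τ)]
      have := den_ne_zero γ⁻¹ τ
      push_cast
      field_simp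
    rw [e, mul_neg, Complex.exp_neg]
    field_simp [hJ0]

/-- The matrices satisfying the transformation law of the theta function. -/
def thetaGroup : Subgroup SL(2, ℤ) where
  carrier := {γ | IsThetaTransform γ}
  mul_mem' h h' := h.mul h'
  one_mem' := ⟨fun _ => 1, fun τ => by simp [den], fun τ z => by simp [den]⟩
  inv_mem' h := h.inv

lemma neg_one_mem_thetaGroup : (-1 : SL(2, ℤ)) ∈ thetaGroup :=
  ⟨fun _ => 1, fun τ => by simp [den], fun τ z => by
    rw [ModularGroup.SL_neg_smul]
    simp [den, div_neg, jacobiTheta₂_neg_left]⟩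

lemma T_mem_thetaGroup : ModularGroup.T ∈ thetaGroup :=
  ⟨fun _ => 1, fun τ => by simp [den, ModularGroup.T], fun τ z => by
    rw [modular_T_smul, coe_vadd, Complex.ofReal_one, mul_add, add_comm, mul_one,
      jacobiTheta₂_add_right]
    simp [den, ModularGroup.T]⟩

/-- The matrix `(1, 0; 4m, 1)`. -/
def lowerUni (m : ℤ) : SL(2, ℤ) := ⟨!![1, 0; 4 * m, 1], by simp⟩

lemma lowerUni_add (m n : ℤ) : lowerUni (m + n) = lowerUni m * lowerUni n := by
  ext i j
  rw [SL_mul_entry]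
  fin_cases i <;> fin_cases j <;> simp [lowerUni, mul_add]

/-- In the variable 2τ this matrix is an inversion, a translation by −2 and another inversion. Two
applications of Jacobi's functional equation give J as a product of two square roots; fixing only J⁴
avoids the choice of branch. -/
lemma lowerUni_one_mem_thetaGroup : lowerUni 1 ∈ thetaGroup := by
  have hden : ∀ τ : ℍ, den (lowerUni 1) τ = 4 * τ + 1 := fun τ => by simp [den, lowerUni]
  have hne : ∀ τ : ℍ, (4 * τ + 1 : ℂ) ≠ 0 := fun τ => hden τ ▸ den_ne_zero _ τ
  have hτ0 : ∀ τ : ℍ, (τ : ℂ) ≠ 0 := fun τ => ne_zero τ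
  refine ⟨fun τ => (-Complex.I * (2 * τ)) ^ (1 / 2 : ℂ) *
    (-Complex.I * (-1 / (2 * τ) + -2)) ^ (1 / 2 : ℂ), fun τ => ?_, fun τ z => ?_⟩
  · have h2 : ∀ u : ℂ, (u ^ (1 / 2 : ℂ)) ^ 4 = u ^ 2 := fun u => by
      rw [← Complex.cpow_nat_mul, ← Complex.cpow_natCast]
      norm_num
    rw [mul_pow, h2, h2, hden, ← mul_pow]
    have := hτ0 τ
    congr 1
    field_simp
    ring_nf
    rw [Complex.I_sq]
    ring
  · have h0 := hτ0 τ
    have h1 := hne τ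
    set σ : ℂ := -1 / (2 * τ) + -2 with hσ
    have hσe : σ = -((4 * τ + 1) / (2 * τ)) := by rw [hσ]; field_simp; ring
    have hσ0 : σ ≠ 0 := by rw [hσe]; exact neg_ne_zero.mpr (div_ne_zero h1 (by simpa using h0))
    have e1 := jacobiTheta₂_functional_equation z (2 * τ)
    have e2 : jacobiTheta₂ (z / (2 * τ)) (-1 / (2 * τ)) = jacobiTheta₂ (z / (2 * τ)) σ := by
      rw [← jacobiTheta₂_add_right _ σ, hσ]
      congr 1
      ring
    have e3 := jacobiTheta₂_functional_equation (z / (2 * τ)) σ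
    have e4 : z / (2 * τ) / σ = -(z / (4 * τ + 1)) := by
      rw [hσe, div_neg]; field_simp
    have h00 : lowerUni 1 0 0 = 1 := rfl
    have h01 : lowerUni 1 0 1 = 0 := rfl
    have h10 : lowerUni 1 1 0 = 4 := rfl
    have e5 : -1 / σ = 2 * (lowerUni 1 • τ : ℍ) := by
      rw [coe_SL_smul, hden, hσe, neg_div_neg_eq, one_div_div, h00, h01]
      push_cast
      ring
    rw [e4, e5, jacobiTheta₂_neg_left] at e3
    rw [e2, e3] at e1
    rw [e1, hden]
    have hc1 : (-Complex.I * (2 * τ)) ^ (1 / 2 : ℂ) ≠ 0 := by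
      rw [Ne, Complex.cpow_eq_zero_iff]
      simp [h0]
    have hc2 : (-Complex.I * σ) ^ (1 / 2 : ℂ) ≠ 0 := by
      rw [Ne, Complex.cpow_eq_zero_iff]
      simp [hσ0]
    have hexp : Complex.exp (2 * Real.pi * Complex.I * (lowerUni 1 1 0 * z ^ 2 / (4 * (4 * τ + 1)))) *
        (Complex.exp (-Real.pi * Complex.I * z ^ 2 / (2 * τ)) *
          Complex.exp (-Real.pi * Complex.I * (z / (2 * τ)) ^ 2 / σ)) = 1 := by
      rw [← Complex.exp_add, ← Complex.exp_add]
      refine (congrArg Complex.exp ?_).trans Complex.exp_zero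
      rw [hσe, div_neg, h10]
      push_cast
      field_simp
      ring
    change _ = (-Complex.I * (2 * τ)) ^ (1 / 2 : ℂ) * (-Complex.I * σ) ^ (1 / 2 : ℂ) * _ * _
    refine ((congrArg (· * jacobiTheta₂ _ _) hexp).trans (one_mul _)).symm.trans ?_
    generalize (-Complex.I * (2 * τ)) ^ (1 / 2 : ℂ) = c₁ at hc1 ⊢
    generalize (-Complex.I * σ) ^ (1 / 2 : ℂ) = c₂ at hc2 ⊢
    generalize Complex.exp (-Real.pi * Complex.I * z ^ 2 / (2 * τ)) = u₁
    generalize Complex.exp (-Real.pi * Complex.I * (z / (2 * τ)) ^ 2 / σ) = u₂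
    generalize jacobiTheta₂ _ _ = t
    generalize Complex.exp _ = u₃
    field_simp

lemma lowerUni_mem_thetaGroup (m : ℤ) : lowerUni m ∈ thetaGroup := by
  induction m using Int.induction_on with
  | zero =>
    have : lowerUni 0 = 1 := by
      ext i j
      fin_cases i <;> fin_cases j <;> simp [lowerUni]
    rw [this]
    exact one_mem _
  | succ m ih =>
    rw [lowerUni_add]
    exact mul_mem ih lowerUni_one_mem_thetaGroup
  | pred m ih =>
    refine (mul_mem_cancel_right lowerUni_one_mem_thetaGroup).mp ?_
    rwa [← lowerUni_add, sub_add_cancel]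

/-! ### Generators of Γ₀(4) -/

lemma exists_two_mul_abs_le (d : ℤ) {c : ℤ} (hc : c ≠ 0) : ∃ n : ℤ, 2 * |d + n * c| ≤ |c| := by
  have h1 := Int.emod_add_mul_ediv d c
  have h2 := Int.emod_nonneg d hc
  have h3 := Int.emod_lt_abs d hc
  rcases le_or_gt (2 * (d % c)) |c| with h | h
  · refine ⟨-(d / c), ?_⟩
    rw [show d + -(d / c) * c = d % c by linarith, abs_of_nonneg h2]
    exact h
  · rcases abs_cases c with ⟨hc', -⟩ | ⟨hc', -⟩
    · refine ⟨-(d / c) - 1, ?_⟩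
      rw [show d + (-(d / c) - 1) * c = d % c - |c| by rw [hc']; linarith,
        abs_of_nonpos (by linarith)]
      linarith
    · refine ⟨-(d / c) + 1, ?_⟩
      rw [show d + (-(d / c) + 1) * c = d % c - |c| by rw [hc']; linarith,
        abs_of_nonpos (by linarith)]
      linarith

lemma SL_T_zpow_entry (γ : SL(2, ℤ)) (n : ℤ) (i : Fin 2) :
    (γ * ModularGroup.T ^ n) i 0 = γ i 0 ∧ (γ * ModularGroup.T ^ n) i 1 = γ i 1 + n * γ i 0 := by
  rw [SL_mul_entry, SL_mul_entry, ModularGroup.coe_T_zpow]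
  simp [mul_comm, add_comm]

/-- `Γ₀(4)` is generated by `-1`, `(1, 1; 0, 1)` and `(1, 0; 4, 1)`. -/
theorem Gamma0_four_le_thetaGroup : Gamma0 4 ≤ thetaGroup := by
  intro γ hγ
  rw [Gamma0_mem_iff] at hγ
  induction hn : (γ 1 0).natAbs using Nat.strong_induction_on generalizing γ with
  | _ n ih =>
    have hdet := SL_det γ
    by_cases hc : γ 1 0 = 0
    · rw [hc, mul_zero, sub_zero] at hdet
      have hTn : ∀ n : ℤ, ModularGroup.T ^ n ∈ thetaGroup := fun n => zpow_mem T_mem_thetaGroup n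
      rcases Int.mul_eq_one_iff_eq_one_or_neg_one.mp hdet with ⟨ha, hd⟩ | ⟨ha, hd⟩
      · have : γ = ModularGroup.T ^ γ 0 1 := by
          ext i j
          fin_cases i <;> fin_cases j <;> simp [ModularGroup.coe_T_zpow, ha, hd, hc]
        rw [this]
        exact hTn _
      · have : γ = -1 * ModularGroup.T ^ (-γ 0 1) := by
          ext i j
          rw [SL_mul_entry, ModularGroup.coe_T_zpow]
          fin_cases i <;> fin_cases j <;> simp [ha, hd, hc]
        rw [this]
        exact mul_mem neg_one_mem_thetaGroup (hTn _)
    -- Descent on the lower left entry c. A power of T makes 2|d| ≤ |c|, strictly because d is odd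
    -- and 4 ∣ c. A power of (1, 0; 4, 1) then reduces c modulo 4d to absolute value at most 2|d| <
    -- |c|.
    · obtain ⟨n₁, hn₁⟩ := exists_two_mul_abs_le (γ 1 1) hc
      set d := γ 1 1 + n₁ * γ 1 0 with hd
      obtain ⟨c', hc'⟩ := hγ
      have hdodd : d % 2 = 1 := by
        by_contra hne
        have h0 : d % 2 = 0 := by omega
        obtain ⟨e, he⟩ := Int.dvd_of_emod_eq_zero h0
        have h11 : γ 1 1 = 2 * (e - n₁ * (2 * c')) := by
          rw [hc'] at hd
          push_cast at hd
          linarith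
        rw [h11, hc'] at hdet
        push_cast at hdet
        have : (2 : ℤ) ∣ 1 := ⟨γ 0 0 * (e - n₁ * (2 * c')) - γ 0 1 * (2 * c'), by linarith⟩
        omega
      have hd0 : 4 * d ≠ 0 := by omega
      have hlt : 2 * |d| < |γ 1 0| := by
        refine lt_of_le_of_ne hn₁ fun he => ?_
        rcases abs_cases d with ⟨h1, -⟩ | ⟨h1, -⟩ <;> rcases abs_cases (γ 1 0) with ⟨h2, -⟩ | ⟨h2, -⟩ <;>
          rw [h1, h2, hc'] at he <;> omega
      obtain ⟨m, hm⟩ := exists_two_mul_abs_le (γ 1 0) hd0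
      have hprod : γ * ModularGroup.T ^ n₁ * lowerUni m ∈ thetaGroup := by
        have e10 : (γ * ModularGroup.T ^ n₁ * lowerUni m) 1 0 = γ 1 0 + m * (4 * d) := by
          rw [SL_mul_entry, (SL_T_zpow_entry γ n₁ 1).1, (SL_T_zpow_entry γ n₁ 1).2, ← hd]
          simp [lowerUni]
          ring
        refine ih _ ?_ ?_ rfl
        · rw [e10, ← hn]
          rw [abs_mul, show |(4 : ℤ)| = 4 from rfl] at hm
          zify
          linarith
        · rw [e10, hc']
          exact ⟨c' + m * d, by push_cast; ring⟩
      rwa [mul_mem_cancel_right (lowerUni_mem_thetaGroup m),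
        mul_mem_cancel_right (zpow_mem T_mem_thetaGroup n₁)] at hprod

/-! ### The theta functions θ(s²τ) through averages over torsion points -/

lemma sum_exp_div (s : ℕ) [NeZero s] (d n : ℤ) (hd : IsCoprime d s) :
    ∑ b ∈ Finset.range s, Complex.exp (2 * Real.pi * Complex.I * n * (d * b / s)) =
      if (s : ℤ) ∣ n then (s : ℂ) else 0 := by
  have hs : (s : ℂ) ≠ 0 := NeZero.ne _
  set ζ := Complex.exp (2 * Real.pi * Complex.I * (n * d / s)) with hζ
  have h1 : ∀ b ∈ Finset.range s,
      Complex.exp (2 * Real.pi * Complex.I * n * (d * b / s)) = ζ ^ b := fun b _ => by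
    rw [hζ, ← Complex.exp_nat_mul]
    congr 1
    ring
  rw [Finset.sum_congr rfl h1]
  have hζs : ζ ^ s = 1 := by
    rw [hζ, ← Complex.exp_nat_mul, Complex.exp_eq_one_iff]
    exact ⟨n * d, by push_cast; field_simp⟩
  split_ifs with hd'
  · obtain ⟨m, rfl⟩ := hd'
    have : ζ = 1 := by
      rw [hζ, Complex.exp_eq_one_iff]
      exact ⟨m * d, by push_cast; field_simp⟩
    simp [this]
  · have hne : ζ ≠ 1 := fun h => by
      rw [hζ, Complex.exp_eq_one_iff] at h
      obtain ⟨m, hm⟩ := h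
      have hpi : (2 * Real.pi * Complex.I : ℂ) ≠ 0 := Complex.two_pi_I_ne_zero
      rw [mul_comm (m : ℂ)] at hm
      have h2 := mul_left_cancel₀ hpi hm
      rw [div_eq_iff hs] at h2
      have h3 : n * d = m * s := by exact_mod_cast h2
      exact hd' (hd.symm.dvd_of_dvd_mul_right ⟨m, by rw [h3, mul_comm]⟩)
    have := mul_neg_geom_sum ζ s
    rw [hζs, sub_self] at this
    exact (mul_eq_zero.mp this).resolve_left (sub_ne_zero.mpr hne.symm)

lemma two_mul_im_pos (τ : ℍ) : 0 < (2 * (τ : ℂ)).im := by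
  simpa using τ.im_pos

lemma theta_eq (τ : ℍ) : theta τ = jacobiTheta₂ 0 (2 * τ) := by
  rw [theta, jacobiTheta_eq_jacobiTheta₂]

lemma hasSum_theta (s : ℕ) [NeZero s] (τ : ℍ) :
    HasSum (fun n : ℤ => Complex.exp (2 * Real.pi * Complex.I * (s * n ^ 2) * τ)) (opV s theta τ) := by
  have h := hasSum_jacobiTheta₂_term 0 (two_mul_im_pos (diagR s 1 • τ))
  rw [← theta_eq, ← opV_apply (x := theta)] at h
  convert h using 2 with n
  rw [jacobiTheta₂_term, coe_diagR_smul]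
  congr 1
  push_cast
  ring

/-- Averaging over torsion points: `∑_b θ(τ, db/s) = s θ(s²τ)`. -/
lemma sum_jacobiTheta₂_torsion (s : ℕ) [NeZero s] (d : ℤ) (hd : IsCoprime d s) (τ : ℍ) :
    ∑ b ∈ Finset.range s, jacobiTheta₂ (d * b / s) (2 * τ) = s * opV (s ^ 2) theta τ := by
  have h1 := hasSum_sum (s := Finset.range s) fun b _ =>
    hasSum_jacobiTheta₂_term (d * b / s : ℂ) (two_mul_im_pos τ)
  have h2 := (hasSum_theta (s ^ 2) τ).mul_left (s : ℂ)
  have hinj : Function.Injective fun n : ℤ => (s : ℤ) * n :=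
    mul_right_injective₀ (by exact_mod_cast NeZero.ne s)
  refine h1.unique ((hinj.hasSum_iff fun n hn => ?_).mp ?_)
  · have hn' : ¬ (s : ℤ) ∣ n := fun ⟨m, hm⟩ => hn ⟨m, hm.symm⟩
    have := sum_exp_div s d n hd
    rw [if_neg hn'] at this
    simp only [jacobiTheta₂_term, Complex.exp_add, ← Finset.sum_mul]
    rw [this, zero_mul]
  · refine (congrArg (HasSum · _) (funext fun n => ?_)).mp h2
    have := sum_exp_div s d (s * n) hd
    rw [if_pos (Dvd.intro _ rfl)] at this
    simp only [Function.comp_apply, jacobiTheta₂_term, Complex.exp_add, ← Finset.sum_mul]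
    rw [this]
    congr 2
    push_cast
    ring

/-- `θ(τ)` and `θ(s²τ)` have the same automorphy factor on `Γ₀(4s²)`. -/
theorem theta_transform (s : ℕ) [NeZero s] {γ : SL(2, ℤ)} (hγ : γ ∈ Gamma0 (4 * s ^ 2)) :
    ∃ J : ℍ → ℂ, (∀ τ, J τ ^ 4 = den γ τ ^ 2) ∧ (∀ τ, theta (γ • τ) = J τ * theta τ) ∧
      ∀ τ, opV (s ^ 2) theta (γ • τ) = J τ * opV (s ^ 2) theta τ := by
  rw [Gamma0_mem_iff] at hγ
  obtain ⟨c, hc⟩ := hγ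
  obtain ⟨J, hJ, h⟩ : IsThetaTransform γ := Gamma0_four_le_thetaGroup
    (Gamma0_mem_iff.mpr ⟨s ^ 2 * c, by rw [hc]; push_cast; ring⟩)
  have hs : (s : ℂ) ≠ 0 := NeZero.ne _
  refine ⟨J, hJ, fun τ => ?_, fun τ => ?_⟩
  · have := h τ 0
    rw [zero_div] at this
    rw [theta_eq, theta_eq, this]
    simp
  · have hcop : IsCoprime (γ 1 1) (s : ℤ) := by
      refine ⟨γ 0 0, -γ 0 1 * (4 * s * c), ?_⟩
      have := SL_det γ
      rw [hc] at this
      push_cast at this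
      linear_combination this
    have h1 := sum_jacobiTheta₂_torsion s 1 isCoprime_one_left (γ • τ)
    have h2 := sum_jacobiTheta₂_torsion s _ hcop τ
    have hterm : ∀ b ∈ Finset.range s, jacobiTheta₂ (((1 : ℤ) : ℂ) * b / s) (2 * (γ • τ : ℍ)) =
        J τ * jacobiTheta₂ ((γ 1 1 : ℂ) * b / s) (2 * τ) := fun b _ => by
      have hd := den_ne_zero γ τ
      have h3 := h τ (den γ τ * b / s)
      have e1 : den γ τ * b / s / den γ τ = ((1 : ℤ) : ℂ) * b / s := by
        field_simp
        simp
      -- As γ₁₀ = 4s²c, the point (cτ+d)b/s of the Jacobi law is the torsion point γ₁₁b/s moved by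
      -- an integral multiple of 2τ.
      have e2 : den γ τ * b / s = (γ 1 1 : ℂ) * b / s + ((2 * s * c * b : ℤ) : ℂ) * (2 * τ) := by
        rw [den, hc]
        push_cast
        field_simp
        ring
      rw [e1, e2, jacobiTheta₂_add_int_mul] at h3
      rw [h3]
      -- The exponential of the Jacobi law and that of quasi-periodicity cancel: their exponents add
      -- up to an integral multiple of 2πi.
      have e3 : Complex.exp (2 * Real.pi * Complex.I * (γ 1 0 *
          ((γ 1 1 : ℂ) * b / s + ((2 * s * c * b : ℤ) : ℂ) * (2 * τ)) ^ 2 / (4 * den γ τ))) *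
          Complex.exp (-Real.pi * Complex.I * (((2 * s * c * b : ℤ) : ℂ) ^ 2 * (2 * τ) +
            2 * ((2 * s * c * b : ℤ) : ℂ) * ((γ 1 1 : ℂ) * b / s))) = 1 := by
        rw [← e2, ← Complex.exp_add, Complex.exp_eq_one_iff]
        refine ⟨-(c * b ^ 2 * γ 1 1), ?_⟩
        have : (γ 1 0 : ℂ) * (den γ τ * b / s) ^ 2 / (4 * den γ τ) = c * b ^ 2 * den γ τ := by
          rw [hc]
          push_cast
          field_simp
        rw [this, den, hc]
        push_cast
        field_simp
        ring
      rw [mul_assoc (J τ), ← mul_assoc (Complex.exp _), e3, one_mul]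
    rw [Finset.sum_congr rfl hterm, ← Finset.mul_sum, h2] at h1
    refine mul_left_cancel₀ hs ?_
    rw [← h1]
    ring

end

section

variable {w : ℤ} {x y : ℍ → ℂ}

/-! ### Kohnen plus forms times theta functions -/

lemma mdifferentiable_theta : MDifferentiable 𝓘(ℂ) 𝓘(ℂ) theta := by
  rw [UpperHalfPlane.mdifferentiable_iff]
  intro z hz
  have h : (theta ∘ ofComplex) =ᶠ[𝓝 z] fun z => jacobiTheta (2 * z) := by
    filter_upwards [isOpen_upperHalfPlaneSet.mem_nhds hz] with u hu
    rw [Function.comp_apply, theta, ofComplex_apply_of_im_pos hu]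
  refine (DifferentiableAt.congr_of_eventuallyEq ?_ h).differentiableWithinAt
  have hz' : 0 < (2 * z).im := by simpa using hz
  exact (differentiableAt_jacobiTheta hz').comp z (differentiableAt_id.const_mul 2)

lemma mdifferentiable_opV (hx : MDifferentiable 𝓘(ℂ) 𝓘(ℂ) x) (p : ℕ) [NeZero p] :
    MDifferentiable 𝓘(ℂ) 𝓘(ℂ) (opV p x) := by
  have h := smul_opV p 1 x
  rw [sub_self, zpow_zero, one_smul] at h
  rw [h]
  exact hx.slash 1 _

lemma theta_ne_zero : theta ≠ 0 := fun h => by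
  have h1 := norm_jacobiTheta_sub_one_le (two_mul_im_pos UpperHalfPlane.I)
  have h2 : jacobiTheta (2 * (UpperHalfPlane.I : ℍ)) = 0 := congrFun h UpperHalfPlane.I
  rw [h2, zero_sub, norm_neg, norm_one] at h1
  have h3 : (2 * ((UpperHalfPlane.I : ℍ) : ℂ)).im = 2 := by simp
  rw [h3] at h1
  have h4 : Real.exp (-Real.pi * 2) ≤ 1 / 7 := by
    rw [neg_mul, Real.exp_neg, one_div]
    refine inv_anti₀ (by norm_num) ?_
    have := Real.add_one_le_exp (Real.pi * 2)
    have := Real.pi_gt_three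
    linarith
  have h5 : 0 < 1 - Real.exp (-Real.pi * 2) := by linarith
  rw [div_mul_eq_mul_div, le_div_iff₀ h5] at h1
  linarith

/-- A holomorphic function that vanishes where `θ` does not is zero. -/
lemma eq_of_eq_of_theta_ne_zero (hx : MDifferentiable 𝓘(ℂ) 𝓘(ℂ) x)
    (hy : MDifferentiable 𝓘(ℂ) 𝓘(ℂ) y) (h : ∀ τ, theta τ ≠ 0 → x τ = y τ) : x = y := by
  have h1 : (x - y) * theta = 0 := by
    funext τ
    by_cases h0 : theta τ = 0
    · simp [h0]
    · simp [h τ h0]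
  exact sub_eq_zero.mp
    (((UpperHalfPlane.mul_eq_zero_iff (hx.sub hy) mdifferentiable_theta).mp h1).resolve_right
      theta_ne_zero)

/-- Poisson summation S(a) = a^{−1/2} S(1/a) controls small heights. Valid on all of ℍ, the bound
makes explicit expansions of θ at the other cusps unnecessary. -/
lemma norm_opV_theta_le : ∃ C : ℝ, 0 < C ∧ ∀ (s : ℕ) [NeZero s] (τ : ℍ),
    ‖opV s theta τ‖ ≤ C * (1 + 1 / √τ.im) := by
  have hsum : ∀ a : ℝ, 0 < a → Summable fun n : ℤ => Real.exp (-Real.pi * a * n ^ 2) := fun a ha => by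
    have h := ((summable_jacobiTheta₂_term_iff 0 (a * Complex.I)).mpr (by simpa using ha)).norm
    refine h.congr fun n => ?_
    rw [norm_jacobiTheta₂_term]
    congr 1
    simp
    ring
  set S : ℝ → ℝ := fun a => ∑' n : ℤ, Real.exp (-Real.pi * a * n ^ 2) with hS
  have hmono : ∀ a, 1 ≤ a → S a ≤ S 1 := fun a ha =>
    (hsum a (by linarith)).tsum_le_tsum (fun n => Real.exp_le_exp.mpr (by
      have : 0 ≤ Real.pi * (n : ℝ) ^ 2 := by positivity
      nlinarith)) (hsum 1 one_pos)
  have hpos : 0 < S 1 := (hsum 1 one_pos).tsum_pos (fun n => (Real.exp_pos _).le) 0 (Real.exp_pos _)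
  refine ⟨S 1, hpos, fun s _ τ => ?_⟩
  have hv := τ.im_pos
  have h1 : ‖opV s theta τ‖ ≤ S τ.im := by
    have h := hasSum_theta s τ
    have hle : ∀ n : ℤ, ‖Complex.exp (2 * Real.pi * Complex.I * (s * n ^ 2) * τ)‖ ≤
        Real.exp (-Real.pi * τ.im * n ^ 2) := fun n => by
      rw [Complex.norm_exp]
      refine Real.exp_le_exp.mpr ?_
      have e : (2 * Real.pi * Complex.I * (s * n ^ 2) * τ : ℂ) =
          ((2 * Real.pi * s * n ^ 2 : ℝ) : ℂ) * (Complex.I * τ) := by push_cast; ring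
      rw [e, Complex.re_ofReal_mul]
      have : (Complex.I * (τ : ℂ)).re = -τ.im := by simp
      rw [this]
      have hs : (1 : ℝ) ≤ s := by exact_mod_cast NeZero.one_le
      have h0 : 0 ≤ Real.pi * τ.im * (n : ℝ) ^ 2 := by positivity
      nlinarith
    rw [← h.tsum_eq]
    exact tsum_of_norm_bounded (hsum _ hv).hasSum hle
  refine h1.trans ?_
  rcases le_total 1 τ.im with h | h
  · refine (hmono _ h).trans (le_mul_of_one_le_right hpos.le ?_)
    have : 0 ≤ 1 / √τ.im := by positivity
    linarith
  · have h2 : S τ.im = 1 / √τ.im * S (1 / τ.im) := by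
      rw [hS]
      simp only
      rw [Real.tsum_exp_neg_mul_int_sq hv, Real.sqrt_eq_rpow]
      congr 2
      funext n
      congr 1
      ring
    rw [h2, mul_comm]
    refine mul_le_mul (hmono _ ?_) (by linarith) (by positivity) hpos.le
    rw [le_div_iff₀ hv]
    linarith

section PlusForms

variable {N k : ℕ} [NeZero N] {h : ℍ → ℂ}

/-- The automorphy factor is a quotient of theta values and means something only where θ does not
vanish. Identities obtained there extend to all of ℍ by holomorphy. -/
lemma IsKohnenPlusForm.transform (hh : IsKohnenPlusForm N k h) {γ : SL(2, ℤ)}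
    (hγ : γ ∈ Gamma0 (4 * N)) {J : ℍ → ℂ} (hJ : ∀ τ, theta (γ • τ) = J τ * theta τ) {τ : ℍ}
    (hτ : theta τ ≠ 0) : h (γ • τ) = J τ ^ (2 * k + 1) * h τ := by
  rw [hh.automorphy γ hγ, hJ, mul_div_cancel_right₀ _ hτ]

lemma IsKohnenPlusForm.qfn (hh : IsKohnenPlusForm N k h) : QFn h := by
  have h0 : IsZeroAtImInfty h := by
    have := hh.cuspidal 1
    simpa using this
  refine ⟨hh.holo, fun τ => ?_, h0.isBoundedAtImInfty⟩
  have hT : ModularGroup.T ∈ Gamma0 (4 * N) := by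
    simp
  obtain ⟨-, h2⟩ : (∀ τ, den ModularGroup.T τ = 1) ∧ ∀ τ, theta (ModularGroup.T • τ) = 1 * theta τ :=
    ⟨fun τ => by simp [den, ModularGroup.T], fun τ => by
      rw [one_mul, theta_eq, theta_eq, modular_T_smul, coe_vadd, Complex.ofReal_one, mul_add,
        add_comm, mul_one, jacobiTheta₂_add_right]⟩
  have key : h ∣[(0 : ℤ)] ModularGroup.T = h := by
    refine eq_of_eq_of_theta_ne_zero (hh.holo.slash 0 _) hh.holo fun τ hτ => ?_
    rw [slash_SL_apply, hh.transform hT (J := fun _ => 1) h2 hτ]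
    simp
  have := congrFun key τ
  rwa [slash_SL_apply, modular_T_smul, neg_zero, zpow_zero, mul_one] at this

lemma IsKohnenPlusForm.coeff_zero (hh : IsKohnenPlusForm N k h) : fourierCoeff h 0 = 0 :=
  fourierCoeff_zero_of_isZero hh.qfn (by simpa using hh.cuspidal 1)

lemma pow_four_eq (J d : ℂ) (hJ : J ^ 4 = d ^ 2) (m : ℕ) : J ^ (4 * m) = d ^ (2 * m) := by
  rw [pow_mul, pow_mul, hJ]

/-- The fourth power has integral weight and the factor J⁴ = (cτ+d)² is unambiguous. It transfers
the Hecke bound for integral weight to h. -/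
lemma IsKohnenPlusForm.pow_four_mem (hh : IsKohnenPlusForm N k h) :
    (fun τ => h τ ^ 4) ∈ cuspSpace (4 * N) (4 * k + 2) := by
  have hol : MDifferentiable 𝓘(ℂ) 𝓘(ℂ) fun τ => h τ ^ 4 := hh.holo.pow 4
  have hinv : ∀ γ ∈ Gamma0 (4 * N), (fun τ => h τ ^ 4) ∣[(4 * k + 2 : ℤ)] γ = fun τ => h τ ^ 4 :=
    fun γ hγ => by
    obtain ⟨J, hJ, hJθ, -⟩ := theta_transform 1 (γ := γ) (by
      rw [Gamma0_mem_iff] at hγ ⊢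
      exact (Dvd.intro (N : ℤ) (by push_cast; ring)).trans hγ)
    refine eq_of_eq_of_theta_ne_zero (hol.slash _ _) hol fun τ hτ => ?_
    rw [slash_SL_apply, hh.transform hγ hJθ hτ, mul_pow, ← pow_mul, mul_comm (2 * k + 1) 4,
      pow_four_eq _ _ (hJ τ), zpow_neg, show (4 * k + 2 : ℤ) = ((2 * (2 * k + 1) : ℕ) : ℤ) by
        push_cast; ring, zpow_natCast]
    have := den_ne_zero γ τ
    field_simp
  refine mem_cuspSpace_iff.mpr ⟨⟨hol, ⟨4 * N, NeZero.ne _, fun γ hγ =>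
    hinv γ (Gamma_le_Gamma0 _ hγ)⟩, fun γ => ?_⟩, hinv⟩
  have hc := hh.cuspidal γ
  have h4 : IsZeroAtImInfty fun τ : ℍ =>
      (((‖den γ τ‖ ^ (-((k : ℝ) + 1 / 2)) : ℝ) : ℂ) * h (γ • τ)) ^ 4 := by
    have := Filter.Tendsto.pow hc 4
    rwa [zero_pow four_ne_zero] at this
  suffices hs : Tendsto (fun τ => ‖((fun τ => h τ ^ 4) ∣[(4 * k + 2 : ℤ)] γ) τ‖) atImInfty (𝓝 0) from
    tendsto_zero_iff_norm_tendsto_zero.mpr hs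
  refine (tendsto_zero_iff_norm_tendsto_zero.mp h4).congr fun τ => ?_
  have hd : 0 < ‖den γ τ‖ := norm_pos_iff.mpr (den_ne_zero γ τ)
  rw [slash_SL_apply, mul_pow, norm_mul, norm_mul, mul_comm, norm_zpow, ← Complex.ofReal_pow,
    Complex.norm_real, Real.norm_of_nonneg (by positivity), ← Real.rpow_natCast, ← Real.rpow_mul hd.le,
    ← Real.rpow_intCast]
  congr 2
  push_cast
  ring

/-- The coefficients of a plus form grow polynomially. -/
lemma IsKohnenPlusForm.exists_coeff_le (hh : IsKohnenPlusForm N k h) :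
    ∃ C : ℝ, 0 ≤ C ∧ ∀ n : ℕ, ‖fourierCoeff h n‖ ≤ C * (n : ℝ) ^ (k + 1) := by
  obtain ⟨X, hX⟩ := hh.pow_four_mem
  obtain ⟨C, hC⟩ := CuspFormClass.exists_bound X
  have hC0 : 0 ≤ C := by
    by_contra hneg
    have h1 := (norm_nonneg _).trans (hC UpperHalfPlane.I)
    rw [UpperHalfPlane.I_im, Real.one_rpow, div_one] at h1
    exact hneg h1
  refine ⟨(C + 1) * Real.exp (2 * Real.pi), by positivity, fun n => ?_⟩
  rcases Nat.eq_zero_or_pos n with rfl | hn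
  · rw [hh.coeff_zero, norm_zero]
    positivity
  have hn1 : (1 : ℝ) ≤ n := by exact_mod_cast hn
  -- The bound |h|⁴ ≤ C v^{−(2k+1)} at v = 1/n, weakened to fourth powers: C ≤ (C + 1)⁴ and 2k + 1 ≤
  -- 4(k + 1).
  have hbd : ∀ τ : ℍ, τ.im = 1 / n → ‖h τ‖ ≤ (C + 1) * (n : ℝ) ^ (k + 1) := fun τ hτ => by
    have h1 := hC τ
    rw [hX, norm_pow, hτ] at h1
    have h2 : C / (1 / (n : ℝ)) ^ (((4 * k + 2 : ℤ) : ℝ) / 2) = C * (n : ℝ) ^ (2 * k + 1) := by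
      rw [show (((4 * k + 2 : ℤ) : ℝ) / 2) = ((2 * k + 1 : ℕ) : ℝ) by push_cast; ring,
        Real.rpow_natCast, div_pow, one_pow]
      field_simp
    rw [h2] at h1
    refine le_of_pow_le_pow_left₀ four_ne_zero (by positivity) (h1.trans ?_)
    rw [mul_pow, ← pow_mul]
    refine mul_le_mul ?_ (pow_le_pow_right₀ hn1 (by omega)) (by positivity) (by positivity)
    have : C + 1 ≤ (C + 1) ^ 4 := le_self_pow₀ (by linarith) four_ne_zero
    linarith
  refine (hh.qfn.norm_coeff_le (by positivity) hbd n).trans (le_of_eq ?_)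
  rw [show 2 * Real.pi * n * (1 / n) = 2 * Real.pi by field_simp]
  ring

/-- `h(τ) θ(s²τ)`. -/
def thetaProd (s : ℕ) (h : ℍ → ℂ) : ℍ → ℂ := fun τ => h τ * opV (s ^ 2) theta τ

lemma IsKohnenPlusForm.thetaProd_holo (hh : IsKohnenPlusForm N k h) (s : ℕ) [NeZero s] :
    MDifferentiable 𝓘(ℂ) 𝓘(ℂ) (thetaProd s h) :=
  hh.holo.mul (mdifferentiable_opV mdifferentiable_theta _)

/-- The factor is J^{2k+1}·J. For k odd the exponent 2k + 2 is divisible by 4, so J⁴ = (cτ+d)² turns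
it into (cτ+d)^{k+1} with no character. -/
lemma IsKohnenPlusForm.thetaProd_slash (hh : IsKohnenPlusForm N k h) (hk : Odd k) (s : ℕ)
    [NeZero s] {γ : SL(2, ℤ)} (hγ : γ ∈ Gamma0 (4 * (N * s ^ 2))) :
    thetaProd s h ∣[(k + 1 : ℤ)] γ = thetaProd s h := by
  rw [Gamma0_mem_iff] at hγ
  obtain ⟨J, hJ, hJθ, hJs⟩ := theta_transform s (γ := γ) (Gamma0_mem_iff.mpr
    ((Dvd.intro (N : ℤ) (by push_cast; ring)).trans hγ))
  have hγN : γ ∈ Gamma0 (4 * N) := Gamma0_mem_iff.mpr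
    ((Dvd.intro ((s : ℤ) ^ 2) (by push_cast; ring)).trans hγ)
  refine eq_of_eq_of_theta_ne_zero ((hh.thetaProd_holo s).slash _ _) (hh.thetaProd_holo s)
    fun τ hτ => ?_
  obtain ⟨m, hm⟩ := hk
  rw [slash_SL_apply, thetaProd, hh.transform hγN hJθ hτ, hJs, thetaProd]
  have e : J τ ^ (2 * k + 1) * J τ = den γ τ ^ (k + 1) := by
    rw [← pow_succ, show 2 * k + 1 + 1 = 4 * (m + 1) by omega, pow_four_eq _ _ (hJ τ)]
    congr 1
    omega
  rw [zpow_neg, show ((k : ℤ) + 1) = ((k + 1 : ℕ) : ℤ) by push_cast; ring, zpow_natCast, ← e]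
  have := den_ne_zero γ τ
  have hJ0 : J τ ≠ 0 := fun h0 => by
    rw [h0, mul_zero] at e
    exact pow_ne_zero _ this e.symm
  field_simp

lemma one_le_norm_den (γ : SL(2, ℤ)) {τ : ℍ} (hτ : 1 ≤ τ.im) : 1 ≤ ‖den γ τ‖ := by
  by_cases hc : γ 1 0 = 0
  · have hd := SL_det γ
    rw [hc, mul_zero, sub_zero] at hd
    have h1 : γ 1 1 = 1 ∨ γ 1 1 = -1 := by
      rcases Int.mul_eq_one_iff_eq_one_or_neg_one.mp hd with h | h
      · exact Or.inl h.2
      · exact Or.inr h.2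
    rcases h1 with h | h <;> simp [den, hc, h]
  · refine le_trans ?_ (Complex.abs_im_le_norm _)
    have : (den γ τ).im = γ 1 0 * τ.im := by simp [den]
    rw [this, abs_mul, abs_of_pos τ.im_pos]
    have h1 : (1 : ℝ) ≤ |(γ 1 0 : ℝ)| := by
      exact_mod_cast Int.one_le_abs hc
    nlinarith

lemma im_SL_smul (γ : SL(2, ℤ)) (τ : ℍ) : (γ • τ).im = τ.im / ‖den γ τ‖ ^ 2 := by
  rw [ModularGroup.im_smul_eq_div_normSq, Complex.normSq_eq_norm_sq]
  simp [den, denom]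

lemma isZeroAtImInfty_of_periodic {M : ℕ} (hM : 0 < M) (hper : ∀ (n : ℤ) τ, x (((M * n : ℤ) : ℝ) +ᵥ τ) = x τ)
    (h : ∀ ε : ℝ, 0 < ε → ∃ A : ℝ, ∀ τ : ℍ, A ≤ τ.im → |τ.re| ≤ M → ‖x τ‖ ≤ ε) :
    IsZeroAtImInfty x := by
  rw [UpperHalfPlane.isZeroAtImInfty_iff]
  intro ε hε
  obtain ⟨A, hA⟩ := h ε hε
  refine ⟨A, fun τ hτ => ?_⟩
  have hM' : (0 : ℝ) < M := by exact_mod_cast hM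
  rw [← hper (-⌊τ.re / M⌋) τ]
  refine hA _ (by rwa [vadd_im]) ?_
  rw [vadd_re, abs_le]
  have h1 := Int.floor_le (τ.re / M)
  have h2 := Int.lt_floor_add_one (τ.re / M)
  rw [le_div_iff₀ hM'] at h1
  rw [div_lt_iff₀ hM'] at h2
  push_cast
  constructor <;> nlinarith

/-- At each cusp h, with its weight factor |cτ+d|^{−(k+1/2)}, tends to 0, while
|cτ+d|^{−1/2}|θ(s²γτ)| stays bounded. Periodicity confines Re τ to a bounded range. -/
lemma IsKohnenPlusForm.thetaProd_mem_cuspSpace (hh : IsKohnenPlusForm N k h) (hk : Odd k) (s : ℕ)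
    [NeZero s] : thetaProd s h ∈ cuspSpace (4 * (N * s ^ 2)) (k + 1) := by
  set M := 4 * (N * s ^ 2)
  refine mem_cuspSpace_iff.mpr ⟨⟨hh.thetaProd_holo s, ⟨M, NeZero.ne _, fun γ hγ =>
    hh.thetaProd_slash hk s (Gamma_le_Gamma0 _ hγ)⟩, fun γ => ?_⟩,
    fun γ hγ => hh.thetaProd_slash hk s hγ⟩
  have hMp : 0 < M := Nat.pos_of_ne_zero (NeZero.ne _)
  refine isZeroAtImInfty_of_periodic hMp (fun n τ => ?_) fun ε hε => ?_
  · have hT : ModularGroup.T ^ ((M : ℤ) * n) ∈ Gamma M := by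
      rw [Gamma_mem, ModularGroup.coe_T_zpow]
      simp
    have h1 : γ * ModularGroup.T ^ ((M : ℤ) * n) * γ⁻¹ ∈ Gamma M := (Gamma_normal M).conj_mem _ hT γ
    have h2 := hh.thetaProd_slash hk s (Gamma_le_Gamma0 _ h1)
    have h3 : (thetaProd s h ∣[(k + 1 : ℤ)] γ) ∣[(k + 1 : ℤ)] (ModularGroup.T ^ ((M : ℤ) * n) : SL(2, ℤ)) =
        thetaProd s h ∣[(k + 1 : ℤ)] γ := by
      conv_rhs => rw [← h2]
      rw [← SlashAction.slash_mul, ← SlashAction.slash_mul, inv_mul_cancel_right]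
    rw [← slash_T_pow (w := k + 1) (x := thetaProd s h ∣[(k + 1 : ℤ)] γ), h3]
  · obtain ⟨C, hC, hbd⟩ := norm_opV_theta_le
    set K : ℝ := |(γ 1 0 : ℝ)| * (M + 1) + |(γ 1 1 : ℝ)| with hK
    have hK0 : 0 ≤ K := by positivity
    obtain ⟨A, hA⟩ := (UpperHalfPlane.isZeroAtImInfty_iff.mp (hh.cuspidal γ)) (ε / (C * (1 + √K)))
      (by positivity)
    refine ⟨max A 1, fun τ hτ hre => ?_⟩
    have hτ1 : 1 ≤ τ.im := (le_max_right _ _).trans hτ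
    have h1 := hA τ ((le_max_left _ _).trans hτ)
    have hD := one_le_norm_den γ hτ1
    set D := ‖den γ τ‖ with hDdef
    have hDpos : 0 < D := by linarith
    have hDK : D ≤ K * τ.im := by
      refine (norm_add_le _ _).trans ?_
      rw [norm_mul, hK, Complex.norm_intCast, Complex.norm_intCast, add_mul, mul_assoc]
      refine add_le_add (mul_le_mul_of_nonneg_left ?_ (abs_nonneg _))
        (le_mul_of_one_le_right (abs_nonneg _) hτ1)
      refine (Complex.norm_le_abs_re_add_abs_im _).trans ?_
      have : |(τ : ℂ).im| = τ.im := abs_of_pos τ.im_pos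
      rw [this]
      change |τ.re| + τ.im ≤ _
      nlinarith
    rw [slash_SL_apply, thetaProd, norm_mul, norm_mul, norm_zpow, ← hDdef]
    change ‖(((D ^ (-((k : ℝ) + 1 / 2)) : ℝ) : ℂ)) * h (γ • τ)‖ ≤ _ at h1
    rw [norm_mul, Complex.norm_real, Real.norm_of_nonneg (by positivity)] at h1
    have h2 := hbd (s ^ 2) (γ • τ)
    have h3 : D ^ (-(k + 1 : ℤ)) = D ^ (-((k : ℝ) + 1 / 2)) * (1 / √D) := by
      rw [Real.sqrt_eq_rpow, one_div (D ^ _), ← Real.rpow_neg hDpos.le, ← Real.rpow_add hDpos,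
        ← Real.rpow_intCast]
      congr 1
      push_cast
      ring
    -- Since Im γτ = v/D², the second term equals √(D/v), and D ≤ Kv on the strip.
    have h4 : 1 / √D * (1 + 1 / √(γ • τ).im) ≤ 1 + √K := by
      rw [im_SL_smul, ← hDdef, Real.sqrt_div τ.im_pos.le, Real.sqrt_sq hDpos.le, mul_add, mul_one,
        one_div_div]
      refine add_le_add ?_ ?_
      · rw [div_le_one (Real.sqrt_pos.mpr hDpos)]
        exact Real.one_le_sqrt.mpr hD
      · have : 1 / √D * (D / √τ.im) = √D / √τ.im := by
          have hs : √D * √D = D := Real.mul_self_sqrt hDpos.le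
          have := Real.sqrt_pos.mpr hDpos
          have := Real.sqrt_pos.mpr τ.im_pos
          field_simp
          linarith
        rw [this, div_le_iff₀ (Real.sqrt_pos.mpr τ.im_pos), ← Real.sqrt_mul hK0]
        exact Real.sqrt_le_sqrt hDK
    calc ‖h (γ • τ)‖ * ‖opV (s ^ 2) theta (γ • τ)‖ * D ^ (-(k + 1 : ℤ))
        = (D ^ (-((k : ℝ) + 1 / 2)) * ‖h (γ • τ)‖) *
            (1 / √D * ‖opV (s ^ 2) theta (γ • τ)‖) := by rw [h3]; ring
      _ ≤ ε / (C * (1 + √K)) * (C * (1 + √K)) := by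
          refine mul_le_mul h1 ?_ (by positivity) (by positivity)
          calc 1 / √D * ‖opV (s ^ 2) theta (γ • τ)‖
              ≤ 1 / √D * (C * (1 + 1 / √(γ • τ).im)) :=
                mul_le_mul_of_nonneg_left h2 (by positivity)
            _ = C * (1 / √D * (1 + 1 / √(γ • τ).im)) := by ring
            _ ≤ _ := mul_le_mul_of_nonneg_left h4 hC.le
      _ = ε := div_mul_cancel₀ _ (by positivity)

end PlusForms

end

/-! ### Coefficients of the theta products and the relation between G and G_α -/

section

variable {w : ℤ} {x y : ℍ → ℂ}

/-- `∑_r c(n - s²r²)`. -/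
def convTheta (s : ℕ) (c : ℕ → ℂ) (n : ℕ) : ℂ := ∑' r : ℤ, c ((n : ℤ) - s ^ 2 * r ^ 2).toNat

/-- Negative arguments are truncated to 0, where c vanishes. This convention makes the sums over all
integers r finite. -/
lemma finite_support_conv {s : ℕ} [NeZero s] {c : ℕ → ℂ} (hc : c 0 = 0) (n : ℤ) :
    (Function.support fun r : ℤ => c (n - s ^ 2 * r ^ 2).toNat).Finite := by
  refine (Set.finite_Icc (-n) n).subset fun r hr => ?_
  have hs : (1 : ℤ) ≤ s ^ 2 := by exact_mod_cast NeZero.one_le (n := s ^ 2)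
  have h0 : 0 < n - s ^ 2 * r ^ 2 := by
    by_contra hle
    refine hr ?_
    simp only
    rw [Int.toNat_of_nonpos (not_lt.mp hle), hc]
  have h1 : |r| ≤ r ^ 2 := by
    rw [← sq_abs]
    exact_mod_cast Int.le_self_sq |r|
  have h2 : |r| ≤ n := by nlinarith [sq_nonneg r]
  exact abs_le.mp h2

lemma summable_conv {s : ℕ} [NeZero s] {c : ℕ → ℂ} (hc : c 0 = 0) (n : ℤ) :
    Summable fun r : ℤ => c (n - s ^ 2 * r ^ 2).toNat :=
  summable_of_hasFiniteSupport (finite_support_conv hc n)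

lemma hasSum_theta_pow (s : ℕ) [NeZero s] (τ : ℍ) :
    HasSum (fun r : ℤ => 𝕢 1 τ ^ (s * r.natAbs) ^ 2) (opV (s ^ 2) theta τ) := by
  refine (congrArg (HasSum · _) (funext fun r => ?_)).mp (hasSum_theta (s ^ 2) τ)
  rw [Function.Periodic.qParam, ← Complex.exp_nat_mul]
  congr 1
  have : ((r.natAbs : ℂ)) ^ 2 = r ^ 2 := by
    rw [Nat.cast_natAbs, ← Int.cast_pow, sq_abs, Int.cast_pow]
  push_cast
  rw [mul_pow, this]
  ring

/-- The product of the two series, reindexed by (r, n) ↦ (r, n + s²r²). Indices outside the image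
contribute c(0) = 0. -/
lemma hasSum_convTheta {c : ℕ → ℂ} (hc : c 0 = 0) (s : ℕ) [NeZero s] {q a t : ℂ} {e : ℤ → ℕ}
    (he : ∀ r, (e r : ℤ) = s ^ 2 * r ^ 2) (h1 : HasSum (fun n => c n * q ^ n) a)
    (h2 : HasSum (fun r : ℤ => q ^ e r) t) :
    HasSum (fun n => convTheta s c n * q ^ n) (t * a) := by
  have hs := summable_mul_of_summable_norm (f := fun r : ℤ => q ^ e r)
    (g := fun n : ℕ => c n * q ^ n) (summable_norm_iff.mpr h2.summable)
    (summable_norm_iff.mpr h1.summable)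
  have h3 := h2.mul h1 hs
  have hi : Function.Injective fun x : ℤ × ℕ => (x.1, x.2 + e x.1) := by
    rintro ⟨r, n⟩ ⟨r', n'⟩ h
    rw [Prod.mk.injEq] at h
    obtain ⟨rfl, h⟩ := h
    exact congrArg (Prod.mk r) (Nat.add_right_cancel h)
  have h4 : HasSum (fun x : ℤ × ℕ => c ((x.2 : ℤ) - s ^ 2 * x.1 ^ 2).toNat * q ^ x.2) (t * a) := by
    refine (hi.hasSum_iff fun x hx => ?_).mp ?_
    · have hlt : (x.2 : ℤ) < s ^ 2 * x.1 ^ 2 := by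
        by_contra hle
        rw [not_lt, ← he, Nat.cast_le] at hle
        exact hx ⟨(x.1, x.2 - e x.1), Prod.ext rfl (Nat.sub_add_cancel hle)⟩
      rw [Int.toNat_of_nonpos (by linarith), hc, zero_mul]
    · refine (congrArg (HasSum · _) (funext fun x => ?_)).mp h3
      have e' : (((x.2 + e x.1 : ℕ) : ℤ) - s ^ 2 * x.1 ^ 2).toNat = x.2 := by
        rw [← he, Nat.cast_add, add_sub_cancel_right, Int.toNat_natCast]
      simp only [Function.comp_apply]
      rw [e', pow_add]
      ring
  have h5 : HasSum (fun x : ℕ × ℤ => c ((x.1 : ℤ) - s ^ 2 * x.2 ^ 2).toNat * q ^ x.1) (t * a) := by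
    rw [← (Equiv.prodComm ℕ ℤ).hasSum_iff] at h4
    exact h4
  refine HasSum.prod_fiberwise h5 fun n => ?_
  have h6 : HasSum (fun r : ℤ => c ((n : ℤ) - s ^ 2 * r ^ 2).toNat) (convTheta s c n) := by
    rw [convTheta]
    exact (summable_conv (s := s) hc (n : ℤ)).hasSum
  simpa only using h6.mul_right (q ^ n)

lemma hasQ_thetaProd {h : ℍ → ℂ} {c : ℕ → ℂ} (hh : HasQ h c) (hc : c 0 = 0) (s : ℕ) [NeZero s] :
    HasQ (thetaProd s h) (convTheta s c) := fun τ => by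
  have he : ∀ r : ℤ, (((s * r.natAbs) ^ 2 : ℕ) : ℤ) = s ^ 2 * r ^ 2 := fun r => by
    rw [Nat.cast_pow, Nat.cast_mul, mul_pow, Int.natAbs_sq]
  have h1 := hasSum_convTheta hc s he (hh τ) (hasSum_theta_pow s τ)
  rw [mul_comm] at h1
  exact h1

/-- The form `∑_n (∑_r c(4n - s²r²)) q^n` attached to a plus form `∑ c(n) q^n`. -/
def plusProd (s : ℕ) (h : ℍ → ℂ) : ℍ → ℂ := opU 2 (opU 2 (thetaProd s h))

section PlusForms

variable {N k : ℕ} [NeZero N] {h : ℍ → ℂ}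

lemma IsKohnenPlusForm.coeff_thetaProd (hh : IsKohnenPlusForm N k h) (hk : Odd k) (s : ℕ) [NeZero s] :
    fourierCoeff (thetaProd s h) = convTheta s (fourierCoeff h) :=
  (qfn_of_cuspSpace (hh.thetaProd_mem_cuspSpace hk s)).fourierCoeff_eq
    (hasQ_thetaProd hh.qfn.hasQ hh.coeff_zero s)

lemma IsKohnenPlusForm.coeff_plusProd (hh : IsKohnenPlusForm N k h) (hk : Odd k) (s : ℕ) [NeZero s]
    (n : ℕ) : fourierCoeff (plusProd s h) n = convTheta s (fourierCoeff h) (4 * n) := by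
  have hq := qfn_of_cuspSpace (hh.thetaProd_mem_cuspSpace hk s)
  rw [plusProd, (hq.opU 2).coeff_U, hq.coeff_U, hh.coeff_thetaProd hk,
    show 2 * (2 * n) = 4 * n by ring]

lemma sq_emod_four (t : ℤ) : t ^ 2 % 4 = 0 ∨ t ^ 2 % 4 = 1 := by
  have : t % 4 = 0 ∨ t % 4 = 1 ∨ t % 4 = 2 ∨ t % 4 = 3 := by omega
  rcases this with h | h | h | h <;> simp [sq, Int.mul_emod, h]

/-- For k odd the plus condition asks t² − n ≡ 0 or 1 mod 4 with t = sr. For n ≡ 2 the left side is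
2 or 3. -/
lemma IsKohnenPlusForm.conv_eq_zero (hh : IsKohnenPlusForm N k h) (hk : Odd k) (s : ℕ) {n : ℕ}
    (hn : n % 4 = 2) : convTheta s (fourierCoeff h) n = 0 := by
  rw [convTheta]
  convert! tsum_zero with r
  by_contra hne
  have h1 := hh.plus _ hne
  have hpos : 0 < (n : ℤ) - s ^ 2 * r ^ 2 := by
    by_contra hle
    rw [Int.toNat_of_nonpos (not_lt.mp hle), hh.coeff_zero] at hne
    exact hne rfl
  rw [hk.neg_one_pow, Int.toNat_of_nonneg hpos.le, ← mul_pow] at h1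
  have h2 := sq_emod_four (s * r)
  omega

/-- The first U₂ lowers the level from 4Ns² to 2Ns². Its image is supported on even exponents by the
vanishing at n ≡ 2 mod 4, so it is V₂ of the second image, and a periodic form whose V₂ has level
2Ns² has level Ns². -/
lemma IsKohnenPlusForm.plusProd_mem_cuspSpace (hh : IsKohnenPlusForm N k h) (hk : Odd k) (s : ℕ)
    [NeZero s] : plusProd s h ∈ cuspSpace (N * s ^ 2) (k + 1) := by
  have h1 := hh.thetaProd_mem_cuspSpace hk s
  have h2 : opU 2 (thetaProd s h) ∈ cuspSpace (2 * (N * s ^ 2)) (k + 1) :=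
    opU_mem_cuspSpace Nat.prime_two (Dvd.intro _ rfl)
      (by rwa [show 2 * (2 * (N * s ^ 2)) = 4 * (N * s ^ 2) by ring])
  have hq1 := qfn_of_cuspSpace h1
  have hq := qfn_of_cuspSpace h2
  have h3 : opV 2 (plusProd s h) = opU 2 (thetaProd s h) := by
    refine ((hq.opU 2).opV 2).ext hq fun n => ?_
    rw [(hq.opU 2).coeff_V, hq.coeff_U]
    split_ifs with hd
    · rw [Nat.mul_div_cancel' hd]
    · rw [hq1.coeff_U, hh.coeff_thetaProd hk, hh.conv_eq_zero hk s (by omega)]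
  exact mem_cuspSpace_of_opV Nat.prime_two (hq.opU 2) (by rw [h3]; exact h2)

variable {p : ℕ} [hp : Fact p.Prime] {f : ℍ → ℂ} {αf βf : ℂ}

/-- The form `∑_n (∑_r c_α(4n - r²)) q^n` attached to the `p`-stabilisation of a plus form. -/
def stabProd (p : ℕ) (αf βf : ℂ) (h : ℍ → ℂ) : ℍ → ℂ :=
  αf⁻¹ • (opU p (opU p (plusProd p h)) - βf • plusProd 1 h)

lemma IsKohnenPlusForm.plusProd_one_mem (hh : IsKohnenPlusForm N k h) (hk : Odd k) :
    plusProd 1 h ∈ cuspSpace N (k + 1) := by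
  simpa using hh.plusProd_mem_cuspSpace hk 1

/-- The product with θ(p²τ) has level Np². The first U_p lowers it to Np and the second preserves
that level. -/
lemma IsKohnenPlusForm.stabProd_mem (hh : IsKohnenPlusForm N k h) (hk : Odd k) :
    stabProd p αf βf h ∈ cuspSpace (N * p) (k + 1) := by
  refine Submodule.smul_mem _ _ (sub_mem ?_ (Submodule.smul_mem _ _
    (cuspSpace_mono (Dvd.intro _ rfl) (hh.plusProd_one_mem hk))))
  have hd : p ∣ N * p := Dvd.intro_left N rfl
  refine opU_mem_cuspSpace' hp.out hd (opU_mem_cuspSpace hp.out hd ?_)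
  have := hh.plusProd_mem_cuspSpace hk p
  rwa [show N * p ^ 2 = p * (N * p) by ring] at this

lemma toNat_mul_sq (p : ℕ) [NeZero p] (n : ℤ) : ((p : ℤ) ^ 2 * n).toNat = p ^ 2 * n.toNat := by
  rcases le_or_gt n 0 with h | h
  · have : (p : ℤ) ^ 2 * n ≤ 0 := mul_nonpos_of_nonneg_of_nonpos (by positivity) h
    rw [Int.toNat_of_nonpos this, Int.toNat_of_nonpos h, mul_zero]
  · have h1 : (0 : ℤ) ≤ (p : ℤ) ^ 2 * n := by positivity
    zify
    rw [Int.toNat_of_nonneg h1, Int.toNat_of_nonneg h.le]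

lemma stabCoeff_zero {c : ℕ → ℂ} (hc : c 0 = 0) : stabCoeff p αf βf c 0 = 0 := by
  simp [stabCoeff, hc]

/-- The theta function θ(p²τ) is chosen so that 4p²n − p²r² = p²(4n − r²), which produces the terms
c(p²·) of c_α. -/
lemma IsKohnenPlusForm.coeff_stabProd (hh : IsKohnenPlusForm N k h) (hk : Odd k) (n : ℕ) :
    fourierCoeff (stabProd p αf βf h) n = convTheta 1 (stabCoeff p αf βf (fourierCoeff h)) (4 * n) := by
  have hq := qfn_of_cuspSpace (hh.plusProd_mem_cuspSpace hk p)
  have hq1 := qfn_of_cuspSpace (hh.plusProd_one_mem hk)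
  have hc := hh.coeff_zero
  rw [stabProd, (((hq.opU p).opU p).sub (hq1.smul _)).coeff_smul, ((hq.opU p).opU p).coeff_sub
    (hq1.smul _), hq1.coeff_smul, (hq.opU p).coeff_U, hq.coeff_U, hh.coeff_plusProd hk,
    hh.coeff_plusProd hk]
  have h1 : ∀ r : ℤ, ((4 * (p * (p * n)) : ℕ) - (p : ℤ) ^ 2 * r ^ 2).toNat =
      p ^ 2 * ((4 * n : ℕ) - ((1 : ℕ) : ℤ) ^ 2 * r ^ 2).toNat := fun r => by
    rw [← toNat_mul_sq]
    congr 1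
    push_cast
    ring
  have hs1 := summable_conv (s := p) hc ((4 * (p * (p * n)) : ℕ) : ℤ)
  have hs2 := summable_conv (s := 1) hc ((4 * n : ℕ) : ℤ)
  rw [convTheta, convTheta, convTheta, ← tsum_mul_left, ← hs1.tsum_sub (hs2.mul_left _),
    ← tsum_mul_left]
  refine tsum_congr fun r => ?_
  rw [stabCoeff, h1]

/-- At p²n the quadratic symbol in T_{p²} is zero, so c(p⁴n) = a_p(f)c(p²n) − p^{2k−1}c(n).
Substitute a_p = α_f + β_f and p^{2k−1} = α_fβ_f. -/
lemma stabCoeff_sq_mul (hpN : ¬ p ∣ N) (hp2 : p ≠ 2) (hfh : InShimuraShintani N k f h)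
    (hsum : αf + βf = fourierCoeff f p) (hprod : αf * βf = (p : ℂ) ^ (2 * k - 1)) (n : ℕ) :
    stabCoeff p αf βf (fourierCoeff h) (p ^ 2 * n) =
      fourierCoeff h (p ^ 2 * n) - βf * fourierCoeff h n := by
  have hp0 : (p : ℂ) ≠ 0 := NeZero.ne _
  have hα : αf ≠ 0 := fun h0 => by
    rw [h0, zero_mul] at hprod
    exact pow_ne_zero _ hp0 hprod.symm
  have h1 := hfh p hp.out hp2 hpN (p ^ 2 * n)
  have h2 : jacobiSym ((-1) ^ k * ((p ^ 2 * n : ℕ) : ℤ)) p = 0 := by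
    rw [jacobiSym.eq_zero_iff_not_coprime, Int.gcd_comm]
    refine fun hc => hp.out.one_lt.ne' (Nat.dvd_one.mp (hc ▸ Int.dvd_gcd ?_ ?_))
    · exact_mod_cast dvd_rfl
    · push_cast
      exact Dvd.dvd.mul_left (Dvd.intro ((p : ℤ) * n) (by ring)) _
  rw [heckeTsqCoeff, h2, if_pos (Dvd.intro _ rfl), Nat.mul_div_cancel_left _ (pow_pos hp.out.pos 2),
    ← hsum, ← hprod] at h1
  rw [stabCoeff, inv_mul_eq_iff_eq_mul₀ hα]
  push_cast at h1
  linear_combination h1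

/-- Here −n ≡ r² mod p with p ∤ r, so the symbol is 1 (k is odd) and p² ∤ n. The relation for T_{p²}
then reads c(p²n) = (a_p(f) − p^{k−1})c(n). -/
lemma stabCoeff_of_not_dvd (hk : Odd k) (hpN : ¬ p ∣ N) (hp2 : p ≠ 2)
    (hfh : InShimuraShintani N k f h)
    (hsum : αf + βf = fourierCoeff f p) (hprod : αf * βf = (p : ℂ) ^ (2 * k - 1)) {n : ℕ} {r m : ℤ}
    (hr : ¬ (p : ℤ) ∣ r) (hn : (n : ℤ) = p ^ 2 * m - r ^ 2) :
    stabCoeff p αf βf (fourierCoeff h) n =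
      (1 - αf⁻¹ * (p : ℂ) ^ (k - 1)) * fourierCoeff h n := by
  have hp0 : (p : ℂ) ≠ 0 := NeZero.ne _
  have hα : αf ≠ 0 := fun h0 => by
    rw [h0, zero_mul] at hprod
    exact pow_ne_zero _ hp0 hprod.symm
  have h1 := hfh p hp.out hp2 hpN n
  have hpZ : Prime (p : ℤ) := Nat.prime_iff_prime_int.mp hp.out
  have h2 : jacobiSym ((-1) ^ k * (n : ℤ)) p = 1 := by
    have e : ((-1) ^ k * (n : ℤ)) % p = (r ^ 2) % p := by
      rw [hk.neg_one_pow, hn]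
      exact Int.emod_eq_emod_iff_emod_sub_eq_zero.mpr
        (Int.emod_eq_zero_of_dvd ⟨-(p * m), by ring⟩)
    rw [jacobiSym.mod_left, e, ← jacobiSym.mod_left]
    refine jacobiSym.sq_one' ?_
    rw [Int.gcd_comm]
    exact Int.isCoprime_iff_gcd_eq_one.mp ((Prime.coprime_iff_not_dvd hpZ).mpr hr)
  have h3 : ¬ p ^ 2 ∣ n := fun hd => hr (hpZ.dvd_of_dvd_pow (n := 2) (by
    have h4 : ((p ^ 2 : ℕ) : ℤ) ∣ n := Int.natCast_dvd_natCast.mpr hd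
    have h5 : (p : ℤ) ∣ n := (Dvd.intro (p : ℤ) (by push_cast; ring)).trans h4
    rw [hn] at h5
    exact (dvd_sub_right (Dvd.intro ((p : ℤ) * m) (by ring))).mp h5))
  rw [heckeTsqCoeff, h2, if_neg h3, ← hsum] at h1
  rw [stabCoeff, inv_mul_eq_iff_eq_mul₀ hα]
  have h4 : αf * ((1 - αf⁻¹ * (p : ℂ) ^ (k - 1)) * fourierCoeff h n) =
      (αf - (p : ℂ) ^ (k - 1)) * fourierCoeff h n := by
    field_simp
  rw [h4]
  push_cast at h1
  linear_combination h1

/-- `(U² - p^{k-1}) G_α = (1 - α⁻¹p^{k-1}) (U² - β) G`. -/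
theorem IsKohnenPlusForm.opU_opU_stabProd (hh : IsKohnenPlusForm N k h) (hk : Odd k)
    (hpN : ¬ p ∣ N) (hp2 : p ≠ 2) (hfh : InShimuraShintani N k f h)
    (hsum : αf + βf = fourierCoeff f p) (hprod : αf * βf = (p : ℂ) ^ (2 * k - 1)) :
    opU p (opU p (stabProd p αf βf h)) - (p : ℂ) ^ (k - 1) • stabProd p αf βf h =
      (1 - αf⁻¹ * (p : ℂ) ^ (k - 1)) •
        (opU p (opU p (plusProd 1 h)) - βf • plusProd 1 h) := by
  have hα : αf ≠ 0 := fun h0 => by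
    rw [h0, zero_mul] at hprod
    exact pow_ne_zero _ (NeZero.ne _) hprod.symm
  have hqα := qfn_of_cuspSpace (hh.stabProd_mem (p := p) (αf := αf) (βf := βf) hk)
  have hq1 := qfn_of_cuspSpace (hh.plusProd_one_mem hk)
  have hqU := (hq1.opU p).opU p
  refine (((hqα.opU p).opU p).sub (hqα.smul _)).ext ((hqU.sub (hq1.smul _)).smul _) fun m => ?_
  rw [((hqα.opU p).opU p).coeff_sub (hqα.smul _), (hqα.opU p).coeff_U, hqα.coeff_U,
    hqα.coeff_smul, (hqU.sub (hq1.smul _)).coeff_smul, hqU.coeff_sub (hq1.smul _), hq1.coeff_smul,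
    (hq1.opU p).coeff_U, hq1.coeff_U, hh.coeff_stabProd hk, hh.coeff_stabProd hk,
    hh.coeff_plusProd hk, hh.coeff_plusProd hk]
  set e := αf⁻¹ * (p : ℂ) ^ (k - 1) with he
  have hsq := stabCoeff_sq_mul hpN hp2 hfh hsum hprod
  have hnd := fun (n : ℕ) (r m : ℤ) => stabCoeff_of_not_dvd (n := n) (r := r) (m := m) hk hpN hp2 hfh
    hsum hprod
  rw [← he] at hnd
  have hc : fourierCoeff h 0 = 0 := hh.coeff_zero
  generalize fourierCoeff h = c at *
  set cα := stabCoeff p αf βf c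
  have hcα : cα 0 = 0 := stabCoeff_zero hc
  -- Terms with p ∤ r cancel on the left, since there c_α = (1 − e)c. Those with r = pr' are
  -- evaluated by the rule for c_α(p²·).
  have key : convTheta 1 cα (4 * (p * (p * m))) - (1 - e) * convTheta 1 c (4 * (p * (p * m))) =
      ∑' r : ℤ, (e * c (p ^ 2 * ((4 * m : ℕ) - ((1 : ℕ) : ℤ) ^ 2 * r ^ 2).toNat) -
        βf * c ((4 * m : ℕ) - ((1 : ℕ) : ℤ) ^ 2 * r ^ 2).toNat) := by
    have hinj : Function.Injective fun r : ℤ => (p : ℤ) * r :=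
      mul_right_injective₀ (by exact_mod_cast NeZero.ne p)
    rw [convTheta, convTheta, ← tsum_mul_left, ← (summable_conv hcα _).tsum_sub
      ((summable_conv hc _).mul_left _), ← hinj.tsum_eq]
    · refine tsum_congr fun r => ?_
      have h1 : ((4 * (p * (p * m)) : ℕ) - ((1 : ℕ) : ℤ) ^ 2 * ((p : ℤ) * r) ^ 2).toNat =
          p ^ 2 * ((4 * m : ℕ) - ((1 : ℕ) : ℤ) ^ 2 * r ^ 2).toNat := by
        rw [← toNat_mul_sq]
        congr 1
        push_cast
        ring
      rw [h1, hsq]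
      ring
    · intro r hr
      by_contra hnr
      have hd : ¬ (p : ℤ) ∣ r := fun ⟨t, ht⟩ => hnr ⟨t, ht.symm⟩
      refine hr ?_
      simp only
      rcases le_or_gt (((4 * (p * (p * m)) : ℕ) : ℤ) - ((1 : ℕ) : ℤ) ^ 2 * r ^ 2) 0 with h0 | h0
      · rw [Int.toNat_of_nonpos h0, hc, hcα, mul_zero, sub_zero]
      · rw [hnd _ r (4 * m) hd (by
          rw [Int.toNat_of_nonneg h0.le]; push_cast; ring), sub_self]
  have hs1 : Summable fun r : ℤ => c (p ^ 2 * ((4 * m : ℕ) - ((1 : ℕ) : ℤ) ^ 2 * r ^ 2).toNat) :=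
    summable_conv (s := 1) (c := fun n => c (p ^ 2 * n)) (by simpa using hc) _
  have hs2 := summable_conv (s := 1) hc ((4 * m : ℕ) : ℤ)
  rw [(hs1.mul_left e).tsum_sub (hs2.mul_left βf), tsum_mul_left, tsum_mul_left] at key
  have h3 : convTheta 1 cα (4 * m) = αf⁻¹ *
      (∑' r : ℤ, c (p ^ 2 * ((4 * m : ℕ) - ((1 : ℕ) : ℤ) ^ 2 * r ^ 2).toNat) -
        βf * convTheta 1 c (4 * m)) := by
    rw [convTheta, convTheta, ← tsum_mul_left, ← hs1.tsum_sub (hs2.mul_left _), ← tsum_mul_left]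
    rfl
  change _ = e * _ - βf * convTheta 1 c (4 * m) at key
  rw [he] at key ⊢
  linear_combination key - (p : ℂ) ^ (k - 1) * h3

end PlusForms

end

section

variable {w : ℤ} {x y : ℍ → ℂ}

/-! ### The Hecke operators `T_m` of arbitrary index -/

/-- `∑_{d ∣ (m, n), (d, M) = 1} d^k a(mn/d²)`. -/
def heckeCoeff (M k : ℕ) (a : ℕ → ℂ) (m n : ℕ) : ℂ :=
  ∑ d ∈ m.divisors with d ∣ n ∧ d.Coprime M, (d : ℂ) ^ k * a (m * n / d ^ 2)

/-- The Hecke operator `T_m = ∑_{d ∣ m, (d, M) = 1} d^k V_d U_{m/d}`. -/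
def heckeOp (M k m : ℕ) (x : ℍ → ℂ) : ℍ → ℂ :=
  ∑ d ∈ m.divisors with d.Coprime M, (d : ℂ) ^ k • opV d (opU (m / d) x)

lemma heckeCoeff_zero_left (M k : ℕ) (a : ℕ → ℂ) (n : ℕ) : heckeCoeff M k a 0 n = 0 := by
  simp [heckeCoeff]

lemma heckeCoeff_zero_right (M k : ℕ) {a : ℕ → ℂ} (ha : a 0 = 0) (m : ℕ) :
    heckeCoeff M k a m 0 = 0 := by
  simp [heckeCoeff, ha]

lemma heckeCoeff_symm (M k : ℕ) {a : ℕ → ℂ} (ha : a 0 = 0) (m n : ℕ) :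
    heckeCoeff M k a m n = heckeCoeff M k a n m := by
  rcases Nat.eq_zero_or_pos m with rfl | hm
  · rw [heckeCoeff_zero_left, heckeCoeff_zero_right _ _ ha]
  rcases Nat.eq_zero_or_pos n with rfl | hn
  · rw [heckeCoeff_zero_left, heckeCoeff_zero_right _ _ ha]
  rw [heckeCoeff, heckeCoeff]
  refine Finset.sum_congr ?_ fun d _ => by rw [mul_comm m]
  ext d
  simp only [Finset.mem_filter, Nat.mem_divisors]
  constructor
  · rintro ⟨⟨h1, -⟩, h2, h3⟩
    exact ⟨⟨h2, hn.ne'⟩, h1, h3⟩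
  · rintro ⟨⟨h1, -⟩, h2, h3⟩
    exact ⟨⟨h2, hm.ne'⟩, h1, h3⟩

lemma hasQ_heckeOp (hx : QFn x) (M k m : ℕ) :
    HasQ (heckeOp M k m x) (heckeCoeff M k (fourierCoeff x) m) := by
  have h : HasQ (heckeOp M k m x) (∑ d ∈ m.divisors with d.Coprime M,
      (d : ℂ) ^ k • fun n => if d ∣ n then fourierCoeff x (m / d * (n / d)) else 0) := by
    refine HasQ.sum fun d hd => ?_
    obtain ⟨hd, -⟩ := Finset.mem_filter.mp hd
    obtain ⟨hdm, hm0⟩ := Nat.mem_divisors.mp hd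
    have : NeZero d := ⟨fun h => hm0 (by rwa [h, zero_dvd_iff] at hdm)⟩
    have : NeZero (m / d) := ⟨(Nat.div_pos (Nat.le_of_dvd (Nat.pos_of_ne_zero hm0) hdm)
      (NeZero.pos d)).ne'⟩
    exact ((hx.hasQ.opU (m / d)).opV d).smul _
  convert! h using 1
  funext n
  rw [heckeCoeff, Finset.sum_apply, ← Finset.filter_filter, Finset.filter_comm]
  conv_lhs => rw [Finset.sum_filter]
  refine Finset.sum_congr rfl fun d hd => ?_
  obtain ⟨hd, -⟩ := Finset.mem_filter.mp hd
  obtain ⟨⟨m', rfl⟩, hm0⟩ := Nat.mem_divisors.mp hd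
  have hd0 : 0 < d := Nat.pos_of_ne_zero fun h => hm0 (by simp [h])
  rw [Pi.smul_apply, smul_eq_mul]
  split_ifs with hdn
  · obtain ⟨n', rfl⟩ := hdn
    rw [Nat.mul_div_cancel_left _ hd0, Nat.mul_div_cancel_left _ hd0,
      show d * m' * (d * n') = d ^ 2 * (m' * n') by ring, Nat.mul_div_cancel_left _ (by positivity)]
  · rw [mul_zero]

lemma sum_divisors_mul (l m n : ℕ) (hl : l.Prime) (hm : m ≠ 0) (f : ℕ → ℂ) :
    ∑ d ∈ m.divisors with d ∣ n, f (l * d) =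
      ∑ e ∈ (l * m).divisors with e ∣ l * n ∧ l ∣ e, f e := by
  refine Finset.sum_nbij' (fun d => l * d) (fun e => e / l) ?_ ?_ ?_ ?_ ?_
  · intro d hd
    simp only [Finset.mem_filter, Nat.mem_divisors] at hd ⊢
    exact ⟨⟨Nat.mul_dvd_mul_left l hd.1.1, mul_ne_zero hl.ne_zero hm⟩,
      Nat.mul_dvd_mul_left l hd.2, Dvd.intro _ rfl⟩
  · intro e he
    simp only [Finset.mem_filter, Nat.mem_divisors] at he ⊢
    obtain ⟨⟨h1, -⟩, h2, d, rfl⟩ := he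
    rw [Nat.mul_div_cancel_left _ hl.pos]
    exact ⟨⟨Nat.dvd_of_mul_dvd_mul_left hl.pos h1, hm⟩, Nat.dvd_of_mul_dvd_mul_left hl.pos h2⟩
  · intro d _
    exact Nat.mul_div_cancel_left _ hl.pos
  · intro e he
    simp only [Finset.mem_filter] at he
    exact Nat.mul_div_cancel' he.2.2
  · intro d _
    rfl

/-- The multiplication rule of the Hecke operators, on coefficients. -/
lemma heckeCoeff_rec (M k : ℕ) (a : ℕ → ℂ) {l : ℕ} (hl : l.Prime) {m n : ℕ} (hm : m ≠ 0)
    (hn : n ≠ 0) : heckeCoeff M k a m (l * n) +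
      (if l ∣ M then 0 else (l : ℂ) ^ k * (if l ∣ n then heckeCoeff M k a m (n / l) else 0)) =
      heckeCoeff M k a (l * m) n +
      (if l ∣ M then 0 else (l : ℂ) ^ k * (if l ∣ m then heckeCoeff M k a (m / l) n else 0)) := by
  -- All four terms are sums of this one function over divisors e. Those carrying the factor l^k
  -- correspond to e = l·d.
  set t : ℕ → ℂ := fun e => if e.Coprime M then (e : ℂ) ^ k * a (l * m * n / e ^ 2) else 0 with ht
  have hH : ∀ m n, heckeCoeff M k a m n =
      ∑ d ∈ m.divisors with d ∣ n, if d.Coprime M then (d : ℂ) ^ k * a (m * n / d ^ 2) else 0 :=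
    fun m n => by
    rw [heckeCoeff, ← Finset.filter_filter, Finset.sum_filter]
  have h1 : heckeCoeff M k a m (l * n) = ∑ e ∈ m.divisors with e ∣ l * n, t e := by
    rw [hH]
    refine Finset.sum_congr rfl fun d _ => ?_
    rw [ht]
    simp only
    rw [show m * (l * n) = l * m * n by ring]
  have h3 : heckeCoeff M k a (l * m) n = ∑ e ∈ (l * m).divisors with e ∣ n, t e := hH _ _
  have hcop : l ∣ M → ∀ e, l ∣ e → t e = 0 := fun hlM e he => by
    rw [ht]
    simp only
    exact if_neg fun h => Nat.not_coprime_of_dvd_of_dvd hl.one_lt he hlM h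
  have hlt : ¬ l ∣ M → ∀ m' n' : ℕ, l * (m' * n') = m * n → ∀ d,
      (l : ℂ) ^ k * (if d.Coprime M then (d : ℂ) ^ k * a (m' * n' / d ^ 2) else 0) = t (l * d) :=
    fun hlM m' n' hmn d => by
    rw [ht]
    simp only
    have e1 : (l * d).Coprime M ↔ d.Coprime M :=
      ⟨fun h => h.coprime_dvd_left (Dvd.intro_left _ rfl),
        fun h => ((Nat.Prime.coprime_iff_not_dvd hl).mpr hlM).mul_left h⟩
    rw [mul_ite, mul_zero]
    refine if_congr e1.symm ?_ rfl
    rw [show l * m * n = l * (m * n) by ring, ← hmn,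
      show l * (l * (m' * n')) = l ^ 2 * (m' * n') by ring, mul_pow l d,
      Nat.mul_div_mul_left _ _ (pow_pos hl.pos 2)]
    push_cast
    ring
  have h2 : (if l ∣ M then 0 else (l : ℂ) ^ k * (if l ∣ n then heckeCoeff M k a m (n / l) else 0)) =
      ∑ e ∈ (l * m).divisors with e ∣ n ∧ l ∣ e, t e := by
    split_ifs with hlM hln
    · exact (Finset.sum_eq_zero fun e he => hcop hlM e (Finset.mem_filter.mp he).2.2).symm
    · obtain ⟨n', rfl⟩ := hln
      rw [Nat.mul_div_cancel_left _ hl.pos, hH, Finset.mul_sum, ← sum_divisors_mul l m n' hl hm]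
      exact Finset.sum_congr rfl fun d _ => hlt hlM m n' (by ring) d
    · rw [mul_zero]
      refine (Finset.sum_eq_zero fun e he => ?_).symm
      obtain ⟨-, h1, h2⟩ := Finset.mem_filter.mp he
      exact absurd (h2.trans h1) hln
  have h4 : (if l ∣ M then 0 else (l : ℂ) ^ k * (if l ∣ m then heckeCoeff M k a (m / l) n else 0)) =
      ∑ e ∈ m.divisors with e ∣ l * n ∧ l ∣ e, t e := by
    split_ifs with hlM hlm
    · exact (Finset.sum_eq_zero fun e he => hcop hlM e (Finset.mem_filter.mp he).2.2).symm
    · obtain ⟨m', rfl⟩ := hlm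
      rw [Nat.mul_div_cancel_left _ hl.pos, hH, Finset.mul_sum,
        ← sum_divisors_mul l m' n hl fun h => hm (by simp [h])]
      exact Finset.sum_congr rfl fun d _ => hlt hlM m' n (by ring) d
    · rw [mul_zero]
      refine (Finset.sum_eq_zero fun e he => ?_).symm
      obtain ⟨h0, h1, h2⟩ := Finset.mem_filter.mp he
      exact absurd (h2.trans (Nat.dvd_of_mem_divisors h0)) hlm
  -- For e prime to l, the conditions e ∣ m, e ∣ ln and e ∣ lm, e ∣ n are the same.
  have hset : (m.divisors.filter fun e => e ∣ l * n ∧ ¬ l ∣ e) =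
      (l * m).divisors.filter fun e => e ∣ n ∧ ¬ l ∣ e := by
    ext e
    simp only [Finset.mem_filter, Nat.mem_divisors]
    constructor
    · rintro ⟨⟨h1, -⟩, h2, h3⟩
      exact ⟨⟨h1.mul_left l, mul_ne_zero hl.ne_zero hm⟩,
        (((Nat.Prime.coprime_iff_not_dvd hl).mpr h3).symm.dvd_of_dvd_mul_left h2), h3⟩
    · rintro ⟨⟨h1, -⟩, h2, h3⟩
      exact ⟨⟨((Nat.Prime.coprime_iff_not_dvd hl).mpr h3).symm.dvd_of_dvd_mul_left h1, hm⟩,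
        h2.mul_left l, h3⟩
  rw [h1, h2, h3, h4,
    ← Finset.sum_filter_add_sum_filter_not (m.divisors.filter fun e => e ∣ l * n) (l ∣ ·),
    ← Finset.sum_filter_add_sum_filter_not ((l * m).divisors.filter fun e => e ∣ n) (l ∣ ·)]
  simp only [Finset.filter_filter]
  rw [hset]
  ring

/-- By induction through T_{lm} = T_l T_m − l^k T_{m/l} for l ∤ M (the last term only if l ∣ m), and
T_{lm} = U_l T_m for l ∣ M. Single summands V_d U_{m/d} would only give a larger level. -/
lemma heckeOp_mem_cuspSpace {M k : ℕ} [NeZero M] (hx : x ∈ cuspSpace M (k + 1)) (m : ℕ) :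
    heckeOp M k m x ∈ cuspSpace M (k + 1) := by
  have hxq := qfn_of_cuspSpace hx
  have hx0 := fourierCoeff_zero hx
  suffices h : ∃ X ∈ cuspSpace M (k + 1), ∀ n, fourierCoeff X n = heckeCoeff M k (fourierCoeff x) m n by
    obtain ⟨X, hX, hXn⟩ := h
    have h2 := (qfn_of_cuspSpace hX).hasQ
    rw [show fourierCoeff X = _ from funext hXn] at h2
    rwa [(hasQ_heckeOp hxq M k m).ext h2]
  induction m using Nat.strong_induction_on with
  | _ m ih =>
    rcases Nat.eq_zero_or_pos m with rfl | hm0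
    · exact ⟨0, zero_mem _, fun n => by rw [heckeCoeff_zero_left, fourierCoeff_zero_fn]⟩
    by_cases h1 : m = 1
    · subst h1
      exact ⟨x, hx, fun n => by simp [heckeCoeff, Finset.filter_singleton]⟩
    have hl := Nat.minFac_prime h1
    obtain ⟨m', hm'⟩ := Nat.minFac_dvd m
    set l := m.minFac
    have : NeZero l := ⟨hl.ne_zero⟩
    have hm'0 : 0 < m' := Nat.pos_of_ne_zero fun h => by simp [h] at hm'; omega
    have hlt : m' < m := by rw [hm']; exact lt_mul_of_one_lt_left hm'0 hl.one_lt
    obtain ⟨X, hX, hXn⟩ := ih m' hlt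
    obtain ⟨Y, hY, hYn⟩ := ih (m' / l) ((Nat.div_le_self _ _).trans_lt hlt)
    have hXq := qfn_of_cuspSpace hX
    have hYq := qfn_of_cuspSpace hY
    by_cases hlM : l ∣ M
    · refine ⟨opU l X, opU_mem_cuspSpace' hl hlM hX, fun n => ?_⟩
      rw [hXq.coeff_U, hXn, hm']
      rcases Nat.eq_zero_or_pos n with rfl | hn
      · rw [mul_zero, heckeCoeff_zero_right _ _ hx0, heckeCoeff_zero_right _ _ hx0]
      · have := heckeCoeff_rec M k (fourierCoeff x) hl hm'0.ne' hn.ne'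
        simpa [if_pos hlM] using this
    · have hT := heckeT_mem_cuspSpace hl hlM hX
      have hTq := qfn_of_cuspSpace hT
      refine ⟨heckeT (k + 1) l X - (if l ∣ m' then (l : ℂ) ^ k else 0) • Y,
        sub_mem hT (Submodule.smul_mem _ _ hY), fun n => ?_⟩
      rw [hTq.coeff_sub (hYq.smul _), hYq.coeff_smul, hXq.coeff_T, hXn, hXn, hYn, hm',
        add_sub_cancel_right, zpow_natCast]
      rcases Nat.eq_zero_or_pos n with rfl | hn
      · simp [heckeCoeff_zero_right _ _ hx0]
      · have := heckeCoeff_rec M k (fourierCoeff x) hl hm'0.ne' hn.ne'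
        rw [if_neg hlM, if_neg hlM] at this
        rw [this]
        split_ifs <;> ring

lemma coeff_heckeOp {M k : ℕ} [NeZero M] (hx : x ∈ cuspSpace M (k + 1)) (m n : ℕ) :
    fourierCoeff (heckeOp M k m x) n = heckeCoeff M k (fourierCoeff x) m n := by
  rw [(qfn_of_cuspSpace (heckeOp_mem_cuspSpace hx m)).fourierCoeff_eq
    (hasQ_heckeOp (qfn_of_cuspSpace hx) M k m)]

lemma heckeOp_add (M k m : ℕ) (x y : ℍ → ℂ) :
    heckeOp M k m (x + y) = heckeOp M k m x + heckeOp M k m y := by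
  simp [heckeOp, Finset.sum_add_distrib]

lemma heckeOp_smul (M k m : ℕ) (c : ℂ) (x : ℍ → ℂ) :
    heckeOp M k m (c • x) = c • heckeOp M k m x := by
  simp only [heckeOp, _root_.map_smul, Finset.smul_sum]
  exact Finset.sum_congr rfl fun d _ => smul_comm _ _ _

/-- Only divisors d prime to M, hence to p, occur, so replacing n by pn does not change which d
divide it. -/
lemma heckeOp_opU {M k p : ℕ} [NeZero M] [NeZero p] (hp : p.Prime) (hpM : p ∣ M)
    (hx : x ∈ cuspSpace M (k + 1)) (m : ℕ) :
    heckeOp M k m (opU p x) = opU p (heckeOp M k m x) := by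
  have hU := opU_mem_cuspSpace' hp hpM hx
  have hxq := qfn_of_cuspSpace hx
  have hR := qfn_of_cuspSpace (heckeOp_mem_cuspSpace hx m)
  refine (qfn_of_cuspSpace (heckeOp_mem_cuspSpace hU m)).ext (hR.opU p) fun n => ?_
  rw [coeff_heckeOp hU, hR.coeff_U, coeff_heckeOp hx, heckeCoeff, heckeCoeff]
  refine Finset.sum_congr ?_ fun d hd => ?_
  · ext d
    simp only [Finset.mem_filter]
    refine and_congr_right fun _ => and_congr_left fun hd => ?_
    have hdp : d.Coprime p := hd.coprime_dvd_right hpM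
    exact ⟨fun h => h.mul_left p, fun h => hdp.dvd_of_dvd_mul_left h⟩
  · obtain ⟨hd, hdn, hdM⟩ := Finset.mem_filter.mp hd
    obtain ⟨⟨m', rfl⟩, hm0⟩ := Nat.mem_divisors.mp hd
    have hdp : d.Coprime p := hdM.coprime_dvd_right hpM
    obtain ⟨n', rfl⟩ := hdp.dvd_of_dvd_mul_left hdn
    have hd0 : 0 < d := Nat.pos_of_ne_zero fun h => hm0 (by simp [h])
    rw [hxq.coeff_U, show d * m' * (d * n') = d ^ 2 * (m' * n') by ring,
      show d * m' * (p * (d * n')) = d ^ 2 * (p * (m' * n')) by ring,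
      Nat.mul_div_cancel_left _ (by positivity), Nat.mul_div_cancel_left _ (by positivity)]

/-- Comparison of the coefficients of `T_m` in levels `N` and `N * p`. -/
lemma heckeCoeff_level {N k p : ℕ} (hp : p.Prime) (hpN : ¬ p ∣ N) (a : ℕ → ℂ) (m n : ℕ) :
    heckeCoeff (N * p) k a m n = heckeCoeff N k a m n - (p : ℂ) ^ k *
      (if p ∣ m ∧ p ∣ n then heckeCoeff N k a (m / p) (n / p) else 0) := by
  rcases Nat.eq_zero_or_pos m with rfl | hm
  · simp [heckeCoeff_zero_left]
  rw [eq_sub_iff_add_eq]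
  have h1 : heckeCoeff (N * p) k a m n = ∑ d ∈ (m.divisors.filter fun d => d ∣ n ∧ d.Coprime N) with
      ¬ p ∣ d, (d : ℂ) ^ k * a (m * n / d ^ 2) := by
    rw [heckeCoeff, Finset.filter_filter]
    refine Finset.sum_congr (Finset.filter_congr fun d _ => ?_) fun _ _ => rfl
    rw [Nat.coprime_mul_iff_right, and_assoc]
    refine and_congr_right fun _ => and_congr_right fun _ => ?_
    rw [Nat.coprime_comm, Nat.Prime.coprime_iff_not_dvd hp]
  have h2 : (p : ℂ) ^ k * (if p ∣ m ∧ p ∣ n then heckeCoeff N k a (m / p) (n / p) else 0) =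
      ∑ d ∈ (m.divisors.filter fun d => d ∣ n ∧ d.Coprime N) with p ∣ d,
        (d : ℂ) ^ k * a (m * n / d ^ 2) := by
    split_ifs with hd
    · obtain ⟨⟨m', rfl⟩, n', rfl⟩ := hd
      rw [Nat.mul_div_cancel_left _ hp.pos, Nat.mul_div_cancel_left _ hp.pos, heckeCoeff,
        Finset.mul_sum, ← Finset.filter_filter, Finset.sum_filter, Finset.filter_filter,
        Finset.sum_congr rfl (g := fun d => if (p * d).Coprime N then ((p * d : ℕ) : ℂ) ^ k *
          a (p * m' * (p * n') / (p * d) ^ 2) else 0),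
        sum_divisors_mul p m' n' hp (fun h => hm.ne' (by simp [h]))
          (fun e => if e.Coprime N then (e : ℂ) ^ k * a (p * m' * (p * n') / e ^ 2) else 0),
        ← Finset.sum_filter, Finset.filter_filter]
      · refine Finset.sum_congr (Finset.filter_congr fun d _ => ?_) fun _ _ => rfl
        tauto
      · intro d _
        have e1 : (p * d).Coprime N ↔ d.Coprime N :=
          ⟨fun h => h.coprime_dvd_left (Dvd.intro_left _ rfl),
            fun h => ((Nat.Prime.coprime_iff_not_dvd hp).mpr hpN).mul_left h⟩
        refine if_congr e1.symm ?_ rfl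
        rw [show p * m' * (p * n') = p ^ 2 * (m' * n') by ring, mul_pow p d 2,
          Nat.mul_div_mul_left _ _ (pow_pos hp.pos 2)]
        push_cast
        ring
    · rw [mul_zero]
      refine (Finset.sum_eq_zero fun e he => ?_).symm
      obtain ⟨h0, h1⟩ := Finset.mem_filter.mp he
      obtain ⟨h2, h3, -⟩ := Finset.mem_filter.mp h0
      exact absurd ⟨h1.trans (Nat.dvd_of_mem_divisors h2), h1.trans h3⟩ hd
  rw [h1, h2, add_comm, Finset.sum_filter_add_sum_filter_not]
  rfl

end

section

variable {x y : ℍ → ℂ}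

/-! ### The pullback of a Saito-Kurokawa lift -/

/-- The coefficient of a Saito-Kurokawa lift at the form `(n, r/2; r/2, m)`, `n, m ≥ 0`, extended by
zero to the forms which are not positive definite. -/
def formCoeff (M k : ℕ) (c : ℕ → ℂ) (m n : ℕ) (r : ℤ) : ℂ :=
  ∑ d ∈ m.divisors with d ∣ n ∧ d.Coprime M,
    if (d : ℤ) ∣ r then (d : ℂ) ^ k * c ((4 * n * m - r ^ 2 : ℤ).toNat / d ^ 2) else 0

variable {M k : ℕ} {c : ℕ → ℂ}

lemma formCoeff_of_le (hc : c 0 = 0) {m n : ℕ} {r : ℤ} (h : (4 * n * m : ℤ) ≤ r ^ 2) :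
    formCoeff M k c m n r = 0 := by
  refine Finset.sum_eq_zero fun d _ => ?_
  rw [Int.toNat_of_nonpos (by linarith), Nat.zero_div, hc, mul_zero, ite_self]

namespace HalfIntegralForm

lemma snd_pos (B : HalfIntegralForm) : 0 < B.1.2.2 := by
  obtain ⟨⟨n, r, m⟩, h1, h2⟩ := B
  simp only at h1 h2 ⊢
  by_contra hm
  nlinarith [sq_nonneg r]

/-- The entries `(m, n, r)` of a form. -/
def entries (B : HalfIntegralForm) : (ℕ × ℕ) × ℤ := ((B.1.2.2.toNat, B.1.1.toNat), B.1.2.1)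

lemma entries_injective : Function.Injective entries := by
  intro B B' h
  have h1 := B.2.1
  have h2 := B'.2.1
  have h3 := B.snd_pos
  have h4 := B'.snd_pos
  simp only [entries, Prod.mk.injEq] at h
  obtain ⟨⟨h5, h6⟩, h7⟩ := h
  refine Subtype.ext (Prod.ext ?_ (Prod.ext h7 ?_)) <;> omega

lemma exists_entries {m n : ℕ} {r : ℤ} (h : r ^ 2 < 4 * n * m) :
    ∃ B : HalfIntegralForm, B.entries = ((m, n), r) := by
  have hn : 0 < n := Nat.pos_of_ne_zero fun h0 => by
    subst h0
    have := sq_nonneg r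
    simp at h
    linarith
  exact ⟨⟨(n, r, m), Int.natCast_pos.mpr hn, by simpa using h⟩, by simp [entries]⟩

end HalfIntegralForm

lemma saitoKurokawaCoeff_eq (B : HalfIntegralForm) : saitoKurokawaCoeff M k c B =
    formCoeff M k c B.entries.1.1 B.entries.1.2 B.entries.2 := by
  have h1 := B.2.1
  have h3 := B.snd_pos
  obtain ⟨n, hn⟩ := Int.eq_ofNat_of_zero_le h1.le
  obtain ⟨m, hm⟩ := Int.eq_ofNat_of_zero_le h3.le
  have hm0 : m ≠ 0 := fun h => by simp [h] at hm; omega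
  have hn0 : n ≠ 0 := fun h => by simp [h] at hn; omega
  simp only [saitoKurokawaCoeff, formCoeff, HalfIntegralForm.entries, HalfIntegralForm.disc,
    HalfIntegralForm.content, hn, hm, Int.toNat_natCast]
  rw [← Finset.sum_filter, Finset.filter_filter]
  refine Finset.sum_congr ?_ fun _ _ => rfl
  ext d
  have e1 : d ∣ Int.gcd n (Int.gcd B.1.2.1 m : ℤ) ↔ d ∣ n ∧ (d : ℤ) ∣ B.1.2.1 ∧ d ∣ m := by
    rw [Int.natCast_dvd, ← Nat.dvd_gcd_iff, ← Nat.dvd_gcd_iff]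
    rfl
  have e2 : Int.gcd n (Int.gcd B.1.2.1 m : ℤ) ≠ 0 := by
    intro h
    have := Int.gcd_eq_zero_iff.mp h
    omega
  simp only [Finset.mem_filter, Nat.mem_divisors, e1]
  tauto

/-- Only r = ds contributes for a given d, and 4nm − r² = d²(4(mn/d²) − s²). The sum over s is
therefore a(mn/d²): the lift becomes a generating series of Hecke operators. -/
lemma hasSum_formCoeff (hc : c 0 = 0) {a : ℕ → ℂ} (ha : ∀ n, a n = convTheta 1 c (4 * n))
    (m n : ℕ) : HasSum (formCoeff M k c m n) (heckeCoeff M k a m n) := by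
  refine hasSum_sum fun d hd => ?_
  obtain ⟨hd, hdn, -⟩ := Finset.mem_filter.mp hd
  obtain ⟨⟨m', rfl⟩, hm0⟩ := Nat.mem_divisors.mp hd
  obtain ⟨n', rfl⟩ := hdn
  have hd0 : 0 < d := Nat.pos_of_ne_zero fun h => hm0 (by simp [h])
  have : NeZero d := ⟨hd0.ne'⟩
  have hi : Function.Injective fun r : ℤ => (d : ℤ) * r :=
    mul_right_injective₀ (by exact_mod_cast hd0.ne')
  refine (hi.hasSum_iff fun r hr => if_neg fun ⟨s, hs⟩ => hr ⟨s, hs.symm⟩).mp ?_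
  rw [ha, show d * m' * (d * n') = d ^ 2 * (m' * n') by ring,
    Nat.mul_div_cancel_left _ (by positivity), convTheta]
  refine (congrArg (HasSum · _) (funext fun r => ?_)).mp
    ((summable_conv (s := 1) hc ((4 * (m' * n') : ℕ) : ℤ)).hasSum.mul_left ((d : ℂ) ^ k))
  simp only [Function.comp_apply]
  rw [if_pos (Dvd.intro _ rfl)]
  congr 2
  rw [show (4 * ((d * n' : ℕ) : ℤ) * ((d * m' : ℕ) : ℤ) - (d * r) ^ 2 : ℤ) =
    (d : ℤ) ^ 2 * (((4 * (m' * n') : ℕ) : ℤ) - (1 : ℕ) ^ 2 * r ^ 2) by push_cast; ring,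
    toNat_mul_sq, Nat.mul_div_cancel_left _ (by positivity)]

/-- The terms vanish unless r² < 4mn, and then 1 + r² ≤ 5mn. Trading a factor mn for 1/(1 + r²)
makes the bound summable over r. -/
lemma norm_formCoeff_le {C : ℝ} {j : ℕ} (hC : 0 ≤ C) (hc : c 0 = 0)
    (hcb : ∀ n, ‖c n‖ ≤ C * (n : ℝ) ^ j) (m n : ℕ) (r : ℤ) :
    ‖formCoeff M k c m n r‖ ≤ 5 * 4 ^ j * C *
      ((m : ℝ) ^ (k + j + 2) * (n : ℝ) ^ (j + 1) * (1 / (1 + (r : ℝ) ^ 2))) := by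
  rcases le_or_gt (4 * n * m : ℤ) (r ^ 2) with h | h
  · rw [formCoeff_of_le hc h, norm_zero]
    positivity
  have hm : 0 < m := Nat.pos_of_ne_zero fun h0 => by
    subst h0
    have := sq_nonneg r
    simp at h
    linarith
  have hn : 0 < n := Nat.pos_of_ne_zero fun h0 => by
    subst h0
    have := sq_nonneg r
    simp at h
    linarith
  have h1 : ‖formCoeff M k c m n r‖ ≤ m * ((m : ℝ) ^ k * (C * (4 * n * m : ℝ) ^ j)) := by
    have hb : ∀ d ∈ m.divisors.filter (fun d => d ∣ n ∧ d.Coprime M),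
        ‖(if (d : ℤ) ∣ r then (d : ℂ) ^ k * c ((4 * n * m - r ^ 2 : ℤ).toNat / d ^ 2) else 0 : ℂ)‖ ≤
          (m : ℝ) ^ k * (C * (4 * n * m : ℝ) ^ j) := by
      intro d hd
      have hdm : d ≤ m := Nat.divisor_le (Finset.mem_filter.mp hd).1
      split_ifs
      · rw [norm_mul, norm_pow, Complex.norm_natCast]
        have h3 : (4 * n * m - r ^ 2 : ℤ).toNat / d ^ 2 ≤ 4 * n * m := by
          refine (Nat.div_le_self _ _).trans ?_
          have := sq_nonneg r
          zify
          omega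
        have h4 : (((4 * n * m - r ^ 2 : ℤ).toNat / d ^ 2 : ℕ) : ℝ) ≤ 4 * n * m := by
          exact_mod_cast h3
        have h5 : (d : ℝ) ≤ m := by exact_mod_cast hdm
        gcongr
        exact (hcb _).trans (by gcongr)
      · rw [norm_zero]
        positivity
    refine (norm_sum_le_of_le _ hb).trans ?_
    rw [Finset.sum_const, nsmul_eq_mul]
    have h6 : ((m.divisors.filter (fun d => d ∣ n ∧ d.Coprime M)).card : ℝ) ≤ m := by
      exact_mod_cast (Finset.card_filter_le _ _).trans (Nat.card_divisors_le_self m)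
    gcongr
  refine h1.trans ?_
  have hr : (1 : ℝ) ≤ 5 * (m * n) * (1 / (1 + (r : ℝ) ^ 2)) := by
    rw [mul_one_div, le_div_iff₀ (by positivity), one_mul]
    have h2 : (r : ℝ) ^ 2 < 4 * n * m := by exact_mod_cast h
    have h3 : (1 : ℝ) ≤ m * n := by exact_mod_cast Nat.mul_pos hm hn
    linarith
  calc (m : ℝ) * ((m : ℝ) ^ k * (C * (4 * n * m : ℝ) ^ j))
      ≤ (m : ℝ) * ((m : ℝ) ^ k * (C * (4 * n * m : ℝ) ^ j)) *
        (5 * (m * n) * (1 / (1 + (r : ℝ) ^ 2))) := le_mul_of_one_le_right (by positivity) hr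
    _ = _ := by
      rw [mul_pow, mul_pow]
      ring

lemma summable_one_div_one_add_sq : Summable fun r : ℤ => 1 / (1 + (r : ℝ) ^ 2) := by
  refine Summable.of_nonneg_of_le (fun r => by positivity) (fun r => ?_)
    ((Real.summable_one_div_int_pow.mpr one_lt_two).add (hasSum_ite_eq (0 : ℤ) (1 : ℝ)).summable)
  rcases eq_or_ne r 0 with rfl | hr
  · simp
  · have h0 : (0 : ℝ) < (r : ℝ) ^ 2 := by positivity
    rw [if_neg hr, add_zero]
    exact one_div_le_one_div_of_le h0 (by linarith)

lemma summable_formCoeff {C : ℝ} {j : ℕ} (hC : 0 ≤ C) (hc : c 0 = 0)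
    (hcb : ∀ n, ‖c n‖ ≤ C * (n : ℝ) ^ j) {q₁ q₂ : ℂ} (h₁ : ‖q₁‖ < 1) (h₂ : ‖q₂‖ < 1) :
    Summable fun t : (ℕ × ℕ) × ℤ =>
      formCoeff M k c t.1.1 t.1.2 t.2 * (q₁ ^ t.1.2 * q₂ ^ t.1.1) := by
  have e1 : Summable fun m : ℕ => (m : ℝ) ^ (k + j + 2) * ‖q₂‖ ^ m :=
    summable_pow_mul_geometric_of_norm_lt_one _ (by rwa [norm_norm])
  have e2 : Summable fun n : ℕ => (n : ℝ) ^ (j + 1) * ‖q₁‖ ^ n :=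
    summable_pow_mul_geometric_of_norm_lt_one _ (by rwa [norm_norm])
  have e3 := ((e1.mul_of_nonneg e2 (fun m => by positivity) (fun n => by positivity)).mul_of_nonneg
    summable_one_div_one_add_sq (fun _ => by dsimp only [Pi.zero_apply]; positivity)
    (fun r => by dsimp only [Pi.zero_apply]; positivity)).mul_left (5 * 4 ^ j * C)
  refine Summable.of_norm_bounded e3 fun t => ?_
  rw [norm_mul, norm_mul, norm_pow, norm_pow]
  refine (mul_le_mul_of_nonneg_right (norm_formCoeff_le hC hc hcb t.1.1 t.1.2 t.2)
    (by positivity)).trans_eq ?_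
  ring

/-- The function `∑_m (T_m g)(τ₁) q(τ₂)^m` on `ℍ × ℍ`. -/
def heckeKernel (M k : ℕ) (g : ℍ → ℂ) : ℍ → ℍ → ℂ := fun τ₁ τ₂ =>
  ∑' m : ℕ, heckeOp M k m g τ₁ * 𝕢 1 τ₂ ^ m

/-- On the diagonal the exponential does not involve r, so absolute convergence allows summing first
over r, then over n, then over m. -/
lemma pullback_saitoKurokawa {C : ℝ} {j : ℕ} (hC : 0 ≤ C) (hc : c 0 = 0)
    (hcb : ∀ n, ‖c n‖ ≤ C * (n : ℝ) ^ j) {g : ℍ → ℂ} (hg : QFn g)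
    (hgc : ∀ n, fourierCoeff g n = convTheta 1 c (4 * n)) :
    pullback (saitoKurokawa M k c) = heckeKernel M k g := by
  funext τ₁ τ₂
  set q₁ := 𝕢 1 τ₁ with hq₁
  set q₂ := 𝕢 1 τ₂ with hq₂
  have hs := summable_formCoeff (M := M) (k := k) hC hc hcb
    (Function.Periodic.norm_qParam_lt_one one_pos τ₁.im_pos)
    (Function.Periodic.norm_qParam_lt_one one_pos τ₂.im_pos)
  have h1 := hs.hasSum.prod_fiberwise fun t : ℕ × ℕ =>
    (hasSum_formCoeff (M := M) (k := k) hc hgc t.1 t.2).mul_right (q₁ ^ t.2 * q₂ ^ t.1)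
  have h2 := h1.prod_fiberwise (g := fun m => heckeOp M k m g τ₁ * q₂ ^ m) fun m => by
    refine (congrArg (HasSum · _) (funext fun n => ?_)).mp
      ((hasQ_heckeOp hg M k m τ₁).mul_right (q₂ ^ m))
    ring
  rw [heckeKernel, h2.tsum_eq, pullback, saitoKurokawa]
  rw [← HalfIntegralForm.entries_injective.tsum_eq (f := fun t : (ℕ × ℕ) × ℤ =>
      formCoeff M k c t.1.1 t.1.2 t.2 * (q₁ ^ t.1.2 * q₂ ^ t.1.1))]
  · refine tsum_congr fun B => ?_
    rw [saitoKurokawaCoeff_eq]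
    congr 1
    have hn : ((B.1.1.toNat : ℤ) : ℂ) = (B.1.1 : ℂ) := by rw [Int.toNat_of_nonneg B.2.1.le]
    have hm : ((B.1.2.2.toNat : ℤ) : ℂ) = (B.1.2.2 : ℂ) := by rw [Int.toNat_of_nonneg B.snd_pos.le]
    rw [Int.cast_natCast] at hn hm
    rw [hq₁, hq₂, Function.Periodic.qParam, Function.Periodic.qParam, ← Complex.exp_nat_mul,
      ← Complex.exp_nat_mul, ← Complex.exp_add]
    congr 1
    simp only [HalfIntegralForm.toMatrix, diagEmbedding, HalfIntegralForm.entries, hn, hm,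
      Matrix.trace_fin_two, Matrix.mul_apply, Fin.sum_univ_two, Matrix.diagonal_apply]
    simp
    ring
  · intro t ht
    obtain ⟨⟨m, n⟩, r⟩ := t
    refine HalfIntegralForm.exists_entries ?_
    by_contra hle
    refine ht ?_
    simp only
    rw [formCoeff_of_le hc (not_lt.mp hle), zero_mul]

/-- Expand T_m g along the finitely many coefficients that determine it, and use a_j(T_m g) =
a_m(T_j g) to resum over m. -/
lemma hasSum_heckeKernel [NeZero M] {B : ℕ} {b : Fin B → ℍ → ℂ}
    (hb : ∀ x ∈ cuspSpace M (k + 1), x = ∑ j : Fin B, fourierCoeff x j • b j) {g : ℍ → ℂ}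
    (hg : g ∈ cuspSpace M (k + 1)) (τ₁ τ₂ : ℍ) :
    HasSum (fun m : ℕ => heckeOp M k m g τ₁ * 𝕢 1 τ₂ ^ m)
      (∑ j : Fin B, b j τ₁ * heckeOp M k j g τ₂) := by
  have h := hasSum_sum (s := Finset.univ) fun (j : Fin B) _ =>
    (hasQ_heckeOp (qfn_of_cuspSpace hg) M k j τ₂).mul_left (b j τ₁)
  refine (congrArg (HasSum · _) (funext fun m => ?_)).mp h
  conv_rhs => rw [hb _ (heckeOp_mem_cuspSpace hg m)]
  rw [Finset.sum_apply, Finset.sum_mul]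
  refine Finset.sum_congr rfl fun j _ => ?_
  rw [Pi.smul_apply, smul_eq_mul, coeff_heckeOp hg, heckeCoeff_symm _ _ (fourierCoeff_zero hg)]
  ring

lemma heckeKernel_mem_boxTensor [NeZero M] {g : ℍ → ℂ} (hg : g ∈ cuspSpace M (k + 1)) :
    heckeKernel M k g ∈ boxTensor (cuspSpace M (k + 1)) (cuspSpace M (k + 1)) := by
  obtain ⟨B, b, hbm, hb⟩ := exists_dual_basis M (k + 1)
  rw [show heckeKernel M k g = ∑ j : Fin B, fun τ₁ τ₂ => b j τ₁ * heckeOp M k j g τ₂ from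
    funext fun τ₁ => funext fun τ₂ => by
      rw [heckeKernel, (hasSum_heckeKernel hb hg τ₁ τ₂).tsum_eq, Finset.sum_apply, Finset.sum_apply]]
  exact Submodule.sum_mem _ fun j _ =>
    Submodule.subset_span ⟨_, hbm j, _, heckeOp_mem_cuspSpace hg j, rfl⟩

end

section

variable {x y : ℍ → ℂ}

/-! ### Tensor products of linear maps -/

/-- Linearity on a subspace `S` of a map which is defined on all functions. -/
structure IsLinearOn {V : Type*} [AddCommGroup V] [Module ℂ V] (S : Submodule ℂ (ℍ → ℂ))
    (T : (ℍ → ℂ) → V) : Prop where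
  add : ∀ x ∈ S, ∀ y ∈ S, T (x + y) = T x + T y
  smul : ∀ (c : ℂ), ∀ x ∈ S, T (c • x) = c • T x

/-- The function `∑ x_j × y_j` on `ℍ × ℍ`. -/
def boxSum {ι : Type*} [Fintype ι] (x y : ι → ℍ → ℂ) : ℍ → ℍ → ℂ := fun τ₁ τ₂ => ∑ j, x j τ₁ * y j τ₂

/-- `Φ ⊗ Φ` for a functional `Φ`: apply `Φ` in the first variable and then in the second one. -/
def boxEval (Φ : (ℍ → ℂ) → ℂ) (K : ℍ → ℍ → ℂ) : ℂ := Φ fun τ₂ => Φ fun τ₁ => K τ₁ τ₂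

section Linear

variable {V : Type*} [AddCommGroup V] [Module ℂ V] {S : Submodule ℂ (ℍ → ℂ)} {ι : Type*} [Fintype ι]

lemma IsLinearOn.sum_smul {T : (ℍ → ℂ) → V} (hT : IsLinearOn S T) (c : ι → ℂ) (x : ι → ℍ → ℂ)
    (hx : ∀ j, x j ∈ S) : T (∑ j, c j • x j) = ∑ j, c j • T (x j) := by
  classical
  suffices h : ∀ s : Finset ι, T (∑ j ∈ s, c j • x j) = ∑ j ∈ s, c j • T (x j) from h _
  intro s
  induction s using Finset.induction_on with
  | empty => simpa using hT.smul 0 0 (zero_mem _)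
  | insert i s hi ih =>
    rw [Finset.sum_insert hi, Finset.sum_insert hi, hT.add _ (Submodule.smul_mem _ _ (hx i)) _
      (Submodule.sum_mem _ fun j _ => Submodule.smul_mem _ _ (hx j)), hT.smul _ _ (hx i), ih]

lemma IsLinearOn.slice {T : (ℍ → ℂ) → V} (hT : IsLinearOn S T) {x : ι → ℍ → ℂ} (hx : ∀ j, x j ∈ S)
    (c : ι → ℂ) : T (fun τ => ∑ j, x j τ * c j) = ∑ j, c j • T (x j) := by
  rw [← hT.sum_smul c x hx]
  congr 1
  funext τ
  rw [Finset.sum_apply]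
  exact Finset.sum_congr rfl fun j _ => mul_comm _ _

lemma IsLinearOn.onBoth_boxSum {T : (ℍ → ℂ) → (ℍ → ℂ)} (hT : IsLinearOn S T) {x y : ι → ℍ → ℂ}
    (hx : ∀ j, x j ∈ S) (hy : ∀ j, y j ∈ S) :
    onBoth T (boxSum x y) = boxSum (fun j => T (x j)) fun j => T (y j) := by
  funext τ₁ τ₂
  have h : (fun t₂ => T (fun t₁ => boxSum x y t₁ t₂) τ₁) = fun t₂ => ∑ j, y j t₂ * T (x j) τ₁ := by
    funext t₂
    simp only [boxSum]
    rw [hT.slice hx, Finset.sum_apply]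
    rfl
  rw [onBoth, h, hT.slice hy, Finset.sum_apply]
  rfl

lemma IsLinearOn.boxEval_boxSum {Φ : (ℍ → ℂ) → ℂ} (hΦ : IsLinearOn S Φ) {x y : ι → ℍ → ℂ}
    (hx : ∀ j, x j ∈ S) (hy : ∀ j, y j ∈ S) :
    boxEval Φ (boxSum x y) = ∑ j, Φ (x j) * Φ (y j) := by
  have h : (fun τ₂ => Φ fun τ₁ => boxSum x y τ₁ τ₂) = fun τ₂ => ∑ j, y j τ₂ * Φ (x j) := by
    funext τ₂
    simp only [boxSum]
    rw [hΦ.slice hx]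
    rfl
  rw [boxEval, h, hΦ.slice hy]
  rfl

end Linear

lemma isLinearOn_peterssonProduct {M : ℕ} [NeZero M] {w : ℤ} (hy : y ∈ cuspSpace M w) :
    IsLinearOn (cuspSpace M w) fun x => peterssonProduct M w x y where
  add x hx z hz := by
    rw [peterssonProduct_eq (add_mem hx hz) hy, peterssonProduct_eq hx hy, peterssonProduct_eq hz hy,
      pet_add_left (cuspSpace_le_cuspFn hx) (cuspSpace_le_cuspFn hz) (cuspSpace_le_cuspFn hy)]
  smul c x hx := by
    rw [peterssonProduct_eq (Submodule.smul_mem _ c hx) hy, peterssonProduct_eq hx hy,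
      pet_smul_left (cuspSpace_le_cuspFn hx) (cuspSpace_le_cuspFn hy), smul_eq_mul]

lemma isLinearOn_isotypicProj {M : ℕ} [NeZero M] {w : ℤ} {φ : ℍ → ℂ} :
    IsLinearOn (cuspSpace M w) (isotypicProj M w φ) where
  add _ hx _ hz := isotypicProj_add hx hz
  smul c _ hx := isotypicProj_smul hx c

lemma isLinearOn_ordFunctional {M p : ℕ} [NeZero M] [Fact p.Prime] {w : ℤ} {α β : ℂ}
    (hy : y ∈ cuspSpace M w) :
    IsLinearOn (cuspSpace M w) (ordFunctional w p α β y) where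
  add _ hx _ hz := ordFunctional_add (cuspSpace_le_cuspFn hx) (cuspSpace_le_cuspFn hz)
    (cuspSpace_le_cuspFn hy)
  smul c _ hx := ordFunctional_smul (cuspSpace_le_cuspFn hx) (cuspSpace_le_cuspFn hy) c

/-! ### The ordinary functional applied to the Hecke kernels of levels N and Np -/

section Ordinary

variable {N p k : ℕ} [NeZero N] [hp : Fact p.Prime] {w : ℤ} {ι : ℂ ≃+* ℂ_[p]} {φ : ℍ → ℂ} {α β : ℂ}

lemma IsOrdinary.ordProj_eq (H : IsOrdinary N p w ι φ α β) (hx : x ∈ isotypic (N * p) w φ) :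
    ordProj p ι (N * p) w x = (α - β)⁻¹ • (opU p x - β • x) :=
  ordProj_of_isotypic H.not_dvd ι H.eigen H.add_eq H.mul_eq H.norm_unit H.norm_lt hx

lemma IsOrdinary.isLinearOn_ordProj (H : IsOrdinary N p w ι φ α β) :
    IsLinearOn (isotypic (N * p) w φ) (ordProj p ι (N * p) w) where
  add x hx y hy := by
    rw [H.ordProj_eq (add_mem hx hy), H.ordProj_eq hx, H.ordProj_eq hy, map_add]
    module
  smul c x hx := by
    rw [H.ordProj_eq (Submodule.smul_mem _ c hx), H.ordProj_eq hx, _root_.map_smul]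
    module

lemma IsOrdinary.ordProj_mem (H : IsOrdinary N p w ι φ α β) (hx : x ∈ isotypic (N * p) w φ) :
    ordProj p ι (N * p) w x ∈ cuspSpace (N * p) w := by
  rw [H.ordProj_eq hx]
  exact Submodule.smul_mem _ _ (sub_mem (opU_mem_isotypic hp.out (Dvd.intro_left N rfl) hx).1
    (Submodule.smul_mem _ _ hx.1))

/-- The left hand side of the main identity is the ordinary functional applied in both variables. -/
lemma IsOrdinary.peterssonProduct₂_boxSum (H : IsOrdinary N p w ι φ α β) {κ : Type*} [Fintype κ]
    {x y : κ → ℍ → ℂ} (hx : ∀ j, x j ∈ cuspSpace (N * p) w) (hy : ∀ j, y j ∈ cuspSpace (N * p) w) :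
    peterssonProduct₂ (N * p) w (onBoth (ordProj p ι (N * p) w)
      (onBoth (isotypicProj (N * p) w φ) (boxSum x y))) (stabilisation p β φ) (stabilisation p β φ) =
      boxEval (ordFunctional w p α β (stabilisation p β φ)) (boxSum x y) := by
  have hs := (stabilisation_mem_isotypic (p := p) (β := β) H.eigen).1
  have he : ∀ x ∈ cuspSpace (N * p) w, isotypicProj (N * p) w φ x ∈ isotypic (N * p) w φ :=
    fun x hx => (isotypicProj_spec hx).1
  have ho : ∀ x ∈ cuspSpace (N * p) w,
      peterssonProduct (N * p) w (ordProj p ι (N * p) w (isotypicProj (N * p) w φ x))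
        (stabilisation p β φ) = ordFunctional w p α β (stabilisation p β φ) x := fun x hx => by
    rw [peterssonProduct_eq (H.ordProj_mem (he x hx)) hs, H.pet_ordProj hx]
  rw [isLinearOn_isotypicProj.onBoth_boxSum hx hy,
    H.isLinearOn_ordProj.onBoth_boxSum (fun j => he _ (hx j)) fun j => he _ (hy j),
    (isLinearOn_ordFunctional hs).boxEval_boxSum hx hy]
  refine ((isLinearOn_peterssonProduct hs).boxEval_boxSum (fun j => H.ordProj_mem (he _ (hx j)))
    fun j => H.ordProj_mem (he _ (hy j))).trans ?_
  exact Finset.sum_congr rfl fun j _ => by rw [ho _ (hx j), ho _ (hy j)]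

lemma exists_heckeKernel_eq_boxSum (M k : ℕ) [NeZero M] :
    ∃ (B : ℕ) (b : Fin B → ℍ → ℂ), (∀ j, b j ∈ cuspSpace M (k + 1)) ∧
      ∀ g ∈ cuspSpace M (k + 1), heckeKernel M k g = boxSum b fun j => heckeOp M k j g := by
  obtain ⟨B, b, hbm, hb⟩ := exists_dual_basis M (k + 1)
  exact ⟨B, b, hbm, fun g hg => funext fun τ₁ => funext fun τ₂ =>
    (hasSum_heckeKernel hb hg τ₁ τ₂).tsum_eq⟩

lemma isLinearOn_boxEval_heckeKernel {M : ℕ} [NeZero M] {Φ : (ℍ → ℂ) → ℂ}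
    (hΦ : IsLinearOn (cuspSpace M (k + 1)) Φ) :
    IsLinearOn (cuspSpace M (k + 1)) fun g => boxEval Φ (heckeKernel M k g) := by
  obtain ⟨B, b, hbm, hb⟩ := exists_heckeKernel_eq_boxSum M k
  have key : ∀ g ∈ cuspSpace M (k + 1), boxEval Φ (heckeKernel M k g) =
      ∑ j : Fin B, Φ (b j) * Φ (heckeOp M k j g) := fun g hg => by
    rw [hb g hg, hΦ.boxEval_boxSum hbm fun j => heckeOp_mem_cuspSpace hg j]
  refine ⟨fun x hx y hy => ?_, fun c x hx => ?_⟩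
  · rw [key _ (add_mem hx hy), key x hx, key y hy, ← Finset.sum_add_distrib]
    refine Finset.sum_congr rfl fun j _ => ?_
    rw [heckeOp_add, hΦ.add _ (heckeOp_mem_cuspSpace hx j) _ (heckeOp_mem_cuspSpace hy j), mul_add]
  · rw [key _ (Submodule.smul_mem _ c hx), key x hx, Finset.smul_sum]
    refine Finset.sum_congr rfl fun j _ => ?_
    rw [heckeOp_smul, hΦ.smul _ _ (heckeOp_mem_cuspSpace hx j), smul_eq_mul, smul_eq_mul,
      mul_left_comm]

/-- U commutes with each T_j of level Np, so it passes onto the second factor of the finite sum. It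
produces a single α although the functional acts in both variables. -/
lemma IsOrdinary.boxEval_heckeKernel_opU (H : IsOrdinary N p (k + 1) ι φ α β)
    (hx : x ∈ cuspSpace (N * p) (k + 1)) :
    boxEval (ordFunctional (k + 1) p α β (stabilisation p β φ)) (heckeKernel (N * p) k (opU p x)) =
      α * boxEval (ordFunctional (k + 1) p α β (stabilisation p β φ)) (heckeKernel (N * p) k x) := by
  obtain ⟨B, b, hbm, hb⟩ := exists_heckeKernel_eq_boxSum (N * p) k
  have hΦ := isLinearOn_ordFunctional (p := p) (α := α) (β := β)
    (stabilisation_mem_isotypic (p := p) (β := β) H.eigen).1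
  have hU := opU_mem_cuspSpace' hp.out (Dvd.intro_left N rfl) hx
  rw [hb x hx, hb _ hU, hΦ.boxEval_boxSum hbm fun j => heckeOp_mem_cuspSpace hU j,
    hΦ.boxEval_boxSum hbm fun j => heckeOp_mem_cuspSpace hx j, Finset.mul_sum]
  refine Finset.sum_congr rfl fun j _ => ?_
  rw [heckeOp_opU hp.out (Dvd.intro_left N rfl) hx, H.ordFunctional_opU (heckeOp_mem_cuspSpace hx j),
    mul_left_comm]

lemma qParam_pow_eq (p : ℕ) [NeZero p] (τ : ℍ) : 𝕢 1 (diagR p 1 • τ : ℍ) = 𝕢 1 τ ^ p := by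
  rw [coe_diagR_smul, Function.Periodic.qParam, Function.Periodic.qParam, ← Complex.exp_nat_mul]
  congr 1
  push_cast
  ring

/-- The divisors divisible by p are the only difference: T_m in level Np is T_m − p^k V T_{m/p} in
level N. Summing the correction over multiples of p replaces τ₂ by pτ₂. -/
lemma heckeKernel_level (hpN : ¬ p ∣ N) {g : ℍ → ℂ} (hg : g ∈ cuspSpace N (k + 1)) (τ₁ τ₂ : ℍ) :
    heckeKernel (N * p) k g τ₁ τ₂ = heckeKernel N k g τ₁ τ₂ -
      (p : ℂ) ^ k * heckeKernel N k g (diagR p 1 • τ₁) (diagR p 1 • τ₂) := by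
  obtain ⟨B, b, hbm, hb⟩ := exists_dual_basis N (k + 1)
  have hq := qfn_of_cuspSpace hg
  have h1 := (hasSum_heckeKernel hb hg τ₁ τ₂).summable.hasSum
  have h2 := (hasSum_heckeKernel hb hg (diagR p 1 • τ₁) (diagR p 1 • τ₂)).summable.hasSum
  have hi : Function.Injective fun m : ℕ => p * m := mul_right_injective₀ hp.out.ne_zero
  have h3 : HasSum (fun m : ℕ => (if p ∣ m then heckeOp N k (m / p) g (diagR p 1 • τ₁) else 0) *
      𝕢 1 τ₂ ^ m) (heckeKernel N k g (diagR p 1 • τ₁) (diagR p 1 • τ₂)) := by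
    refine (hi.hasSum_iff fun m hm => ?_).mp ?_
    · rw [if_neg fun ⟨s, hs⟩ => hm ⟨s, hs.symm⟩, zero_mul]
    · refine (congrArg (HasSum · _) (funext fun m => ?_)).mp h2
      simp only [Function.comp_apply]
      rw [if_pos (Dvd.intro _ rfl), Nat.mul_div_cancel_left _ hp.out.pos, qParam_pow_eq, pow_mul]
  have hT : ∀ m, heckeOp (N * p) k m g = heckeOp N k m g -
      (p : ℂ) ^ k • (if p ∣ m then opV p (heckeOp N k (m / p) g) else 0) := fun m => by
    have hm := qfn_of_cuspSpace (heckeOp_mem_cuspSpace hg m)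
    have hmp := qfn_of_cuspSpace (heckeOp_mem_cuspSpace hg (m / p))
    have hif : QFn (if p ∣ m then opV p (heckeOp N k (m / p) g) else 0) := by
      split_ifs
      · exact hmp.opV p
      · exact QFn.zero
    have hg' : g ∈ cuspSpace (N * p) (k + 1) := cuspSpace_mono (Dvd.intro _ rfl) hg
    refine (qfn_of_cuspSpace (heckeOp_mem_cuspSpace hg' m)).ext (hm.sub (hif.smul _)) fun n => ?_
    rw [coeff_heckeOp hg', hm.coeff_sub (hif.smul _), coeff_heckeOp hg, hif.coeff_smul,
      heckeCoeff_level hp.out hpN]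
    congr 2
    by_cases h : p ∣ m
    · rw [if_pos h, hmp.coeff_V, coeff_heckeOp hg]
      simp [h]
    · rw [if_neg h, fourierCoeff_zero_fn, if_neg fun h' => h h'.1]
  rw [heckeKernel]
  refine HasSum.tsum_eq ?_
  refine (congrArg (HasSum · _) (funext fun m => ?_)).mp (h1.sub (h3.mul_left ((p : ℂ) ^ k)))
  rw [hT, Pi.sub_apply, Pi.smul_apply, smul_eq_mul]
  split_ifs
  · rw [opV_apply]
    ring
  · simp

/-- Each V costs α⁻¹, so the correction by V in both variables gives 1 − p^k/α² = 1 − β/α. Each of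
the two applications of the functional gives a κ. -/
lemma IsOrdinary.boxEval_heckeKernel_level (H : IsOrdinary N p (k + 1) ι φ α β)
    {g : ℍ → ℂ} (hg : g ∈ cuspSpace N (k + 1)) {κ : ℂ}
    (hκ : ∀ x ∈ cuspSpace N (k + 1),
      ordFunctional (k + 1) p α β (stabilisation p β φ) x = κ * pet (k + 1) x φ) :
    boxEval (ordFunctional (k + 1) p α β (stabilisation p β φ)) (heckeKernel (N * p) k g) =
      (1 - β / α) * κ ^ 2 * peterssonProduct₂ N (k + 1) (heckeKernel N k g) φ φ := by
  obtain ⟨B, b, hbm, hb⟩ := exists_heckeKernel_eq_boxSum N k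
  have hT := fun j => heckeOp_mem_cuspSpace hg j
  have hΦ := isLinearOn_ordFunctional (p := p) (α := α) (β := β)
    (stabilisation_mem_isotypic (p := p) (β := β) H.eigen).1
  have hle : ∀ {x}, x ∈ cuspSpace N (k + 1) → x ∈ cuspSpace (N * p) (k + 1) := fun hx =>
    cuspSpace_mono (Dvd.intro _ rfl) hx
  have h1 : heckeKernel (N * p) k g = boxSum
      (Sum.elim b fun j => (-(p : ℂ) ^ k) • opV p (b j))
      (Sum.elim (fun j : Fin B => heckeOp N k j g) fun j : Fin B => opV p (heckeOp N k j g)) := by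
    funext τ₁ τ₂
    rw [heckeKernel_level H.not_dvd hg, hb g hg]
    simp only [boxSum, Fintype.sum_sum_type, Sum.elim_inl, Sum.elim_inr, Pi.smul_apply, opV_apply,
      smul_eq_mul, sub_eq_add_neg, Finset.mul_sum, ← Finset.sum_neg_distrib]
    congr 1
    exact Finset.sum_congr rfl fun j _ => by ring
  have hx : ∀ i, Sum.elim b (fun j => (-(p : ℂ) ^ k) • opV p (b j)) i ∈ cuspSpace (N * p) (k + 1) := by
    rintro (j | j)
    · exact hle (hbm j)
    · exact Submodule.smul_mem _ _ (opV_mem_cuspSpace (hbm j))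
  have hy : ∀ i, Sum.elim (fun j : Fin B => heckeOp N k j g) (fun j : Fin B => opV p (heckeOp N k j g)) i ∈
      cuspSpace (N * p) (k + 1) := by
    rintro (j | j)
    · exact hle (hT j)
    · exact opV_mem_cuspSpace (hT j)
  have h2 : peterssonProduct₂ N (k + 1) (heckeKernel N k g) φ φ =
      ∑ j : Fin B, pet (k + 1) (b j) φ * pet (k + 1) (heckeOp N k j g) φ := by
    rw [hb g hg]
    refine ((isLinearOn_peterssonProduct H.eigen.mem).boxEval_boxSum hbm fun j => hT j).trans ?_
    exact Finset.sum_congr rfl fun j _ => by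
      rw [peterssonProduct_eq (hbm j) H.eigen.mem, peterssonProduct_eq (hT j) H.eigen.mem]
  have hα := H.unit_ne_zero
  have hαβ : α * β = (p : ℂ) ^ k := by simpa using H.mul_eq
  rw [h1, hΦ.boxEval_boxSum hx hy, h2, Fintype.sum_sum_type, ← Finset.sum_add_distrib,
    Finset.mul_sum]
  refine Finset.sum_congr rfl fun j _ => ?_
  simp only [Sum.elim_inl, Sum.elim_inr]
  rw [hΦ.smul _ _ (opV_mem_cuspSpace (hbm j)), H.ordFunctional_opV (hbm j),
    H.ordFunctional_opV (hT j), hκ _ (hbm j), hκ _ (hT j), smul_eq_mul, ← hαβ]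
  field_simp
  ring

end Ordinary

end

/-! ### Evaluation on the two pullbacks and the final computation -/

section

lemma exists_stabCoeff_le {p j : ℕ} {αf βf : ℂ} {c : ℕ → ℂ} {C : ℝ} (hC : 0 ≤ C)
    (hc : ∀ n, ‖c n‖ ≤ C * (n : ℝ) ^ j) :
    ∃ C' : ℝ, 0 ≤ C' ∧ ∀ n, ‖stabCoeff p αf βf c n‖ ≤ C' * (n : ℝ) ^ j := by
  refine ⟨‖αf⁻¹‖ * (C * ((p : ℝ) ^ 2) ^ j + ‖βf‖ * C), by positivity, fun n => ?_⟩
  rw [stabCoeff, norm_mul, mul_assoc]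
  refine mul_le_mul_of_nonneg_left ((norm_sub_le _ _).trans ?_) (norm_nonneg _)
  rw [norm_mul, add_mul]
  refine add_le_add ((hc _).trans_eq ?_) ?_
  · push_cast
    ring
  · rw [mul_assoc]
    exact mul_le_mul_of_nonneg_left (hc n) (norm_nonneg _)

section PlusForms

variable {N k p : ℕ} [NeZero N] [hp : Fact p.Prime] {ι : ℂ ≃+* ℂ_[p]} {f h φ : ℍ → ℂ}
  {αf βf α β : ℂ}

lemma IsKohnenPlusForm.pullback_eq (hh : IsKohnenPlusForm N k h) (hk : Odd k) :
    pullback (saitoKurokawa N k (fourierCoeff h)) = heckeKernel N k (plusProd 1 h) := by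
  obtain ⟨C, hC, hc⟩ := hh.exists_coeff_le
  exact pullback_saitoKurokawa hC hh.coeff_zero hc (qfn_of_cuspSpace (hh.plusProd_one_mem hk))
    (hh.coeff_plusProd hk 1)

lemma IsKohnenPlusForm.pullback_stab_eq (hh : IsKohnenPlusForm N k h) (hk : Odd k) :
    pullback (saitoKurokawa (N * p) k (stabCoeff p αf βf (fourierCoeff h))) =
      heckeKernel (N * p) k (stabProd p αf βf h) := by
  obtain ⟨C, hC, hc⟩ := hh.exists_coeff_le
  obtain ⟨C', hC', hc'⟩ := exists_stabCoeff_le (p := p) (αf := αf) (βf := βf) hC hc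
  exact pullback_saitoKurokawa hC' (stabCoeff_zero hh.coeff_zero) hc'
    (qfn_of_cuspSpace (hh.stabProd_mem hk)) (hh.coeff_stabProd hk)

/-- The functional is linear in the form and turns U² into α², so the relation between G_α and G
becomes a scalar equation. -/
lemma IsOrdinary.boxEval_stabProd (H : IsOrdinary N p (k + 1) ι φ α β)
    (hh : IsKohnenPlusForm N k h) (hk : Odd k) (hp2 : p ≠ 2) (hfh : InShimuraShintani N k f h)
    (hsum : αf + βf = fourierCoeff f p) (hprod : αf * βf = (p : ℂ) ^ (2 * k - 1)) :
    (α ^ 2 - (p : ℂ) ^ (k - 1)) * boxEval (ordFunctional (k + 1) p α β (stabilisation p β φ))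
        (heckeKernel (N * p) k (stabProd p αf βf h)) =
      (1 - αf⁻¹ * (p : ℂ) ^ (k - 1)) * (α ^ 2 - βf) *
        boxEval (ordFunctional (k + 1) p α β (stabilisation p β φ))
          (heckeKernel (N * p) k (plusProd 1 h)) := by
  set Φ := ordFunctional (k + 1) p α β (stabilisation p β φ) with hΦdef
  have hΦ : IsLinearOn (cuspSpace (N * p) (k + 1)) Φ :=
    isLinearOn_ordFunctional (stabilisation_mem_isotypic (p := p) (β := β) H.eigen).1
  have hL := isLinearOn_boxEval_heckeKernel hΦ
  set L : (ℍ → ℂ) → ℂ := fun g => boxEval Φ (heckeKernel (N * p) k g) with hLdef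
  have hpM : p ∣ N * p := Dvd.intro_left N rfl
  have hLU : ∀ x ∈ cuspSpace (N * p) (k + 1), L (opU p (opU p x)) = α ^ 2 * L x := fun x hx => by
    rw [hLdef]
    simp only
    rw [H.boxEval_heckeKernel_opU (opU_mem_cuspSpace' hp.out hpM hx), H.boxEval_heckeKernel_opU hx]
    ring
  have hL' : ∀ x ∈ cuspSpace (N * p) (k + 1), ∀ y ∈ cuspSpace (N * p) (k + 1), ∀ c : ℂ,
      L (x - c • y) = L x - c * L y := fun x hx y hy c => by
    rw [show x - c • y = x + (-c) • y by module, hL.add x hx _ (Submodule.smul_mem _ _ hy),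
      hL.smul _ y hy, smul_eq_mul]
    ring
  have hUU : ∀ x ∈ cuspSpace (N * p) (k + 1), opU p (opU p x) ∈ cuspSpace (N * p) (k + 1) :=
    fun x hx => opU_mem_cuspSpace' hp.out hpM (opU_mem_cuspSpace' hp.out hpM hx)
  have hG : plusProd 1 h ∈ cuspSpace (N * p) (k + 1) :=
    cuspSpace_mono (Dvd.intro _ rfl) (hh.plusProd_one_mem hk)
  have hGα : stabProd p αf βf h ∈ cuspSpace (N * p) (k + 1) := hh.stabProd_mem hk
  have key := congrArg L (hh.opU_opU_stabProd hk H.not_dvd hp2 hfh hsum hprod)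
  rw [hL' _ (hUU _ hGα) _ hGα, hLU _ hGα, hL.smul _ _ (sub_mem (hUU _ hG) (Submodule.smul_mem _ _ hG)),
    hL' _ (hUU _ hG) _ hG, hLU _ hG, smul_eq_mul] at key
  change (α ^ 2 - (p : ℂ) ^ (k - 1)) * L (stabProd p αf βf h) =
    (1 - αf⁻¹ * (p : ℂ) ^ (k - 1)) * (α ^ 2 - βf) * L (plusProd 1 h)
  linear_combination key

end PlusForms

end

end SKPullback

end

open SKPullback in
theorem corollaryA3 (N k p : ℕ) [Fact p.Prime]
    (hN : Odd N) (hN' : Squarefree N) (hk : Odd k) (hp : p ≠ 2) (hpN : ¬ p ∣ N)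
    (ι : ℂ ≃+* ℂ_[p])
    (f : UpperHalfPlane → ℂ) (hf : IsNormalisedEigenform N (2 * k) f)
    (h : UpperHalfPlane → ℂ) (hh : IsKohnenPlusForm N k h) (hfh : InShimuraShintani N k f h)
    (αf βf : ℂ) (hf_sum : αf + βf = fourierCoeff f p) (hf_prod : αf * βf = (p : ℂ) ^ (2 * k - 1))
    (φ : UpperHalfPlane → ℂ) (hφ : IsNormalisedEigenform N (k + 1) φ)
    (α β : ℂ) (hφ_sum : α + β = fourierCoeff φ p) (hφ_prod : α * β = (p : ℂ) ^ k)
    (hφ_ord : ‖ι α‖ = 1)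
    (F Fα : SiegelUpperHalfSpace → ℂ)
    (hF : F = saitoKurokawa N k (fourierCoeff h))
    (hFα : Fα = saitoKurokawa (N * p) k (stabCoeff p αf βf (fourierCoeff h)))
    (φα : UpperHalfPlane → ℂ) (hφα : φα = stabilisation p β φ) :
    -- the pullbacks lie in the tensor products, and the denominators do not vanish
    pullback F ∈ boxTensor (cuspSpace N (k + 1)) (cuspSpace N (k + 1)) ∧
    pullback Fα ∈ boxTensor (cuspSpace (N * p) (k + 1)) (cuspSpace (N * p) (k + 1)) ∧
    peterssonProduct N (k + 1) φ φ ≠ 0 ∧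
    peterssonProduct (N * p) (k + 1) φα φα ≠ 0 ∧
    eulerAd p α β ≠ 0 ∧
    -- the identity
    peterssonProduct₂ (N * p) (k + 1)
        (onBoth (ordProj p ι (N * p) (k + 1))
          (onBoth (isotypicProj (N * p) (k + 1) φ) (pullback Fα))) φα φα /
        peterssonProduct (N * p) (k + 1) φα φα ^ 2 =
      eulerCirc p k βf α β / eulerAd p α β *
        (peterssonProduct₂ N (k + 1) (pullback F) φ φ / peterssonProduct N (k + 1) φ φ ^ 2) := by
  have hp' : p.Prime := Fact.out
  have : NeZero N := ⟨hN'.ne_zero⟩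
  have hk1 : 1 ≤ k := hk.pos
  have hp0 : (p : ℂ) ≠ 0 := Nat.cast_ne_zero.mpr hp'.ne_zero
  subst hF hFα hφα
  have H : IsOrdinary N p (k + 1) ι φ α β :=
    { eigen := hφ
      not_dvd := hpN
      add_eq := hφ_sum
      mul_eq := by simpa using hφ_prod
      norm_unit := hφ_ord
      norm_lt := by
        -- From αβ = p^k and |α| = 1 follows |β| = p^{−k} < 1.
        have h1 := congrArg (fun z => ‖ι z‖) hφ_prod
        simp only [map_mul, map_pow, map_natCast, norm_mul, norm_pow, hφ_ord, one_mul,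
          norm_p_padicComplex] at h1
        rw [h1]
        exact pow_lt_one₀ (by positivity)
          (inv_lt_one_of_one_lt₀ (by exact_mod_cast hp'.one_lt)) (by omega) }
  have hG := hh.plusProd_one_mem hk
  have hGα : stabProd p αf βf h ∈ cuspSpace (N * p) (k + 1) := hh.stabProd_mem hk
  have hs := (stabilisation_mem_isotypic (p := p) (β := β) hφ).1
  have hP := hφ.pet_ne_zero
  have hPα := pet_stabilisation_ne_zero (p := p) (β := β) hφ
  have hE := H.eulerAd_ne_zero hk1
  rw [hh.pullback_eq hk, hh.pullback_stab_eq hk, peterssonProduct_eq hφ.mem hφ.mem,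
    peterssonProduct_eq hs hs]
  refine ⟨heckeKernel_mem_boxTensor hG, heckeKernel_mem_boxTensor hGα, hP, hPα, hE, ?_⟩
  obtain ⟨κ, hκ⟩ := H.exists_ordFunctional_eq
  obtain ⟨B, b, hbm, hb⟩ := exists_heckeKernel_eq_boxSum (N * p) k
  have h1 : peterssonProduct₂ (N * p) (k + 1) (onBoth (ordProj p ι (N * p) (k + 1))
      (onBoth (isotypicProj (N * p) (k + 1) φ) (heckeKernel (N * p) k (stabProd p αf βf h))))
      (stabilisation p β φ) (stabilisation p β φ) =
      boxEval (ordFunctional (k + 1) p α β (stabilisation p β φ))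
        (heckeKernel (N * p) k (stabProd p αf βf h)) := by
    rw [hb _ hGα]
    exact H.peterssonProduct₂_boxSum hbm fun j => heckeOp_mem_cuspSpace hGα j
  have h2 := H.boxEval_stabProd hh hk hp hfh hf_sum hf_prod
  rw [H.boxEval_heckeKernel_level hG hκ] at h2
  have h3 := H.pet_stabilisation hκ
  rw [h1, h3]
  rw [h3] at hPα
  generalize boxEval (ordFunctional (k + 1) p α β (stabilisation p β φ))
    (heckeKernel (N * p) k (stabProd p αf βf h)) = Λ at h2 ⊢
  generalize peterssonProduct₂ N (k + 1) (heckeKernel N k (plusProd 1 h)) φ φ = Q at h2 ⊢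
  generalize pet (k + 1) φ φ = P at hP hPα ⊢
  -- The formula for ⟨φ_α, φ_α⟩ contains κ as a factor, so positivity of that norm forces κ ≠ 0.
  have hκ0 : κ ≠ 0 := right_ne_zero_of_mul (left_ne_zero_of_mul hPα)
  have hα := H.unit_ne_zero
  have hαf : αf ≠ 0 := left_ne_zero_of_mul (hf_prod.trans_ne (pow_ne_zero _ hp0))
  have hβ : β ≠ 0 := right_ne_zero_of_mul (hφ_prod.trans_ne (pow_ne_zero _ hp0))
  have hsq : α ^ 2 - (p : ℂ) ^ (k - 1) ≠ 0 := sub_ne_zero.mpr (H.sq_ne hk1)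
  have hpk : (p : ℂ) * (p : ℂ) ^ (k - 1) = α * β := by
    rw [hφ_prod, ← pow_succ', Nat.sub_add_cancel hk1]
  -- Equivalent to α_fβ_f = p^{2k−1}. This is the first factor of ℰ°.
  have hfe : αf⁻¹ * (p : ℂ) ^ (k - 1) = βf / (p : ℂ) ^ k := by
    rw [inv_mul_eq_div, div_eq_div_iff hαf (pow_ne_zero _ hp0), ← pow_add, mul_comm βf, hf_prod]
    congr 1
    omega
  rw [hfe] at h2
  rw [eulerCirc, eulerAd] at *
  rw [← hφ_prod] at h2 ⊢
  -- From p·p^{k−1} = αβ: dividing the scalar relation by α² yields the second factors of ℰ(Ad φ)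
  -- and, in the next identity, of ℰ°.
  have h4 : 1 - β / (p * α) = (α ^ 2 - (p : ℂ) ^ (k - 1)) / α ^ 2 := by
    field_simp
    linear_combination hpk
  have h5 : 1 - βf * β / α / (α * β) = (α ^ 2 - βf) / α ^ 2 := by
    field_simp
  have h6 : 1 - β / α ≠ 0 := left_ne_zero_of_mul hE
  rw [h4, h5]
  generalize 1 - β / α = A at h2 hPα hE h6 ⊢
  generalize 1 - βf / (α * β) = D at h2 ⊢
  generalize α ^ 2 - (p : ℂ) ^ (k - 1) = S at h2 hsq ⊢
  have h7 : Λ = D * (α ^ 2 - βf) * (A * κ ^ 2 * Q) / S := by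
    rw [eq_div_iff hsq, ← h2, mul_comm]
  rw [h7]
  field_simp
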